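/- Let $M$ be a compact Riemannian symmetric space of rank one: a sphere $\mathbb S^d$ ($d\ge2$), a projective space $P_d(\mathbb R)$ ($d\ge2$), $P_l(\mathbb C)$, $P_l(\mathbb H)$ ($l\ge 2$), or the Cayley plane. Put $\rho_M(\theta)=(\sin\theta)^{-2}$ if $M$ is a sphere and $\rho_M(\theta)=(\sin\frac\theta2)^{-2}$ otherwise, for $\theta\in(0,\pi)$. For $\alpha,\beta>-1/2$ let $d\mu_{\alpha,\beta}(\theta)=(\sin\frac\theta2)^{2\alpha+1}(\cos\frac\theta2)^{2\beta+1}\,d\theta$ on $(0,\pi)$, let $P_n^{(\alpha,\beta)}$ be the Jacobi polynomials and let $$\mathcal P_n^{(\alpha,\beta)}(\theta)=\left(\frac{(2n+\alpha+\beta+1)\Gamma(n+1)\Gamma(n+\alpha+\beta+1)}{\Gamma(n+\alpha+1)\Gamma(n+\beta+1)}\right)^{1/2}P_n^{(\alpha,\beta)}(\cos\theta)$$ be the trigonometric Jacobi polynomials, an orthonormal basis of $L^2(d\mu_{\alpha,\beta})$ of eigenfunctions of the Jacobi operator $\mathcal J^{\alpha,\beta}$ with eigenvalues $(n+\frac{\alpha+\beta+1}2)^2$.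 Let $$\mathcal P_t^{\alpha,\beta}(\theta,\varphi)=\sum_{n\ge0}e^{-t|n+\frac{\alpha+\beta+1}2|}\,\mathcal P_n^{(\alpha,\beta)}(\theta)\,\mathcal P_n^{(\alpha,\beta)}(\varphi),\qquad T_M^{\alpha,\beta}(\theta,\varphi)=\sqrt{\rho_M(\theta)}\int_0^\infty\mathcal P_t^{\alpha,\beta}(\theta,\varphi)\,dt ,$$ so that $T_M^{\alpha,\beta}$ is the kernel of $\sqrt{\rho_M}\,(\mathcal J^{\alpha,\beta})^{-1/2}$ with respect to $\mu_{\alpha,\beta}$. **Theorem.** Let $\alpha,\beta>-1/2$, $a=1$ or $a\ge2$, $b=0$ or $b\ge1$, and for $j\ge1$ let $u_j(\theta)=(\sin\frac\theta2)^{aj}(\cos\frac\theta2)^{bj}$. For all $j\ge1$ and all $\theta\ne\varphi$ in $(0,\pi)$ the series (for every $t>0$) and the integral that define $T_M^{\alpha+aj,\beta+bj}(\theta,\varphi)$ converge absolutely. Moreover: 1. If $M$ is not a sphere, or $b\ge1$, then there is a constant $C_1>0$, independent of $j$, such that for all $j\ge1$ and all $\theta\neq\varphi$ in $(0,\pi)$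 $$|j\,u_j(\theta)u_j(\varphi)T_M^{\alpha+aj,\beta+bj}(\theta,\varphi)|\le\frac{C_1}{\mu_{\alpha,\beta}(B(\theta,|\theta-\varphi|))}.$$ 2. If $M$ is not a sphere, or $b=1$, or $b\ge2$, then there is a constant $C_2>0$, independent of $j$, such that for all $j\ge1$ and all $\theta\neq\varphi$ in $(0,\pi)$ the kernel $u_j(\theta)u_j(\varphi)T_M^{\alpha+aj,\beta+bj}(\theta,\varphi)$ is differentiable at $(\theta,\varphi)$ and $$|j\,\nabla_{\theta,\varphi}(u_j(\theta)u_j(\varphi)T_M^{\alpha+aj,\beta+bj}(\theta,\varphi))|\le\frac{C_2}{|\theta-\varphi|\,\mu_{\alpha,\beta}(B(\theta,|\theta-\varphi|))}.$$ Here $B(\theta,r)$ is the interval with centre $\theta$ and radius $r$ (intersected with $(0,\pi)$), and $|\nabla_{\theta,\varphi}K|$ is the Euclidean length of $(\partial_\theta K,\partial_\varphi K)$. -/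

import Mathlib

open Set MeasureTheory

noncomputable section

namespace JacobiRiesz

/-- Wang's list of the compact Riemannian symmetric spaces of rank one: the spheres `S^d`, the real,
complex and quaternionic projective spaces `P_d(ℝ)`, `P_l(ℂ)`, `P_l(ℍ)`, and the Cayley plane.
Only the polar coordinate weight `rho M` below depends on the space. -/
inductive RankOneSpace : Type
  | sphere (d : ℕ) (hd : 2 ≤ d)
  | realProjective (d : ℕ) (hd : 2 ≤ d)
  | complexProjective (l : ℕ) (hl : 2 ≤ l)
  | quaternionicProjective (l : ℕ) (hl : 2 ≤ l)
  | cayleyPlane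

/-- `M` is one of the spheres `S^d`. -/
def RankOneSpace.IsSphere : RankOneSpace → Prop
  | .sphere _ _ => True
  | _ => False

/-- The weight `ρ_M(θ)` in front of the angular Laplacian: `1 / sin² θ` on the spheres and
`1 / sin² (θ/2)` on the projective spaces. -/
def rho : RankOneSpace → ℝ → ℝ
  | .sphere _ _, θ => 1 / (Real.sin θ) ^ 2
  | .realProjective _ _, θ => 1 / (Real.sin (θ / 2)) ^ 2
  | .complexProjective _ _, θ => 1 / (Real.sin (θ / 2)) ^ 2
  | .quaternionicProjective _ _, θ => 1 / (Real.sin (θ / 2)) ^ 2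
  | .cayleyPlane, θ => 1 / (Real.sin (θ / 2)) ^ 2

/-- The Jacobi polynomial `P_n^{(α,β)}(x)`, `-1 < x < 1`, by Rodrigues' formula. -/
def jacobiP (α β : ℝ) (n : ℕ) (x : ℝ) : ℝ :=
  (1 - x) ^ (-α) * (1 + x) ^ (-β) * ((-1) ^ n / (2 ^ n * (n.factorial : ℝ))) *
    iteratedDeriv n (fun y : ℝ => (1 - y) ^ ((n : ℝ) + α) * (1 + y) ^ ((n : ℝ) + β)) x

/-- The normalizing factor `d_n^{α,β}`. -/
def jacobiNorm (α β : ℝ) (n : ℕ) : ℝ :=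
  Real.sqrt ((2 * n + α + β + 1) * Real.Gamma (n + 1) * Real.Gamma (n + α + β + 1) /
    (Real.Gamma (n + α + 1) * Real.Gamma (n + β + 1)))

/-- The normalized Jacobi trigonometric polynomial `𝒫_n^{(α,β)}(θ) = d_n^{α,β} P_n^{(α,β)}(cos θ)`. -/
def trigJacobi (α β : ℝ) (n : ℕ) (θ : ℝ) : ℝ :=
  jacobiNorm α β n * jacobiP α β n (Real.cos θ)

/-- The measure `dμ_{α,β}(θ) = sin(θ/2)^{2α+1} cos(θ/2)^{2β+1} dθ` on `(0, π)`. -/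
def jacobiMeasure (α β : ℝ) : Measure ℝ :=
  (volume.restrict (Ioo 0 Real.pi)).withDensity fun θ =>
    ENNReal.ofReal (Real.sin (θ / 2) ^ (2 * α + 1) * Real.cos (θ / 2) ^ (2 * β + 1))

/-- The `n`-th term of the series that defines the Jacobi-Poisson kernel. -/
def poissonTerm (α β t θ φ : ℝ) (n : ℕ) : ℝ :=
  Real.exp (-t * |(n : ℝ) + (α + β + 1) / 2|) * trigJacobi α β n θ * trigJacobi α β n φ

/-- The Jacobi-Poisson kernel `𝒫_t^{α,β}(θ,φ)`. -/
def poissonKernel (α β t θ φ : ℝ) : ℝ :=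
  ∑' n : ℕ, poissonTerm α β t θ φ n

/-- The kernel `T_M^{α,β}(θ,φ) = √ρ_M(θ) ∫_0^∞ 𝒫_t^{α,β}(θ,φ) dt` of `√ρ_M (𝒥^{α,β})^{-1/2}`
with respect to `dμ_{α,β}`. -/
def angularKernel (M : RankOneSpace) (α β θ φ : ℝ) : ℝ :=
  Real.sqrt (rho M θ) * ∫ t in Ioi (0 : ℝ), poissonKernel α β t θ φ

/-- The function `u_j(θ) = sin(θ/2)^{aj} cos(θ/2)^{bj}`. -/
def u (a b : ℝ) (j : ℕ) (θ : ℝ) : ℝ :=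
  Real.sin (θ / 2) ^ (a * j) * Real.cos (θ / 2) ^ (b * j)

/-- The kernel `u_j(θ) u_j(φ) T_M^{α+aj,β+bj}(θ,φ)`. -/
def weightedKernel (M : RankOneSpace) (α β a b : ℝ) (j : ℕ) (θ φ : ℝ) : ℝ :=
  u a b j θ * u a b j φ * angularKernel M (α + a * j) (β + b * j) θ φ

/-- The Euclidean length of the gradient `∇_{θ,φ} K = (∂K/∂θ, ∂K/∂φ)` at `(θ, φ)`. -/
def gradLength (K : ℝ → ℝ → ℝ) (θ φ : ℝ) : ℝ :=
  Real.sqrt ((deriv (fun x => K x φ) θ) ^ 2 + (deriv (fun y => K θ y) φ) ^ 2)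

end JacobiRiesz

end

noncomputable section
namespace JacobiRiesz

/-! ### The entire function behind the modified Bessel function -/

/-! Put B = sin(θ/2) sin(φ/2) and D = cos(θ/2) cos(φ/2). The proof first gives the time integral of
the Poisson kernel a closed form. For the parameters (α, β) it is the Laplace integral of e^{-z}
I_α(zB) I_β(zD), divided by B^α D^β (`poissonKernel_spec`). For the shifted parameters the factor
u_j(θ) u_j(φ) = B^{aj} D^{bj} cancels exactly the powers added to this denominator. The weighted
kernel is therefore the integral of e^{-z} I_{α+aj}(zB) I_{β+bj}(zD), with the normalization of the
unshifted parameters (`besselLaplace_eq_zero_zero`), times √ρ_M(θ).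

The closed form comes from a product formula (`productPoly_mul`). A product of two Jacobi
polynomials of degree n is a finite combination of the homogeneous parts, in (B², D²), of the entire
functions behind I_α and I_β. Both sides solve the Jacobi equation in each variable, and a solution
regular at 0 is determined by its value there. Multiplying by w^n with w = e^{-t} and exchanging the
sums gives a series with nonnegative terms. The exchange is legitimate for small w and extends to
(0, 1) by analyticity (`tsum_poissonCoeff_mul_pow`). Sonin's bound supplies the convergence of the
original series. Each term of the new series has an elementary antiderivative in t.

The estimates rest on bounds of I_{α+δ} that are uniform in δ (`exists_besselH_le`). The decay e^y
(1+y)^{-(α+1/2)} is kept, with α and not α+δ, and raising the order by m gains y/m², twice if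
needed. Both follow from I_ν - I_{ν+2} = (2(ν+1)/y) I_{ν+1} and I_{ν+1} ≤ I_ν. Now e^{-z} = e^{-qz}
e^{-zB} e^{-zD} with q = 1 - B - D = 1 - cos((θ-φ)/2), which is comparable to |θ-φ|². The last two
exponentials absorb the growth of the Bessel functions, the powers of z combine to 1/z over a
majorant of the volume, and part of e^{-qz} is left. The gain in the order produces √z sin(θ/2)/j,
which cancels the singularity of √ρ_M and supplies the factor 1/j. The integral of e^{-qz/4}
z^{-1/2} then gives 1/|θ-φ|.

For the gradient, the terms of size z cancel up to the factor sin((θ-φ)/2), and the derivative of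
1/sin(θ/2) combines with that of the Bessel factor into a quantity of second order at 0
(`exists_besselR_sub_le`, `exists_gradIntegrand_le`). The second-order smallness needs a = 1 or a ≥
2. On spheres 1/sin θ = (cot(θ/2) + tan(θ/2))/2, and the second half is the first one reflected in θ
↦ π - θ. The reflection exchanges (α, a) and (β, b), hence the conditions on b there. -/

lemma exists_inv_Gamma_le : ∃ C : ℝ, 0 < C ∧ ∀ x : ℝ, 1 / 2 ≤ x → (Real.Gamma x)⁻¹ ≤ C := by
  have hcont : ContinuousOn (fun x : ℝ => (Real.Gamma x)⁻¹) (Icc (1 / 2) 2) := by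
    intro x hx
    have hx0 : 0 < x := by linarith [hx.1]
    refine ContinuousAt.continuousWithinAt (ContinuousAt.inv₀ ?_ (Real.Gamma_pos_of_pos hx0).ne')
    refine (Real.differentiableAt_Gamma fun m => ?_).continuousAt
    have : (0 : ℝ) ≤ m := m.cast_nonneg
    linarith
  obtain ⟨C, hC⟩ := isCompact_Icc.bddAbove_image hcont
  refine ⟨max C 1, lt_of_lt_of_le one_pos (le_max_right _ _), fun x hx => ?_⟩
  rcases le_total x 2 with h | h
  · exact le_trans (hC ⟨x, ⟨hx, h⟩, rfl⟩) (le_max_left _ _)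
  · have h1 : Real.Gamma 2 ≤ Real.Gamma x :=
      Real.Gamma_strictMonoOn_Ici.monotoneOn (mem_Ici.2 le_rfl) (mem_Ici.2 h) h
    rw [Real.Gamma_two] at h1
    exact le_trans (inv_le_one_of_one_le₀ h1) (le_max_right _ _)

/-- A bound for the reciprocal of the Gamma function on `[1/2, ∞)`. -/
def invGammaBound : ℝ := exists_inv_Gamma_le.choose

lemma invGammaBound_pos : 0 < invGammaBound := exists_inv_Gamma_le.choose_spec.1

lemma inv_Gamma_le {x : ℝ} (hx : 1 / 2 ≤ x) : (Real.Gamma x)⁻¹ ≤ invGammaBound :=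
  exists_inv_Gamma_le.choose_spec.2 x hx

/-- The coefficients `1 / (i! Γ(i + ν + 1))`. -/
def besselCoeff (ν : ℝ) (i : ℕ) : ℝ := ((i.factorial : ℝ) * Real.Gamma (i + ν + 1))⁻¹

/-- The entire function `E_ν(w) = ∑ wⁱ / (i! Γ(i + ν + 1))`; the modified Bessel function is
`I_ν(y) = (y/2)^ν E_ν((y/2)²)`. -/
def besselE (ν w : ℝ) : ℝ := ∑' i : ℕ, besselCoeff ν i * w ^ i

variable {ν : ℝ}

lemma Gamma_nat_add_pos (hν : -(1 / 2) < ν) (i : ℕ) : 0 < Real.Gamma (i + ν + 1) := by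
  have : (0 : ℝ) ≤ i := i.cast_nonneg
  exact Real.Gamma_pos_of_pos (by linarith)

lemma besselCoeff_pos (hν : -(1 / 2) < ν) (i : ℕ) : 0 < besselCoeff ν i := by
  have := Gamma_nat_add_pos hν i
  unfold besselCoeff
  positivity

lemma besselCoeff_le (hν : -(1 / 2) < ν) (i : ℕ) :
    besselCoeff ν i ≤ invGammaBound * (i.factorial : ℝ)⁻¹ := by
  have : (0 : ℝ) ≤ i := i.cast_nonneg
  unfold besselCoeff
  rw [mul_inv, mul_comm]
  exact mul_le_mul_of_nonneg_right (inv_Gamma_le (by linarith)) (by positivity)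

/-- This is w E'' + (ν + 1) E' = E read off coefficientwise. It is the relation that later makes the
Jacobi operator act simply on the homogeneous parts of E_α E_β. -/
lemma besselCoeff_succ (hν : -(1 / 2) < ν) (i : ℕ) :
    ((i : ℝ) + 1) * (i + 1 + ν) * besselCoeff ν (i + 1) = besselCoeff ν i := by
  have h1 := Gamma_nat_add_pos hν i
  have h0 : (0 : ℝ) ≤ i := i.cast_nonneg
  have h2 : Real.Gamma ((i + 1 : ℕ) + ν + 1) = (i + ν + 1) * Real.Gamma (i + ν + 1) := by
    rw [← Real.Gamma_add_one (by linarith)]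
    push_cast
    ring_nf
  have h3 : (i : ℝ) + ν + 1 ≠ 0 := by linarith
  unfold besselCoeff
  rw [h2, Nat.factorial_succ]
  push_cast
  field_simp
  ring

/-- Coefficient form of E_ν' = E_{ν+1}. -/
lemma besselCoeff_add_one (i : ℕ) :
    ((i : ℝ) + 1) * besselCoeff ν (i + 1) = besselCoeff (ν + 1) i := by
  unfold besselCoeff
  rw [Nat.factorial_succ]
  have : ((i + 1 : ℕ) : ℝ) + ν + 1 = i + (ν + 1) + 1 := by push_cast; ring
  rw [this]
  push_cast
  have : (i : ℝ) + 1 ≠ 0 := by positivity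
  rw [mul_inv, mul_inv, mul_inv]
  field_simp

lemma summable_besselE (hν : -(1 / 2) < ν) (w : ℝ) :
    Summable fun i : ℕ => besselCoeff ν i * w ^ i := by
  refine Summable.of_norm_bounded ((Real.summable_pow_div_factorial |w|).mul_left invGammaBound)
    fun i => ?_
  rw [norm_mul, Real.norm_of_nonneg (besselCoeff_pos hν i).le, norm_pow, Real.norm_eq_abs,
    div_eq_mul_inv, mul_left_comm, mul_comm]
  exact mul_le_mul_of_nonneg_left (besselCoeff_le hν i) (by positivity)

lemma besselE_nonneg (hν : -(1 / 2) < ν) {w : ℝ} (hw : 0 ≤ w) : 0 ≤ besselE ν w :=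
  tsum_nonneg fun i => mul_nonneg (besselCoeff_pos hν i).le (by positivity)

lemma besselE_le_exp (hν : -(1 / 2) < ν) {w : ℝ} (hw : 0 ≤ w) :
    besselE ν w ≤ invGammaBound * Real.exp w := by
  rw [Real.exp_eq_exp_ℝ, NormedSpace.exp_eq_tsum_div, ← tsum_mul_left]
  refine (summable_besselE hν w).tsum_le_tsum (fun i => ?_)
    ((Real.summable_pow_div_factorial w).mul_left _)
  rw [div_eq_mul_inv, mul_left_comm, mul_comm]
  exact mul_le_mul_of_nonneg_left (besselCoeff_le hν i) (by positivity)

lemma hasDerivAt_besselE (hν : -(1 / 2) < ν) (w : ℝ) :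
    HasDerivAt (besselE ν) (besselE (ν + 1) w) w := by
  set R : ℝ := |w| + 1
  have hR : 0 < R := by positivity
  have hu : Summable fun n : ℕ => besselCoeff ν n * (n * R ^ (n - 1)) := by
    rw [← summable_nat_add_iff 1]
    refine (summable_besselE (ν := ν + 1) (by linarith) R).congr fun i => ?_
    rw [← besselCoeff_add_one]
    push_cast
    ring
  have key := hasDerivAt_tsum_of_isPreconnected (𝕜 := ℝ)
    (g := fun (n : ℕ) z => besselCoeff ν n * z ^ n)
    (g' := fun (n : ℕ) z => besselCoeff ν n * (n * z ^ (n - 1))) (t := Metric.ball 0 R) (y₀ := w)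
    (y := w) hu Metric.isOpen_ball (convex_ball 0 R).isPreconnected
    (fun n y _ => (hasDerivAt_pow n y).const_mul _) (fun n y hy => ?_)
    (by simp [R]) (summable_besselE hν w) (by simp [R])
  · have e : (∑' n : ℕ, besselCoeff ν n * (n * w ^ (n - 1))) = besselE (ν + 1) w := by
      rw [Summable.tsum_eq_zero_add]
      · simp only [CharP.cast_eq_zero, zero_mul, mul_zero, zero_add]
        refine tsum_congr fun i => ?_
        rw [← besselCoeff_add_one]
        push_cast
        ring
      · rw [← summable_nat_add_iff 1]
        refine (summable_besselE (ν := ν + 1) (by linarith) w).congr fun i => ?_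
        rw [← besselCoeff_add_one]
        push_cast
        ring
    rw [← e]
    exact key
  · rw [norm_mul, Real.norm_of_nonneg (besselCoeff_pos hν n).le, norm_mul, norm_pow,
      Real.norm_of_nonneg n.cast_nonneg]
    have : ‖y‖ ≤ R := by simpa using (mem_ball_zero_iff.1 hy).le
    have := (besselCoeff_pos hν n).le
    gcongr

lemma continuous_besselE (hν : -(1 / 2) < ν) : Continuous (besselE ν) :=
  continuous_iff_continuousAt.2 fun w => (hasDerivAt_besselE hν w).continuousAt

/-- The three-term recurrence I_ν - I_{ν+2} = (2(ν+1)/y) I_{ν+1}, freed of powers of y. -/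
lemma besselE_recurrence (hν : -(1 / 2) < ν) (w : ℝ) :
    besselE ν w = (ν + 1) * besselE (ν + 1) w + w * besselE (ν + 2) w := by
  have h1 := summable_besselE (ν := ν + 1) (by linarith) w
  have h2 := summable_besselE (ν := ν + 2) (by linarith) w
  have h3 : Summable fun i : ℕ => (i : ℝ) * besselCoeff (ν + 1) i * w ^ i := by
    rw [← summable_nat_add_iff 1]
    refine (h2.mul_left w).congr fun i => ?_
    have := besselCoeff_add_one (ν := ν + 1) i
    rw [show ν + 2 = ν + 1 + 1 by ring, ← this]
    push_cast
    ring
  have e3 : w * besselE (ν + 2) w = ∑' i : ℕ, (i : ℝ) * besselCoeff (ν + 1) i * w ^ i := by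
    rw [h3.tsum_eq_zero_add, besselE, ← tsum_mul_left]
    simp only [CharP.cast_eq_zero, zero_mul, zero_add]
    refine tsum_congr fun i => ?_
    have := besselCoeff_add_one (ν := ν + 1) i
    rw [show ν + 2 = ν + 1 + 1 by ring, ← this]
    push_cast
    ring
  rw [e3, besselE, besselE, ← tsum_mul_left, ← (h1.mul_left _).tsum_add h3]
  refine tsum_congr fun i => ?_
  have e : besselCoeff ν i = (i + 1 + ν) * besselCoeff (ν + 1) i := by
    rw [← besselCoeff_add_one, ← besselCoeff_succ hν]
    ring
  rw [e]
  ring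

lemma hasDerivAt_besselE_sq (hν : -(1 / 2) < ν) (p : ℝ) :
    HasDerivAt (fun p => besselE ν (p ^ 2)) (2 * p * besselE (ν + 1) (p ^ 2)) p := by
  have := (hasDerivAt_besselE hν (p ^ 2)).comp p (hasDerivAt_pow 2 p)
  refine this.congr_deriv ?_
  push_cast
  ring

/-- In terms of modified Bessel functions: `I_{ν+1} ≤ I_ν`. -/
lemma mul_besselE_add_one_le (hν : -(1 / 2) < ν) {p : ℝ} (hp : 0 ≤ p) :
    p * besselE (ν + 1) (p ^ 2) ≤ besselE ν (p ^ 2) := by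
  rcases hp.eq_or_lt with rfl | hp
  · simpa using besselE_nonneg hν le_rfl
  -- By the recurrence, F = E_ν - p E_{ν+1} (at p²) satisfies F' + 2F = (2ν+1) E_{ν+1}. The power
  -- p^{2ν+1} turns the right-hand side into a nonnegative multiple of E_ν. The positivity of 2ν+1
  -- is needed here and for G(0) = 0.
  set G : ℝ → ℝ := fun p => Real.exp (2 * p) * p ^ (2 * ν + 1) *
    (besselE ν (p ^ 2) - p * besselE (ν + 1) (p ^ 2))
  have hd : ∀ p : ℝ, 0 < p → HasDerivAt G (Real.exp (2 * p) * p ^ (2 * ν + 1) *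
      ((2 * ν + 1) / p * besselE ν (p ^ 2))) p := by
    intro p hp
    have h1 : HasDerivAt (fun p => Real.exp (2 * p)) (Real.exp (2 * p) * 2) p := by
      simpa using ((hasDerivAt_id p).const_mul 2).exp
    have h2 := Real.hasDerivAt_rpow_const (x := p) (p := 2 * ν + 1) (Or.inl hp.ne')
    have h3 := (hasDerivAt_besselE_sq hν p).sub
      ((hasDerivAt_id p).mul (hasDerivAt_besselE_sq (ν := ν + 1) (by linarith) p))
    refine ((h1.mul h2).mul h3).congr_deriv ?_
    have e : p ^ 2 * besselE (ν + 1 + 1) (p ^ 2) =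
        besselE ν (p ^ 2) - (ν + 1) * besselE (ν + 1) (p ^ 2) := by
      rw [besselE_recurrence hν, show ν + 1 + 1 = ν + 2 by ring]
      ring
    have e2 : p ^ (2 * ν + 1 - 1) = p ^ (2 * ν + 1) / p := by
      rw [Real.rpow_sub_one hp.ne']
    simp only [Pi.mul_apply, Pi.sub_apply, id]
    rw [e2]
    field_simp
    linear_combination (-2 * p : ℝ) * e
  have hmono : MonotoneOn G (Ici 0) := by
    refine monotoneOn_of_deriv_nonneg (convex_Ici 0) ?_ ?_ ?_
    · have c1 := continuous_besselE hν
      have c2 := continuous_besselE (ν := ν + 1) (by linarith)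
      refine Continuous.continuousOn ?_
      have : Continuous fun p : ℝ => p ^ (2 * ν + 1) :=
        Real.continuous_rpow_const (by linarith)
      fun_prop
    · intro x hx
      rw [interior_Ici] at hx
      exact (hd x hx).differentiableAt.differentiableWithinAt
    · intro x hx
      rw [interior_Ici] at hx
      rw [(hd x hx).deriv]
      have hx : 0 < x := hx
      have := besselE_nonneg hν (sq_nonneg x)
      have h5 : 0 < 2 * ν + 1 := by linarith
      positivity
  have h0 := hmono (mem_Ici.2 le_rfl) (mem_Ici.2 hp.le) hp.le
  have hG0 : G 0 = 0 := by
    simp only [G]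
    rw [Real.zero_rpow (by linarith)]
    ring
  rw [hG0] at h0
  have hpos : 0 < Real.exp (2 * p) * p ^ (2 * ν + 1) := by positivity
  have := nonneg_of_mul_nonneg_right h0 hpos
  linarith

/-- The recurrence with p E_{ν+2} ≤ E_{ν+1} inserted: consecutive Bessel functions differ by a
relative error of order 1/p. -/
lemma besselE_sub_le (hν : -(1 / 2) < ν) {p : ℝ} (hp : 0 ≤ p) :
    besselE ν (p ^ 2) - p * besselE (ν + 1) (p ^ 2) ≤ (ν + 1) * besselE (ν + 1) (p ^ 2) := by
  have h1 := besselE_recurrence hν (p ^ 2)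
  have h2 := mul_le_mul_of_nonneg_left
    (mul_besselE_add_one_le (ν := ν + 1) (by linarith) hp) hp
  rw [show ν + 1 + 1 = ν + 2 by ring] at h2
  nlinarith

/-- In terms of modified Bessel functions: `√y e^{-y} I_ν(y)` is bounded for `y ≥ 1`. -/
lemma exp_mul_besselE_le (hν : -(1 / 2) < ν) {p : ℝ} (hp : 1 / 2 ≤ p) :
    Real.exp (-2 * p) * p ^ (ν + 1 / 2) * besselE ν (p ^ 2) ≤
      2 * invGammaBound * Real.exp (1 / 4 + (ν + 1 / 2) * (ν + 1)) := by
  set κ : ℝ := (ν + 1 / 2) * (ν + 1) / 2 with hκ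
  have hκ0 : 0 < κ := by
    have h1 : 0 < ν + 1 / 2 := by linarith
    have h2 : 0 < ν + 1 := by linarith
    positivity
  -- For the sum I_ν + I_{ν+1} the leading terms of the derivative cancel. What remains is (ν+1/2)/p
  -- times the difference E_ν - p E_{ν+1}, at most κ/p² times the sum, and the factor e^{κ/p}
  -- compensates for that. So G decreases from its value at p = 1/2.
  set G : ℝ → ℝ := fun p => Real.exp (κ / p) * (Real.exp (-2 * p) * p ^ (ν + 1 / 2) *
    (besselE ν (p ^ 2) + p * besselE (ν + 1) (p ^ 2)))
  have hd : ∀ p : ℝ, 0 < p → HasDerivAt G (Real.exp (κ / p) * (Real.exp (-2 * p) *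
      p ^ (ν + 1 / 2) * ((ν + 1 / 2) / p * (besselE ν (p ^ 2) - p * besselE (ν + 1) (p ^ 2)) -
        κ / p ^ 2 * (besselE ν (p ^ 2) + p * besselE (ν + 1) (p ^ 2))))) p := by
    intro p hp
    have h0 : HasDerivAt (fun p => Real.exp (κ / p)) (Real.exp (κ / p) * (-κ / p ^ 2)) p := by
      have := ((hasDerivAt_const p κ).div (hasDerivAt_id p) hp.ne').exp
      refine this.congr_deriv ?_
      simp
    have h1 : HasDerivAt (fun p => Real.exp (-2 * p)) (Real.exp (-2 * p) * (-2)) p := by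
      simpa using ((hasDerivAt_id p).const_mul (-2)).exp
    have h2 := Real.hasDerivAt_rpow_const (x := p) (p := ν + 1 / 2) (Or.inl hp.ne')
    have h3 := (hasDerivAt_besselE_sq hν p).add
      ((hasDerivAt_id p).mul (hasDerivAt_besselE_sq (ν := ν + 1) (by linarith) p))
    refine (h0.mul ((h1.mul h2).mul h3)).congr_deriv ?_
    have e : p ^ 2 * besselE (ν + 1 + 1) (p ^ 2) =
        besselE ν (p ^ 2) - (ν + 1) * besselE (ν + 1) (p ^ 2) := by
      rw [besselE_recurrence hν, show ν + 1 + 1 = ν + 2 by ring]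
      ring
    have e2 : p ^ (ν + 1 / 2 - 1) = p ^ (ν + 1 / 2) / p := by
      rw [Real.rpow_sub_one hp.ne']
    simp only [Pi.mul_apply, Pi.add_apply, id]
    rw [e2]
    field_simp
    linear_combination (4 * p ^ 2 : ℝ) * e
  have hanti : AntitoneOn G (Ici (1 / 2)) := by
    refine antitoneOn_of_deriv_nonpos (convex_Ici _) ?_ ?_ ?_
    · intro x hx
      have : 0 < x := lt_of_lt_of_le (by norm_num) (mem_Ici.1 hx)
      exact (hd x this).continuousAt.continuousWithinAt
    · intro x hx
      rw [interior_Ici] at hx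
      have : 0 < x := lt_trans (by norm_num) (mem_Ioi.1 hx)
      exact (hd x this).differentiableAt.differentiableWithinAt
    · intro x hx
      rw [interior_Ici] at hx
      have hx : 0 < x := lt_trans (by norm_num) (mem_Ioi.1 hx)
      rw [(hd x hx).deriv]
      have h1 := besselE_sub_le hν hx.le
      have h2 := mul_besselE_add_one_le hν hx.le
      have h3 : (ν + 1 / 2) / x * (besselE ν (x ^ 2) - x * besselE (ν + 1) (x ^ 2)) ≤
          κ / x ^ 2 * (besselE ν (x ^ 2) + x * besselE (ν + 1) (x ^ 2)) := by
        have h5 : 0 < ν + 1 / 2 := by linarith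
        have h6 : 0 < ν + 1 := by linarith
        calc (ν + 1 / 2) / x * (besselE ν (x ^ 2) - x * besselE (ν + 1) (x ^ 2))
            ≤ (ν + 1 / 2) / x * ((ν + 1) * besselE (ν + 1) (x ^ 2)) := by gcongr
          _ = κ / x ^ 2 * (2 * (x * besselE (ν + 1) (x ^ 2))) := by
              rw [hκ]; field_simp
          _ ≤ _ := by
              gcongr
              linarith
      refine mul_nonpos_of_nonneg_of_nonpos (by positivity)
        (mul_nonpos_of_nonneg_of_nonpos (by positivity) (by linarith))
  have hp0 : 0 < p := by linarith
  have hν1 : -(1 / 2) < ν + 1 := by linarith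
  have h1 := hanti (mem_Ici.2 le_rfl) (mem_Ici.2 hp) hp
  have hG1 : G (1 / 2) ≤ 2 * invGammaBound * Real.exp (1 / 4 + (ν + 1 / 2) * (ν + 1)) := by
    have a1 := besselE_le_exp hν (w := (1 / 2) ^ 2) (by positivity)
    have a2 := besselE_le_exp hν1 (w := (1 / 2) ^ 2) (by positivity)
    have a3 := besselE_nonneg hν1 (w := (1 / 2) ^ 2) (by positivity)
    have a4 := besselE_nonneg hν (w := (1 / 2) ^ 2) (by positivity)
    have b1 : Real.exp (-2 * (1 / 2)) ≤ 1 := Real.exp_le_one_iff.2 (by norm_num)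
    have b2 : (1 / 2 : ℝ) ^ (ν + 1 / 2) ≤ 1 :=
      Real.rpow_le_one (by norm_num) (by norm_num) (by linarith)
    have b3 : Real.exp (κ / (1 / 2)) = Real.exp ((ν + 1 / 2) * (ν + 1)) := by
      rw [hκ]; congr 1; ring
    have b4 : Real.exp (-2 * (1 / 2)) * (1 / 2 : ℝ) ^ (ν + 1 / 2) ≤ 1 :=
      mul_le_one₀ b1 (by positivity) b2
    simp only [G]
    rw [b3, Real.exp_add]
    have b5 : besselE ν ((1 / 2) ^ 2) + 1 / 2 * besselE (ν + 1) ((1 / 2) ^ 2) ≤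
        2 * invGammaBound * Real.exp (1 / 4) := by
      have : ((1 : ℝ) / 2) ^ 2 = 1 / 4 := by norm_num
      rw [this] at *
      linarith
    calc _ ≤ Real.exp ((ν + 1 / 2) * (ν + 1)) *
        (1 * (besselE ν ((1 / 2) ^ 2) + 1 / 2 * besselE (ν + 1) ((1 / 2) ^ 2))) := by
          gcongr
      _ ≤ Real.exp ((ν + 1 / 2) * (ν + 1)) * (1 * (2 * invGammaBound * Real.exp (1 / 4))) := by
          gcongr
      _ = _ := by ring
  refine le_trans ?_ (h1.trans hG1)
  have c1 := besselE_nonneg hν (sq_nonneg p)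
  have c2 := besselE_nonneg hν1 (sq_nonneg p)
  have c3 : 1 ≤ Real.exp (κ / p) := Real.one_le_exp (by positivity)
  calc Real.exp (-2 * p) * p ^ (ν + 1 / 2) * besselE ν (p ^ 2)
      ≤ 1 * (Real.exp (-2 * p) * p ^ (ν + 1 / 2) *
        (besselE ν (p ^ 2) + p * besselE (ν + 1) (p ^ 2))) := by
        rw [one_mul]
        gcongr
        nlinarith
    _ ≤ _ := by
        simp only [G]
        gcongr

end JacobiRiesz
end

noncomputable section
namespace JacobiRiesz

/-! ### Estimates for modified Bessel functions, uniform in the order -/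

/-- `(y/2)^{-α} I_{α+δ}(y)`. -/
def besselH (α δ y : ℝ) : ℝ := (y / 2) ^ δ * besselE (α + δ) ((y / 2) ^ 2)

/-- `y H'(y) - y H(y)` for `H = besselH α δ`. -/
def besselR (α δ y : ℝ) : ℝ := δ * besselH α δ y - y * (besselH α δ y - besselH α (δ + 1) y)

section

variable {α δ y : ℝ}

lemma besselH_nonneg (hα : -(1 / 2) < α) (hδ : 0 ≤ δ) (hy : 0 ≤ y) : 0 ≤ besselH α δ y :=
  mul_nonneg (by positivity) (besselE_nonneg (by linarith) (sq_nonneg _))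

lemma besselH_add_one_le (hα : -(1 / 2) < α) (hδ : 0 ≤ δ) (hy : 0 < y) :
    besselH α (δ + 1) y ≤ besselH α δ y := by
  unfold besselH
  rw [Real.rpow_add_one (by positivity), mul_assoc, ← add_assoc]
  exact mul_le_mul_of_nonneg_left (mul_besselE_add_one_le (by linarith) (by positivity))
    (by positivity)

lemma besselH_sub_add_two (hα : -(1 / 2) < α) (hδ : 0 ≤ δ) (hy : 0 < y) :
    besselH α δ y - besselH α (δ + 2) y = 2 * (α + δ + 1) / y * besselH α (δ + 1) y := by
  have h2 : 0 < y / 2 := by positivity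
  have e1 : (y / 2) ^ (δ + 2) = (y / 2) ^ δ * (y / 2) ^ 2 := by
    rw [Real.rpow_add h2, Real.rpow_two]
  unfold besselH
  rw [e1, Real.rpow_add_one h2.ne', besselE_recurrence (ν := α + δ) (by linarith),
    show α + (δ + 2) = α + δ + 2 by ring, show α + (δ + 1) = α + δ + 1 by ring]
  field_simp
  ring

/-- The difference of neighbours is at most the difference over two steps, which the recurrence
evaluates. Hence `besselR`, whose two parts of size y nearly cancel, is only the order times
`besselH`. -/
lemma besselH_sub_le (hα : -(1 / 2) < α) (hδ : 0 ≤ δ) (hy : 0 < y) :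
    y * (besselH α δ y - besselH α (δ + 1) y) ≤ 2 * (α + δ + 1) * besselH α δ y := by
  have h1 := besselH_sub_add_two hα hδ hy
  have h2 := besselH_add_one_le hα (δ := δ + 1) (by linarith) hy
  have h3 := besselH_add_one_le hα hδ hy
  rw [show δ + 1 + 1 = δ + 2 by ring] at h2
  have h4 : besselH α δ y - besselH α (δ + 1) y ≤ 2 * (α + δ + 1) / y * besselH α (δ + 1) y := by
    linarith
  calc y * (besselH α δ y - besselH α (δ + 1) y)
      ≤ y * (2 * (α + δ + 1) / y * besselH α (δ + 1) y) := by gcongr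
    _ = 2 * (α + δ + 1) * besselH α (δ + 1) y := by field_simp
    _ ≤ _ := mul_le_mul_of_nonneg_left h3 (by linarith)

lemma besselH_add_nat_le (hα : -(1 / 2) < α) (hδ : 0 ≤ δ) (hy : 0 < y) (m : ℕ) :
    besselH α (δ + m) y ≤ besselH α δ y := by
  induction m with
  | zero => simp
  | succ m ih =>
    refine le_trans ?_ ih
    push_cast
    rw [← add_assoc]
    exact besselH_add_one_le hα (by positivity) hy

/-- The gain of a factor `y / m²` when the order grows by `m`. -/
lemma sq_mul_besselH_add_nat_le (hα : -(1 / 2) < α) (hδ : 0 ≤ δ) (hy : 0 < y) (m : ℕ) :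
    (m : ℝ) ^ 2 * besselH α (δ + m) y ≤ 2 * y * besselH α δ y := by
  -- Telescoping the recurrence: step m contributes the coefficient 2(α+δ+m+1) ≥ 2m+1 = (m+1)² - m²,
  -- by α > -1/2 and δ ≥ 0. Keeping the subtracted terms makes the induction close.
  have key : ∀ m : ℕ, (m : ℝ) ^ 2 * besselH α (δ + m) y ≤
      y * (besselH α δ y + besselH α (δ + 1) y - besselH α (δ + m) y -
        besselH α (δ + m + 1) y) := by
    intro m
    induction m with
    | zero => simp
    | succ m ih =>
      have hm : 0 ≤ δ + m := by positivity
      have h1 := besselH_sub_add_two hα hm hy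
      have h2 := besselH_add_one_le hα hm hy
      have h3 : besselH α (δ + m) y * y - besselH α (δ + m + 2) y * y =
          2 * (α + (δ + m) + 1) * besselH α (δ + m + 1) y := by
        rw [← sub_mul, h1]
        field_simp
      have h4 := besselH_nonneg (y := y) hα (δ := δ + m + 1) (by linarith) hy.le
      push_cast
      rw [show δ + ((m : ℝ) + 1) = δ + m + 1 by ring, show δ + (m : ℝ) + 1 + 1 = δ + m + 2 by ring]
      have h5 : (m : ℝ) ^ 2 * besselH α (δ + m + 1) y ≤ (m : ℝ) ^ 2 * besselH α (δ + m) y := by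
        gcongr
      have h6 : (2 * (m : ℝ) + 1) * besselH α (δ + m + 1) y ≤
          2 * (α + (δ + m) + 1) * besselH α (δ + m + 1) y :=
        mul_le_mul_of_nonneg_right (by linarith) h4
      linarith
  have h1 := besselH_nonneg (y := y) hα (δ := δ + m) (by positivity) hy.le
  have h2 := besselH_nonneg (y := y) hα (δ := δ + m + 1) (by positivity) hy.le
  have h3 := besselH_add_one_le hα hδ hy
  refine (key m).trans ?_
  rw [mul_assoc 2, mul_left_comm]
  gcongr
  linarith

lemma hasDerivAt_besselH (hα : -(1 / 2) < α) (hδ : 0 ≤ δ) (hy : 0 < y) :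
    HasDerivAt (besselH α δ) (δ / y * besselH α δ y + besselH α (δ + 1) y) y := by
  have h2 : 0 < y / 2 := by positivity
  have h0 : HasDerivAt (fun y : ℝ => y / 2) (1 / 2) y := (hasDerivAt_id y).div_const 2
  have h := ((Real.hasDerivAt_rpow_const (x := y / 2) (p := δ) (Or.inl h2.ne')).comp y h0).mul
    ((hasDerivAt_besselE_sq (ν := α + δ) (by linarith) (y / 2)).comp y h0)
  refine h.congr_deriv ?_
  simp only [Function.comp, besselH]
  rw [Real.rpow_add_one h2.ne', Real.rpow_sub_one h2.ne', ← add_assoc α δ 1]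
  field_simp

lemma continuousOn_besselH (hα : -(1 / 2) < α) (hδ : 0 ≤ δ) :
    ContinuousOn (besselH α δ) (Ioi 0) := fun _ hy =>
  (hasDerivAt_besselH hα hδ hy).continuousAt.continuousWithinAt

end

/-- The constant in `exp_mul_besselE_le` grows with the order, so it is used only in the window 0 ≤
δ ≤ 1, where it is bounded. Larger orders are reached afterwards by monotonicity. The power series
handles y ≤ 1, the large-argument decay y ≥ 1. -/
lemma exists_besselH_le_of_le_one {α : ℝ} (hα : -(1 / 2) < α) : ∃ C : ℝ, 0 < C ∧
    ∀ δ : ℝ, 0 ≤ δ → δ ≤ 1 → ∀ y : ℝ, 0 < y →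
      Real.exp (-y) * besselH α δ y ≤ C * (1 + y) ^ (-(α + 1 / 2)) := by
  have hG := invGammaBound_pos
  set e : ℝ := α + 1 / 2 with he
  have he0 : 0 < e := by linarith
  set K : ℝ := Real.exp (1 / 4 + (α + 3 / 2) * (α + 2))
  refine ⟨4 ^ e * (2 * invGammaBound * K), by positivity, fun δ h0 h1 y hy => ?_⟩
  have hν : -(1 / 2) < α + δ := by linarith
  rcases le_total y 1 with h | h
  · have a1 : Real.exp (-y) ≤ 1 := Real.exp_le_one_iff.2 (by linarith)
    have a2 : (y / 2) ^ δ ≤ 1 := Real.rpow_le_one (by positivity) (by linarith) h0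
    have a3 := besselE_le_exp hν (sq_nonneg (y / 2))
    have a4 : Real.exp ((y / 2) ^ 2) ≤ K := by
      refine Real.exp_le_exp.2 ?_
      have : 0 ≤ (α + 3 / 2) * (α + 2) := mul_nonneg (by linarith) (by linarith)
      nlinarith
    have a5 := besselE_nonneg hν (sq_nonneg (y / 2))
    have a6 : 1 ≤ 4 ^ e * (1 + y) ^ (-e) := by
      rw [Real.rpow_neg (by positivity), ← div_eq_mul_inv, ← Real.div_rpow (by positivity)
        (by positivity)]
      refine Real.one_le_rpow ?_ he0.le
      rw [le_div_iff₀ (by positivity)]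
      linarith
    calc Real.exp (-y) * besselH α δ y
        ≤ 1 * (1 * (invGammaBound * K)) := by
          unfold besselH
          gcongr
          exact a3.trans (by gcongr)
      _ ≤ (4 ^ e * (1 + y) ^ (-e)) * (2 * invGammaBound * K) := by
          have : 0 < invGammaBound * K := by positivity
          nlinarith
      _ = _ := by ring
  · have hp : 1 / 2 ≤ y / 2 := by linarith
    have hp0 : 0 < y / 2 := by positivity
    have b1 := exp_mul_besselE_le hν hp
    have b2 : Real.exp (1 / 4 + (α + δ + 1 / 2) * (α + δ + 1)) ≤ K := by
      refine Real.exp_le_exp.2 ?_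
      have : (α + δ + 1 / 2) * (α + δ + 1) ≤ (α + 3 / 2) * (α + 2) :=
        mul_le_mul (by linarith) (by linarith) (by linarith) (by linarith)
      linarith
    have b3 : Real.exp (-y) * besselH α δ y = (y / 2) ^ (-e) *
        (Real.exp (-2 * (y / 2)) * (y / 2) ^ (α + δ + 1 / 2) * besselE (α + δ) ((y / 2) ^ 2)) := by
      unfold besselH
      rw [show (y / 2) ^ δ = (y / 2) ^ (-e) * (y / 2) ^ (α + δ + 1 / 2) by
        rw [← Real.rpow_add hp0]; congr 1; rw [he]; ring]
      rw [show -2 * (y / 2) = -y by ring]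
      ring
    have b4 : (y / 2) ^ (-e) ≤ 4 ^ e * (1 + y) ^ (-e) := by
      rw [Real.rpow_neg (by positivity), Real.rpow_neg (by positivity), ← div_eq_mul_inv,
        ← Real.div_rpow (by positivity) (by positivity), ← Real.inv_rpow (by positivity)]
      refine Real.rpow_le_rpow (by positivity) ?_ he0.le
      rw [inv_le_comm₀ (by positivity) (by positivity), inv_div]
      linarith
    have b5 := besselE_nonneg hν (sq_nonneg (y / 2))
    rw [b3]
    calc _ ≤ (4 ^ e * (1 + y) ^ (-e)) * (2 * invGammaBound * K) := by
          refine mul_le_mul b4 (b1.trans (by gcongr)) (by positivity) (by positivity)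
      _ = _ := by ring

/-- Write δ as its fractional part plus m. Lowering the order by m brings it into the window of
uniform constants, and yields no gain, one gain y/m², or two gains when m is split in two. -/
lemma exists_besselH_le {α : ℝ} (hα : -(1 / 2) < α) : ∃ C : ℝ, 0 < C ∧
    ∀ δ : ℝ, 0 ≤ δ → ∀ y : ℝ, 0 < y →
      Real.exp (-y) * besselH α δ y ≤ C * (1 + y) ^ (-(α + 1 / 2)) ∧
      (⌊δ⌋₊ : ℝ) ^ 2 * (Real.exp (-y) * besselH α δ y) ≤ C * (1 + y) ^ (-(α + 1 / 2)) * y ∧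
      (2 ≤ ⌊δ⌋₊ → (⌊δ⌋₊ : ℝ) ^ 4 * (Real.exp (-y) * besselH α δ y) ≤
        C * (1 + y) ^ (-(α + 1 / 2)) * y ^ 2) := by
  obtain ⟨C, hC, h⟩ := exists_besselH_le_of_le_one hα
  refine ⟨144 * C, by positivity, fun δ hδ y hy => ?_⟩
  set m := ⌊δ⌋₊
  set f : ℝ := δ - m with hf
  have hf0 : 0 ≤ f := sub_nonneg.2 (Nat.floor_le hδ)
  have hf1 : f ≤ 1 := by linarith [Nat.lt_floor_add_one δ]
  have hfm : δ = f + m := by rw [hf]; ring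
  have hb := h f hf0 hf1 y hy
  set W : ℝ := (1 + y) ^ (-(α + 1 / 2))
  have hW : 0 < W := by positivity
  have hCW : 0 < C * W := by positivity
  rw [hfm]
  refine ⟨?_, ?_, fun hm => ?_⟩
  · calc Real.exp (-y) * besselH α (f + m) y ≤ Real.exp (-y) * besselH α f y := by
          gcongr
          exact besselH_add_nat_le hα hf0 hy m
      _ ≤ C * W := hb
      _ ≤ _ := by nlinarith
  · calc (m : ℝ) ^ 2 * (Real.exp (-y) * besselH α (f + m) y)
        = Real.exp (-y) * ((m : ℝ) ^ 2 * besselH α (f + m) y) := by ring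
      _ ≤ Real.exp (-y) * (2 * y * besselH α f y) := by
          gcongr Real.exp (-y) * ?_
          exact sq_mul_besselH_add_nat_le hα hf0 hy m
      _ = 2 * y * (Real.exp (-y) * besselH α f y) := by ring
      _ ≤ 2 * y * (C * W) := by gcongr
      _ ≤ _ := by nlinarith [mul_pos hCW hy]
  -- Each part gains y/m_i². Since m ≥ 2, neither part vanishes; m ≤ 3 m1 and m ≤ 2 m2 give 36, and
  -- the two factors 2 of `sq_mul_besselH_add_nat_le` give 144.
  · obtain ⟨m1, m2, e, h1, h2⟩ : ∃ m1 m2 : ℕ, m = m1 + m2 ∧ m ≤ 3 * m1 ∧ m ≤ 2 * m2 :=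
      ⟨m / 2, m - m / 2, by omega, by omega, by omega⟩
    have h1' : (m : ℝ) ≤ 3 * m1 := by exact_mod_cast h1
    have h2' : (m : ℝ) ≤ 2 * m2 := by exact_mod_cast h2
    have g1 := sq_mul_besselH_add_nat_le hα hf0 hy m1
    have g2 := sq_mul_besselH_add_nat_le hα (δ := f + m1) (by positivity) hy m2
    have hH := besselH_nonneg hα (δ := f + m1 + m2) (by positivity) hy.le
    have e' : f + (m : ℝ) = f + m1 + m2 := by rw [e]; push_cast; ring
    rw [e']
    have hp : (m : ℝ) ^ 4 ≤ 36 * ((m1 : ℝ) ^ 2 * (m2 : ℝ) ^ 2) := by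
      calc (m : ℝ) ^ 4 = (m : ℝ) ^ 2 * (m : ℝ) ^ 2 := by ring
        _ ≤ ((3 : ℝ) * m1) ^ 2 * ((2 : ℝ) * m2) ^ 2 := by gcongr
        _ = _ := by ring
    calc (m : ℝ) ^ 4 * (Real.exp (-y) * besselH α (f + m1 + m2) y)
        ≤ 36 * ((m1 : ℝ) ^ 2 * (m2 : ℝ) ^ 2) * (Real.exp (-y) * besselH α (f + m1 + m2) y) := by
          gcongr
      _ = 36 * Real.exp (-y) * (m1 : ℝ) ^ 2 * ((m2 : ℝ) ^ 2 * besselH α (f + m1 + m2) y) := by ring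
      _ ≤ 36 * Real.exp (-y) * (m1 : ℝ) ^ 2 * (2 * y * besselH α (f + m1) y) := by gcongr
      _ = 72 * y * Real.exp (-y) * ((m1 : ℝ) ^ 2 * besselH α (f + m1) y) := by ring
      _ ≤ 72 * y * Real.exp (-y) * (2 * y * besselH α f y) := by gcongr
      _ = 144 * y ^ 2 * (Real.exp (-y) * besselH α f y) := by ring
      _ ≤ 144 * y ^ 2 * (C * W) := by gcongr
      _ = _ := by ring

/-- `min (√Y) Y` for `Y = y / j²`. -/
def sqrtMin (j y : ℝ) : ℝ := min (Real.sqrt y / j) (y / j ^ 2)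

section

variable {j y z K : ℝ}

lemma sqrtMin_nonneg (hj : 0 < j) (hy : 0 ≤ y) : 0 ≤ sqrtMin j y :=
  le_min (by positivity) (by positivity)

/-- With Y = y/j², min(1, Y) ≤ min(√Y, Y). The square root is the useful form, because √(st) can
later be traded for s alone. -/
lemma le_mul_sqrtMin (hj : 0 < j) (hy : 0 ≤ y) (hK : 0 ≤ K) (h0 : z ≤ K)
    (h1 : z ≤ K * (y / j ^ 2)) : z ≤ K * sqrtMin j y := by
  have hs : (Real.sqrt y / j) ^ 2 = y / j ^ 2 := by rw [div_pow, Real.sq_sqrt hy]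
  have hs0 : 0 ≤ Real.sqrt y / j := by positivity
  unfold sqrtMin
  rcases min_choice (Real.sqrt y / j) (y / j ^ 2) with h | h <;> rw [h]
  · rcases le_total 1 (Real.sqrt y / j) with h2 | h2
    · nlinarith
    · refine h1.trans (mul_le_mul_of_nonneg_left ?_ hK)
      rw [← hs]
      nlinarith
  · exact h1

lemma le_mul_sqrtMin_sq (hy : 0 ≤ y) (h0 : z ≤ K * (y / j ^ 2))
    (h1 : z ≤ K * (y / j ^ 2) ^ 2) : z ≤ K * sqrtMin j y ^ 2 := by
  have hs : (Real.sqrt y / j) ^ 2 = y / j ^ 2 := by rw [div_pow, Real.sq_sqrt hy]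
  unfold sqrtMin
  rcases min_choice (Real.sqrt y / j) (y / j ^ 2) with h | h <;> rw [h]
  · rwa [hs]
  · exact h1

end

/-- The estimates of `besselH` and its derivative for the orders `α + aj`, uniform in `j`. -/
lemma exists_besselH_mul_nat_le {α a : ℝ} (hα : -(1 / 2) < α) (ha : 1 ≤ a) : ∃ C : ℝ, 0 < C ∧
    ∀ j : ℕ, 1 ≤ j → ∀ y : ℝ, 0 < y →
      Real.exp (-y) * besselH α (a * j) y ≤
        C * (1 + y) ^ (-(α + 1 / 2)) * sqrtMin j y ∧
      Real.exp (-y) * besselH α (a * j) y ≤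
        C * (1 + y) ^ (-(α + 1 / 2)) * (y / j ^ 2) ∧
      (2 ≤ a * j → Real.exp (-y) * besselH α (a * j) y ≤
        C * (1 + y) ^ (-(α + 1 / 2)) * (y / j ^ 2) ^ 2) := by
  obtain ⟨C, hC, h⟩ := exists_besselH_le hα
  refine ⟨C, hC, fun j hj y hy => ?_⟩
  have hj0 : (0 : ℝ) < j := by exact_mod_cast hj
  have hδ : 0 ≤ a * j := by positivity
  obtain ⟨h0, h1, h2⟩ := h (a * j) hδ y hy
  have hW : 0 < C * (1 + y) ^ (-(α + 1 / 2)) := by positivity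
  have hH : 0 ≤ Real.exp (-y) * besselH α (a * j) y :=
    mul_nonneg (Real.exp_pos _).le (besselH_nonneg hα hδ hy.le)
  have hfl : j ≤ ⌊a * j⌋₊ := by
    rw [Nat.le_floor_iff hδ]
    nlinarith
  have hfl' : (j : ℝ) ≤ ⌊a * j⌋₊ := by exact_mod_cast hfl
  have k1 : Real.exp (-y) * besselH α (a * j) y ≤
      C * (1 + y) ^ (-(α + 1 / 2)) * (y / j ^ 2) := by
    rw [← mul_div_assoc, le_div_iff₀ (by positivity), mul_comm]
    refine le_trans ?_ h1
    gcongr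
  refine ⟨le_mul_sqrtMin hj0 hy.le hW.le h0 k1, k1, fun h3 => ?_⟩
  have h4 := h2 ((Nat.le_floor_iff hδ).2 (by exact_mod_cast h3))
  rw [div_pow, ← mul_div_assoc, le_div_iff₀ (by positivity), mul_comm, ← pow_mul]
  refine le_trans ?_ h4
  gcongr

lemma abs_besselR_le {α δ y : ℝ} (hα : -(1 / 2) < α) (hδ : 0 ≤ δ) (hy : 0 < y) :
    |besselR α δ y| ≤ (δ + 2 * (α + δ + 1)) * besselH α δ y := by
  have h1 := besselH_sub_le hα hδ hy
  have h2 := besselH_add_one_le hα hδ hy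
  have h3 := besselH_nonneg hα hδ hy.le
  have h4 : 0 ≤ y * (besselH α δ y - besselH α (δ + 1) y) :=
    mul_nonneg hy.le (sub_nonneg.2 h2)
  have h5 : 0 ≤ δ * besselH α δ y := by positivity
  have h6 : 0 ≤ (α + δ + 1) * besselH α δ y := mul_nonneg (by linarith) h3
  unfold besselR
  rw [abs_le]
  constructor <;> linarith

lemma exists_besselR_le {α a : ℝ} (hα : -(1 / 2) < α) (ha : 1 ≤ a) : ∃ C : ℝ, 0 < C ∧
    ∀ j : ℕ, 1 ≤ j → ∀ y : ℝ, 0 < y →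
      Real.exp (-y) * |besselR α (a * j) y| ≤ C * (1 + y) ^ (-(α + 1 / 2)) * (y / j) ∧
      Real.exp (-y) * |besselR α (a * j) y| ≤ C * (1 + y) ^ (-(α + 1 / 2)) * (j * sqrtMin j y) := by
  obtain ⟨C, hC, h⟩ := exists_besselH_mul_nat_le hα ha
  set c : ℝ := a + 2 * (α + a + 1)
  have hc : 0 < c := by simp only [c]; linarith
  have main : ∀ j : ℕ, 1 ≤ j → ∀ y : ℝ, 0 < y → Real.exp (-y) * |besselR α (a * j) y| ≤
      c * j * (Real.exp (-y) * besselH α (a * j) y) := by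
    intro j hj y hy
    have hj1 : (1 : ℝ) ≤ j := by exact_mod_cast hj
    have hδ : 0 ≤ a * j := by positivity
    have h1 := abs_besselR_le hα hδ hy
    have h3 := besselH_nonneg hα hδ hy.le
    have h4 : a * j + 2 * (α + a * j + 1) ≤ c * j := by simp only [c]; nlinarith
    calc _ ≤ Real.exp (-y) * (c * j * besselH α (a * j) y) := by
          gcongr
          exact h1.trans (by gcongr)
      _ = _ := by ring
  refine ⟨c * C, by positivity, fun j hj y hy => ?_⟩
  have hj0 : (0 : ℝ) < j := by exact_mod_cast hj
  obtain ⟨h1, h2, -⟩ := h j hj y hy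
  constructor
  · refine (main j hj y hy).trans ((mul_le_mul_of_nonneg_left h2 (by positivity)).trans_eq ?_)
    field_simp
  · refine (main j hj y hy).trans ((mul_le_mul_of_nonneg_left h1 (by positivity)).trans_eq ?_)
    ring

/-- Near y = 0 one has H ~ y^{aj}, so R - H behaves like (aj - 1) y^{aj}, which must be O(y²). That
holds if aj ≥ 2, by the double gain, or if aj = 1, where the leading term cancels. The dichotomy for
a excludes the remaining case. -/
lemma exists_besselR_sub_le {α a : ℝ} (hα : -(1 / 2) < α) (ha : a = 1 ∨ 2 ≤ a) :
    ∃ C : ℝ, 0 < C ∧ ∀ j : ℕ, 1 ≤ j → ∀ y : ℝ, 0 < y →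
      Real.exp (-y) * |besselR α (a * j) y - besselH α (a * j) y| ≤
        C * (1 + y) ^ (-(α + 1 / 2)) * (j * sqrtMin j y ^ 2) := by
  have ha1 : 1 ≤ a := by rcases ha with h | h <;> linarith
  obtain ⟨C, hC, h⟩ := exists_besselH_mul_nat_le hα ha1
  set c : ℝ := 2 * a + 2 * (α + a + 1) with hcdef
  have hc : 0 < c := by simp only [c]; linarith
  refine ⟨c * C, by positivity, fun j hj y hy => ?_⟩
  have hj1 : (1 : ℝ) ≤ j := by exact_mod_cast hj
  have hj0 : (0 : ℝ) < j := by linarith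
  have hδ : 0 ≤ a * j := by positivity
  obtain ⟨h1, h2, h3⟩ := h j hj y hy
  have hH := besselH_nonneg hα hδ hy.le
  set W : ℝ := C * (1 + y) ^ (-(α + 1 / 2)) with hWdef
  have hW : 0 < W := by positivity
  suffices Real.exp (-y) * |besselR α (a * j) y - besselH α (a * j) y| ≤
      (c * j * W) * sqrtMin j y ^ 2 by
    refine this.trans_eq ?_
    rw [hWdef]
    ring
  have g1 : Real.exp (-y) * |besselR α (a * j) y - besselH α (a * j) y| ≤
      c * j * (Real.exp (-y) * besselH α (a * j) y) := by
    have h5 := abs_besselR_le hα hδ hy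
    have h4 : a * j + 2 * (α + a * j + 1) + 1 ≤ c * j := by simp only [c]; nlinarith
    calc _ ≤ Real.exp (-y) * (c * j * besselH α (a * j) y) := by
          gcongr
          refine (abs_sub _ _).trans ?_
          rw [abs_of_nonneg hH]
          nlinarith
      _ = _ := by ring
  by_cases h2a : 2 ≤ a * j
  · refine le_mul_sqrtMin_sq hy.le ?_ ?_
    · refine g1.trans ((mul_le_mul_of_nonneg_left h2 (by positivity)).trans_eq ?_)
      ring
    · refine g1.trans ((mul_le_mul_of_nonneg_left (h3 h2a) (by positivity)).trans_eq ?_)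
      ring
  -- From aj < 2 and a ≥ 1 follows j = 1, and then a ≥ 2 is impossible, so a = 1.
  · have hj' : j = 1 := by
      by_contra hne
      have : 2 ≤ j := by omega
      have : (2 : ℝ) ≤ j := by exact_mod_cast this
      nlinarith
    subst hj'
    have ha' : a = 1 := by
      rcases ha with h | h
      · exact h
      · push_cast at h2a
        linarith
    subst ha'
    -- Here δ = 1, so δH cancels against the subtracted H and a full factor y is left.
    have e : besselR α (1 * (1 : ℕ)) y - besselH α (1 * (1 : ℕ)) y =
        -(y * (besselH α (1 * (1 : ℕ)) y - besselH α (1 * (1 : ℕ) + 1) y)) := by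
      unfold besselR
      push_cast
      ring
    have h6 := besselH_add_one_le hα hδ hy
    have h8 := besselH_nonneg hα (δ := 1 * (1 : ℕ) + 1) (by positivity) hy.le
    have g2 : Real.exp (-y) * |besselR α (1 * (1 : ℕ)) y - besselH α (1 * (1 : ℕ)) y| ≤
        y * (Real.exp (-y) * besselH α (1 * (1 : ℕ)) y) := by
      rw [e, abs_neg, abs_of_nonneg (mul_nonneg hy.le (sub_nonneg.2 h6)), mul_left_comm]
      gcongr
      linarith
    have hc1 : 1 ≤ c := by simp only [c]; linarith
    refine le_mul_sqrtMin_sq hy.le ?_ ?_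
    · refine g1.trans ((mul_le_mul_of_nonneg_left h2 (by positivity)).trans_eq ?_)
      ring
    · refine g2.trans ((mul_le_mul_of_nonneg_left h2 (by positivity)).trans ?_)
      push_cast
      have : 0 ≤ y * W * y := by positivity
      nlinarith

/-- The same for the orders `β + bj` when `b = 0` is allowed; there is no gain from `j` then. -/
lemma exists_besselH_besselR_le {β b : ℝ} (hβ : -(1 / 2) < β) (hb : b = 0 ∨ 1 ≤ b) :
    ∃ C : ℝ, 0 < C ∧ ∀ j : ℕ, 1 ≤ j → ∀ y : ℝ, 0 < y →
      Real.exp (-y) * besselH β (b * j) y ≤ C * (1 + y) ^ (-(β + 1 / 2)) ∧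
      Real.exp (-y) * |besselR β (b * j) y| ≤ C * (1 + y) ^ (-(β + 1 / 2)) * sqrtMin 1 y := by
  obtain ⟨C, hC, h⟩ := exists_besselH_le hβ
  rcases hb with rfl | hb
  · set c : ℝ := 2 * (β + 1) + 1
    have hc : 1 ≤ c := by simp only [c]; linarith
    refine ⟨c * C, by positivity, fun j hj y hy => ?_⟩
    rw [zero_mul]
    obtain ⟨h0, -, -⟩ := h 0 le_rfl y hy
    set W : ℝ := C * (1 + y) ^ (-(β + 1 / 2)) with hW
    have hW0 : 0 < W := by positivity
    have hH := besselH_nonneg hβ le_rfl hy.le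
    have h1 := abs_besselR_le hβ le_rfl hy
    have h2 := besselH_add_one_le hβ le_rfl hy
    have h3 := besselH_nonneg hβ (δ := 0 + 1) (by positivity) hy.le
    rw [mul_assoc c C, ← hW]
    refine ⟨by nlinarith, le_mul_sqrtMin one_pos hy.le (by positivity) ?_ ?_⟩
    · calc _ ≤ Real.exp (-y) * (c * besselH β 0 y) := by
            gcongr
            refine h1.trans (mul_le_mul_of_nonneg_right ?_ hH)
            simp only [c]
            linarith
        _ = c * (Real.exp (-y) * besselH β 0 y) := by ring
        _ ≤ _ := by gcongr
    -- At order shift 0 the smallness at y = 0 comes from the explicit factor y, not from a gain in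
    -- the order.
    · have e : besselR β 0 y = -(y * (besselH β 0 y - besselH β (0 + 1) y)) := by
        unfold besselR
        ring
      rw [e, abs_neg, abs_of_nonneg (mul_nonneg hy.le (sub_nonneg.2 h2))]
      calc _ ≤ Real.exp (-y) * (y * besselH β 0 y) := by
            gcongr
            linarith
        _ = y * (Real.exp (-y) * besselH β 0 y) := by ring
        _ ≤ y * W := by gcongr
        _ ≤ _ := by
            have : 0 < y * W := by positivity
            rw [one_pow, div_one]
            nlinarith
  · obtain ⟨C', hC', h'⟩ := exists_besselR_le hβ hb
    refine ⟨C + C', by positivity, fun j hj y hy => ?_⟩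
    have hj1 : (1 : ℝ) ≤ j := by exact_mod_cast hj
    have hj0 : (0 : ℝ) < j := by linarith
    obtain ⟨h0, -, -⟩ := h (b * j) (by positivity) y hy
    obtain ⟨-, h2⟩ := h' j hj y hy
    have hW : 0 < (1 + y) ^ (-(β + 1 / 2)) := by positivity
    refine ⟨h0.trans ?_, h2.trans ?_⟩
    · nlinarith
    -- j min(√y/j, y/j²) = min(√y, y/j): the factor j lost in `besselR` is exactly the one gained.
    · have h5 : j * sqrtMin j y ≤ sqrtMin 1 y := by
        unfold sqrtMin
        rw [mul_min_of_nonneg _ _ hj0.le]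
        refine min_le_min (le_of_eq ?_) ?_
        · field_simp
        · rw [one_pow, div_one, pow_two, ← mul_div_assoc, mul_div_mul_left _ _ hj0.ne']
          exact div_le_self hy.le hj1
      have h6 := sqrtMin_nonneg hj0 hy.le
      gcongr
      linarith

end JacobiRiesz
end

noncomputable section
namespace JacobiRiesz

/-! ### The Laplace integral of a product of two Bessel functions -/

/-- The derivative of `besselH α δ`. -/
def besselH' (α δ y : ℝ) : ℝ := δ / y * besselH α δ y + besselH α (δ + 1) y

/-- The integrand of `besselLaplace`. -/
def besselProd (α β δ ε B D z : ℝ) : ℝ :=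
  Real.exp (-z) * (z / 2) ^ (α + β) * (besselH α δ (z * B) * besselH β ε (z * D))

/-- `∫ e^{-z} (z/2)^{α+β} H_{α,δ}(zB) H_{β,ε}(zD) dz` with `H = besselH`; this is the Laplace
transform at `1` of the product of modified Bessel functions `I_{α+δ}(zB) I_{β+ε}(zD)`, normalized
to be regular at `B = 0` and `D = 0`. -/
def besselLaplace (α β δ ε B D : ℝ) : ℝ := ∫ z in Ioi (0 : ℝ), besselProd α β δ ε B D z

section

variable {α β δ ε B D : ℝ}

lemma exists_besselH_le_exp (hα : -(1 / 2) < α) :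
    ∃ C : ℝ, 0 < C ∧ ∀ δ : ℝ, 0 ≤ δ → ∀ y : ℝ, 0 < y → besselH α δ y ≤ C * Real.exp y := by
  obtain ⟨C, hC, h⟩ := exists_besselH_le hα
  refine ⟨C, hC, fun δ hδ y hy => ?_⟩
  obtain ⟨h0, -, -⟩ := h δ hδ y hy
  have h1 : (1 + y) ^ (-(α + 1 / 2)) ≤ 1 :=
    Real.rpow_le_one_of_one_le_of_nonpos (by linarith) (by linarith)
  rw [Real.exp_neg, inv_mul_eq_div, div_le_iff₀ (Real.exp_pos _)] at h0
  refine h0.trans ?_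
  have := Real.exp_pos y
  gcongr
  nlinarith

lemma integrableOn_rpow_mul_exp {p c : ℝ} (hp : -1 < p) (hc : 0 < c) :
    IntegrableOn (fun z : ℝ => z ^ p * Real.exp (-(c * z))) (Ioi 0) := by
  have := integrableOn_rpow_mul_exp_neg_mul_rpow hp one_pos hc
  simpa using this

lemma continuousOn_besselH_mul (hα : -(1 / 2) < α) (hδ : 0 ≤ δ) (hB : 0 < B) :
    ContinuousOn (fun z => besselH α δ (z * B)) (Ioi 0) :=
  (continuousOn_besselH hα hδ).comp (by fun_prop) fun _ hz => mul_pos hz hB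

lemma continuousOn_weight (c : ℝ) :
    ContinuousOn (fun z : ℝ => Real.exp (-z) * (z / 2) ^ c) (Ioi 0) := by
  refine ContinuousOn.mul (by fun_prop) (ContinuousOn.rpow_const (by fun_prop) fun z hz => ?_)
  exact Or.inl (by have : (0 : ℝ) < z := hz; positivity)

lemma continuousOn_besselProd (hα : -(1 / 2) < α) (hβ : -(1 / 2) < β) (hδ : 0 ≤ δ) (hε : 0 ≤ ε)
    (hB : 0 < B) (hD : 0 < D) : ContinuousOn (besselProd α β δ ε B D) (Ioi 0) :=
  (continuousOn_weight _).mul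
    ((continuousOn_besselH_mul hα hδ hB).mul (continuousOn_besselH_mul hβ hε hD))

lemma besselProd_nonneg (hα : -(1 / 2) < α) (hβ : -(1 / 2) < β) (hδ : 0 ≤ δ) (hε : 0 ≤ ε)
    (hB : 0 < B) (hD : 0 < D) {z : ℝ} (hz : 0 < z) : 0 ≤ besselProd α β δ ε B D z := by
  have h1 := besselH_nonneg hα hδ (mul_pos hz hB).le
  have h2 := besselH_nonneg hβ hε (mul_pos hz hD).le
  unfold besselProd
  positivity

lemma exp_neg_mul_exp_mul_exp (B D z : ℝ) :
    Real.exp (-z) * (Real.exp (z * B) * Real.exp (z * D)) =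
      Real.exp (-((1 - B - D) * z)) := by
  rw [← Real.exp_add, ← Real.exp_add]
  ring_nf

lemma integrableOn_besselProd (hα : -(1 / 2) < α) (hβ : -(1 / 2) < β) (hδ : 0 ≤ δ) (hε : 0 ≤ ε)
    (hB : 0 < B) (hD : 0 < D) (hBD : B + D < 1) :
    IntegrableOn (besselProd α β δ ε B D) (Ioi 0) := by
  obtain ⟨C, hC, h⟩ := exists_besselH_le_exp hα
  obtain ⟨C', hC', h'⟩ := exists_besselH_le_exp hβ
  have hint := (integrableOn_rpow_mul_exp (p := α + β) (c := 1 - B - D) (by linarith)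
    (by linarith)).const_mul (C * C' * (1 / 2) ^ (α + β))
  refine hint.mono' ((continuousOn_besselProd hα hβ hδ hε hB hD).aestronglyMeasurable
    measurableSet_Ioi) ((ae_restrict_iff' measurableSet_Ioi).2 (.of_forall fun z hz => ?_))
  have hz : 0 < z := hz
  rw [Real.norm_of_nonneg (besselProd_nonneg hα hβ hδ hε hB hD hz)]
  have h2 := besselH_nonneg hβ hε (mul_pos hz hD).le
  calc besselProd α β δ ε B D z
      ≤ Real.exp (-z) * (z / 2) ^ (α + β) * ((C * Real.exp (z * B)) * (C' * Real.exp (z * D))) := by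
        unfold besselProd
        gcongr
        · exact h δ hδ _ (mul_pos hz hB)
        · exact h' ε hε _ (mul_pos hz hD)
    _ = (z / 2) ^ (α + β) * (C * C') * (Real.exp (-z) * (Real.exp (z * B) * Real.exp (z * D))) := by
        ring
    _ = _ := by
        rw [exp_neg_mul_exp_mul_exp, div_eq_mul_one_div z 2, Real.mul_rpow hz.le (by norm_num)]
        ring

lemma hasDerivAt_besselH_mul (hα : -(1 / 2) < α) (hδ : 0 ≤ δ) (hB : 0 < B) {z : ℝ} (hz : 0 < z) :
    HasDerivAt (fun B => besselH α δ (z * B)) (z * besselH' α δ (z * B)) B := by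
  have h0 : HasDerivAt (fun B : ℝ => z * B) z B := by simpa using (hasDerivAt_id B).const_mul z
  have := (hasDerivAt_besselH hα hδ (mul_pos hz hB)).comp B h0
  refine this.congr_deriv ?_
  rw [besselH', mul_comm]

/-- Separates from the B-derivative its large part z·H. In the gradient of the kernel the large
parts of the two derivatives nearly cancel, and only `besselR` has to be estimated directly. -/
lemma mul_besselH'_eq (hB : 0 < B) {z : ℝ} (hz : 0 < z) :
    z * besselH' α δ (z * B) =
      (besselR α δ (z * B) + z * B * besselH α δ (z * B)) / B := by
  unfold besselR besselH'
  field_simp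
  ring

/-- The gradient of the integrand of `besselLaplace`. -/
def besselProdGrad (α β δ ε B D z : ℝ) : ℝ × ℝ →L[ℝ] ℝ :=
  (Real.exp (-z) * (z / 2) ^ (α + β) * (z * besselH' α δ (z * B) * besselH β ε (z * D))) •
      ContinuousLinearMap.fst ℝ ℝ ℝ +
    (Real.exp (-z) * (z / 2) ^ (α + β) * (besselH α δ (z * B) * (z * besselH' β ε (z * D)))) •
      ContinuousLinearMap.snd ℝ ℝ ℝ

lemma hasFDerivAt_besselProd (hα : -(1 / 2) < α) (hβ : -(1 / 2) < β) (hδ : 0 ≤ δ) (hε : 0 ≤ ε)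
    (hB : 0 < B) (hD : 0 < D) {z : ℝ} (hz : 0 < z) :
    HasFDerivAt (fun p : ℝ × ℝ => besselProd α β δ ε p.1 p.2 z)
      (besselProdGrad α β δ ε B D z) (B, D) := by
  have f1 : HasFDerivAt (fun p : ℝ × ℝ => p.1) (ContinuousLinearMap.fst ℝ ℝ ℝ) (B, D) :=
    hasFDerivAt_fst
  have f2 : HasFDerivAt (fun p : ℝ × ℝ => p.2) (ContinuousLinearMap.snd ℝ ℝ ℝ) (B, D) :=
    hasFDerivAt_snd
  have h1 := HasDerivAt.comp_hasFDerivAt (B, D) (hasDerivAt_besselH_mul hα hδ hB hz) f1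
  have h2 := HasDerivAt.comp_hasFDerivAt (B, D) (hasDerivAt_besselH_mul hβ hε hD hz) f2
  refine ((h1.mul h2).const_mul (Real.exp (-z) * (z / 2) ^ (α + β))).congr_fderiv ?_
  ext <;> simp [besselProdGrad, -mul_eq_mul_left_iff]
  ring

lemma norm_smul_fst_add_smul_snd_le (c d : ℝ) :
    ‖c • ContinuousLinearMap.fst ℝ ℝ ℝ + d • ContinuousLinearMap.snd ℝ ℝ ℝ‖ ≤ |c| + |d| := by
  refine (norm_add_le _ _).trans ?_
  rw [norm_smul, norm_smul, Real.norm_eq_abs, Real.norm_eq_abs]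
  have h1 := ContinuousLinearMap.norm_fst_le ℝ ℝ ℝ
  have h2 := ContinuousLinearMap.norm_snd_le ℝ ℝ ℝ
  have := abs_nonneg c
  have := abs_nonneg d
  nlinarith

lemma exists_besselH'_le_exp (hα : -(1 / 2) < α) (hδ : 0 ≤ δ) :
    ∃ C : ℝ, 0 < C ∧ ∀ y : ℝ, 0 < y → 0 ≤ besselH' α δ y ∧
      besselH' α δ y ≤ C * (1 / y + 1) * Real.exp y := by
  obtain ⟨C, hC, h⟩ := exists_besselH_le_exp hα
  refine ⟨C * (δ + 1), by positivity, fun y hy => ?_⟩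
  have h1 := h δ hδ y hy
  have h2 := h (δ + 1) (by positivity) y hy
  have h3 := besselH_nonneg hα hδ hy.le
  have h4 := besselH_nonneg hα (δ := δ + 1) (by positivity) hy.le
  unfold besselH'
  refine ⟨by positivity, ?_⟩
  calc δ / y * besselH α δ y + besselH α (δ + 1) y
      ≤ δ / y * (C * Real.exp y) + C * Real.exp y := by gcongr
    _ ≤ δ / y * (C * Real.exp y) + C * Real.exp y +
        (C * Real.exp y * (1 / y) + δ * (C * Real.exp y)) :=
      le_add_of_nonneg_right (by positivity)
    _ = _ := by field_simp; ring

lemma continuousOn_besselH'_mul (hα : -(1 / 2) < α) (hδ : 0 ≤ δ) (hB : 0 < B) :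
    ContinuousOn (fun z => z * besselH' α δ (z * B)) (Ioi 0) := by
  unfold besselH'
  refine continuousOn_id.mul (ContinuousOn.add (ContinuousOn.mul ?_ ?_) ?_)
  · exact continuousOn_const.div (by fun_prop) fun z hz => (mul_pos hz hB).ne'
  · exact continuousOn_besselH_mul hα hδ hB
  · exact continuousOn_besselH_mul hα (by positivity) hB

/-- On a box around (B, D) reaching at most η = (1-B-D)/3 beyond each coordinate, the exponent 1 - x
- y stays above η. Staying above B/2 and D/2 controls the factors 1/x and 1/y. This gives one
integrable majorant for differentiation under the integral. -/
lemma exists_bound_besselProdGrad (hα : -(1 / 2) < α) (hβ : -(1 / 2) < β) (hδ : 0 ≤ δ)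
    (hε : 0 ≤ ε) (hB : 0 < B) (hD : 0 < D) (hBD : B + D < 1) :
    ∃ S ∈ nhds (B, D), ∃ bound : ℝ → ℝ, IntegrableOn bound (Ioi 0) ∧
      ∀ z : ℝ, 0 < z → ∀ p ∈ S, 0 < p.1 ∧ 0 < p.2 ∧
      0 ≤ Real.exp (-z) * (z / 2) ^ (α + β) *
        (z * besselH' α δ (z * p.1) * besselH β ε (z * p.2)) ∧
      0 ≤ Real.exp (-z) * (z / 2) ^ (α + β) *
        (besselH α δ (z * p.1) * (z * besselH' β ε (z * p.2))) ∧
      Real.exp (-z) * (z / 2) ^ (α + β) *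
        (z * besselH' α δ (z * p.1) * besselH β ε (z * p.2)) +
      Real.exp (-z) * (z / 2) ^ (α + β) *
        (besselH α δ (z * p.1) * (z * besselH' β ε (z * p.2))) ≤ bound z := by
  obtain ⟨C, hC, h⟩ := exists_besselH_le_exp hα
  obtain ⟨C', hC', h'⟩ := exists_besselH_le_exp hβ
  obtain ⟨c, hc, g⟩ := exists_besselH'_le_exp hα hδ
  obtain ⟨c', hc', g'⟩ := exists_besselH'_le_exp hβ hε
  obtain ⟨η, hη⟩ : ∃ η : ℝ, η = (1 - B - D) / 3 := ⟨_, rfl⟩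
  have hη0 : 0 < η := by rw [hη]; linarith
  obtain ⟨K, hK⟩ : ∃ K : ℝ, K = (1 / 2) ^ (α + β) * (c * C' * (2 / B) + C * c' * (2 / D)) :=
    ⟨_, rfl⟩
  obtain ⟨K', hK'⟩ : ∃ K' : ℝ, K' = (1 / 2) ^ (α + β) * (c * C' + C * c') := ⟨_, rfl⟩
  refine ⟨Ioo (B / 2) (B + η) ×ˢ Ioo (D / 2) (D + η),
    prod_mem_nhds (Ioo_mem_nhds (by linarith) (by linarith))
      (Ioo_mem_nhds (by linarith) (by linarith)),
    fun z => K * (z ^ (α + β) * Real.exp (-(η * z))) +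
      K' * (z ^ (α + β + 1) * Real.exp (-(η * z))),
    ((integrableOn_rpow_mul_exp (by linarith) hη0).const_mul K).add
      ((integrableOn_rpow_mul_exp (by linarith) hη0).const_mul K'), ?_⟩
  rintro z hz ⟨x, y⟩ ⟨⟨hx1, hx2⟩, ⟨hy1, hy2⟩⟩
  dsimp only at *
  have hx0 : 0 < x := by linarith
  have hy0 : 0 < y := by linarith
  have hzx := mul_pos hz hx0
  have hzy := mul_pos hz hy0
  obtain ⟨g0, g1⟩ := g _ hzx
  obtain ⟨g0', g1'⟩ := g' _ hzy
  have h1 := h δ hδ _ hzx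
  have h1' := h' ε hε _ hzy
  have h0 := besselH_nonneg hα hδ hzx.le
  have h0' := besselH_nonneg hβ hε hzy.le
  refine ⟨hx0, hy0, by positivity, by positivity, ?_⟩
  have e1 : z * besselH' α δ (z * x) ≤ c * (2 / B + z) * Real.exp (z * x) := by
    calc z * besselH' α δ (z * x) ≤ z * (c * (1 / (z * x) + 1) * Real.exp (z * x)) := by gcongr
      _ = c * (1 / x + z) * Real.exp (z * x) := by field_simp
      _ ≤ c * (2 / B + z) * Real.exp (z * x) := by
        gcongr c * (?_ + z) * _
        rw [div_le_div_iff₀ hx0 hB]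
        linarith
  have e2 : z * besselH' β ε (z * y) ≤ c' * (2 / D + z) * Real.exp (z * y) := by
    calc z * besselH' β ε (z * y) ≤ z * (c' * (1 / (z * y) + 1) * Real.exp (z * y)) := by gcongr
      _ = c' * (1 / y + z) * Real.exp (z * y) := by field_simp
      _ ≤ c' * (2 / D + z) * Real.exp (z * y) := by
        gcongr c' * (?_ + z) * _
        rw [div_le_div_iff₀ hy0 hD]
        linarith
  have e3 : Real.exp (-((1 - x - y) * z)) ≤ Real.exp (-(η * z)) := by
    refine Real.exp_le_exp.2 (neg_le_neg ?_)
    gcongr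
    linarith
  have hw : 0 ≤ (z / 2) ^ (α + β) := by positivity
  calc _ ≤ Real.exp (-z) * (z / 2) ^ (α + β) *
        (c * (2 / B + z) * Real.exp (z * x) * (C' * Real.exp (z * y))) +
      Real.exp (-z) * (z / 2) ^ (α + β) *
        (C * Real.exp (z * x) * (c' * (2 / D + z) * Real.exp (z * y))) := by gcongr
    _ = (z / 2) ^ (α + β) * (c * C' * (2 / B + z) + C * c' * (2 / D + z)) *
        (Real.exp (-z) * (Real.exp (z * x) * Real.exp (z * y))) := by ring
    _ ≤ (z / 2) ^ (α + β) * (c * C' * (2 / B + z) + C * c' * (2 / D + z)) *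
        Real.exp (-(η * z)) := by
      rw [exp_neg_mul_exp_mul_exp]
      gcongr
    _ = _ := by
      rw [hK, hK', div_eq_mul_one_div z 2, Real.mul_rpow hz.le (by norm_num),
        Real.rpow_add_one hz.ne']
      ring

lemma integrableOn_besselProd_fst (hα : -(1 / 2) < α) (hβ : -(1 / 2) < β) (hδ : 0 ≤ δ)
    (hε : 0 ≤ ε) (hB : 0 < B) (hD : 0 < D) (hBD : B + D < 1) :
    IntegrableOn (fun z => Real.exp (-z) * (z / 2) ^ (α + β) *
      (z * besselH' α δ (z * B) * besselH β ε (z * D))) (Ioi 0) := by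
  obtain ⟨S, hS, bound, hb, hle⟩ := exists_bound_besselProdGrad hα hβ hδ hε hB hD hBD
  refine hb.mono' (ContinuousOn.aestronglyMeasurable ((continuousOn_weight _).mul
    ((continuousOn_besselH'_mul hα hδ hB).mul (continuousOn_besselH_mul hβ hε hD)))
    measurableSet_Ioi) ((ae_restrict_iff' measurableSet_Ioi).2 (.of_forall fun z hz => ?_))
  obtain ⟨-, -, a1, a2, a3⟩ := hle z hz _ (mem_of_mem_nhds hS)
  rw [Real.norm_of_nonneg a1]
  linarith

lemma integrableOn_besselProd_snd (hα : -(1 / 2) < α) (hβ : -(1 / 2) < β) (hδ : 0 ≤ δ)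
    (hε : 0 ≤ ε) (hB : 0 < B) (hD : 0 < D) (hBD : B + D < 1) :
    IntegrableOn (fun z => Real.exp (-z) * (z / 2) ^ (α + β) *
      (besselH α δ (z * B) * (z * besselH' β ε (z * D)))) (Ioi 0) := by
  obtain ⟨S, hS, bound, hb, hle⟩ := exists_bound_besselProdGrad hα hβ hδ hε hB hD hBD
  refine hb.mono' (ContinuousOn.aestronglyMeasurable ((continuousOn_weight _).mul
    ((continuousOn_besselH_mul hα hδ hB).mul (continuousOn_besselH'_mul hβ hε hD)))
    measurableSet_Ioi) ((ae_restrict_iff' measurableSet_Ioi).2 (.of_forall fun z hz => ?_))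
  obtain ⟨-, -, a1, a2, a3⟩ := hle z hz _ (mem_of_mem_nhds hS)
  rw [Real.norm_of_nonneg a2]
  linarith

lemma hasFDerivAt_integral_besselProd (hα : -(1 / 2) < α) (hβ : -(1 / 2) < β) (hδ : 0 ≤ δ)
    (hε : 0 ≤ ε) (hB : 0 < B) (hD : 0 < D) (hBD : B + D < 1) :
    HasFDerivAt (fun p : ℝ × ℝ => besselLaplace α β δ ε p.1 p.2)
      (∫ z in Ioi (0 : ℝ), besselProdGrad α β δ ε B D z) (B, D) := by
  obtain ⟨S, hS, bound, hb, hle⟩ := exists_bound_besselProdGrad hα hβ hδ hε hB hD hBD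
  have m1 := integrableOn_besselProd_fst hα hβ hδ hε hB hD hBD
  have m2 := integrableOn_besselProd_snd hα hβ hδ hε hB hD hBD
  have m3 : AEStronglyMeasurable (besselProdGrad α β δ ε B D) (volume.restrict (Ioi 0)) := by
    unfold besselProdGrad
    exact (m1.aestronglyMeasurable.smul_const _).add (m2.aestronglyMeasurable.smul_const _)
  have key := hasFDerivAt_integral_of_dominated_of_fderiv_le (𝕜 := ℝ) (x₀ := (B, D))
    (μ := volume.restrict (Ioi (0 : ℝ)))
    (F := fun (p : ℝ × ℝ) z => besselProd α β δ ε p.1 p.2 z)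
    (F' := fun (p : ℝ × ℝ) z => besselProdGrad α β δ ε p.1 p.2 z) (bound := bound) hS ?_ ?_ ?_ ?_
    hb ?_
  · exact key
  · filter_upwards [hS] with p hp
    obtain ⟨h1, h2, -⟩ := hle 1 one_pos p hp
    exact (continuousOn_besselProd hα hβ hδ hε h1 h2).aestronglyMeasurable measurableSet_Ioi
  · exact integrableOn_besselProd hα hβ hδ hε hB hD hBD
  · exact m3
  · refine (ae_restrict_iff' measurableSet_Ioi).2 (.of_forall fun z hz p hp => ?_)
    obtain ⟨-, -, a1, a2, a3⟩ := hle z hz _ hp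
    refine (norm_smul_fst_add_smul_snd_le _ _).trans ?_
    rwa [abs_of_nonneg a1, abs_of_nonneg a2]
  · refine (ae_restrict_iff' measurableSet_Ioi).2 (.of_forall fun z hz p hp => ?_)
    obtain ⟨h1, h2, -⟩ := hle 1 one_pos p hp
    exact hasFDerivAt_besselProd hα hβ hδ hε h1 h2 hz

lemma hasFDerivAt_besselLaplace (hα : -(1 / 2) < α) (hβ : -(1 / 2) < β) (hδ : 0 ≤ δ)
    (hε : 0 ≤ ε) (hB : 0 < B) (hD : 0 < D) (hBD : B + D < 1) :
    HasFDerivAt (fun p : ℝ × ℝ => besselLaplace α β δ ε p.1 p.2)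
      ((∫ z in Ioi (0 : ℝ), Real.exp (-z) * (z / 2) ^ (α + β) *
          (z * besselH' α δ (z * B) * besselH β ε (z * D))) • ContinuousLinearMap.fst ℝ ℝ ℝ +
        (∫ z in Ioi (0 : ℝ), Real.exp (-z) * (z / 2) ^ (α + β) *
          (besselH α δ (z * B) * (z * besselH' β ε (z * D)))) •
            ContinuousLinearMap.snd ℝ ℝ ℝ) (B, D) := by
  have m1 := integrableOn_besselProd_fst hα hβ hδ hε hB hD hBD
  have m2 := integrableOn_besselProd_snd hα hβ hδ hε hB hD hBD
  refine (hasFDerivAt_integral_besselProd hα hβ hδ hε hB hD hBD).congr_fderiv ?_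
  unfold besselProdGrad
  rw [integral_add (m1.smul_const _) (m2.smul_const _), integral_smul_const, integral_smul_const]

end

end JacobiRiesz
end

noncomputable section
namespace JacobiRiesz

/-! ### Pointwise estimates of the integrand -/

/-- The relations between `s = sin (θ/2)`, `t = sin (φ/2)`, `s' = cos (θ/2)`, `t' = cos (φ/2)` and
`x = |θ - φ|` on which the estimates rest. -/
structure OffDiag (s t s' t' x : ℝ) : Prop where
  s_pos : 0 < s
  t_pos : 0 < t
  s'_pos : 0 < s'
  t'_pos : 0 < t'
  x_pos : 0 < x
  s_le : s ≤ t + x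
  t_le : t ≤ s + x
  s'_le : s' ≤ t' + x
  t'_le : t' ≤ s' + x
  s_le_one : s ≤ 1
  t_le_one : t ≤ 1
  s'_le_one : s' ≤ 1
  t'_le_one : t' ≤ 1
  sq_le : x ^ 2 ≤ 20 * (1 - s * t - s' * t')
  cross_le : |s' * t - s * t'| ≤ x

lemma OffDiag.q_pos {s t s' t' x : ℝ} (h : OffDiag s t s' t' x) : 0 < 1 - s * t - s' * t' := by
  have := h.sq_le
  have := pow_pos h.x_pos 2
  linarith

lemma exists_one_add_rpow_le_exp {p c : ℝ} (hp : 0 < p) (hc : 0 < c) :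
    ∃ C : ℝ, 0 < C ∧ ∀ v : ℝ, 0 ≤ v → (1 + v) ^ p ≤ C * Real.exp (c * v) := by
  set k : ℝ := max 1 (p / c)
  have hk1 : 1 ≤ k := le_max_left _ _
  have hk2 : p / c ≤ k := le_max_right _ _
  have hk : 0 < k := by linarith
  refine ⟨k ^ p, by positivity, fun v hv => ?_⟩
  have h1 : 1 + v ≤ k * Real.exp (c * v / p) := by
    have h2 : c * v / p + 1 ≤ Real.exp (c * v / p) := Real.add_one_le_exp _
    have h3 : 1 + v ≤ k * (c * v / p + 1) := by
      have : v ≤ k * (c * v / p) := by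
        calc v = p / c * (c * v / p) := by field_simp
          _ ≤ _ := by gcongr
      linarith
    exact h3.trans (by gcongr)
  calc (1 + v) ^ p ≤ (k * Real.exp (c * v / p)) ^ p := by gcongr
    _ = k ^ p * Real.exp (c * v) := by
      rw [Real.mul_rpow hk.le (Real.exp_pos _).le, ← Real.exp_mul]
      congr 2
      field_simp

/-- The Bessel decay sees only B = st, whereas the volume needs S² = (s+x)². When B is much smaller
than S², q is comparable to S², so a fraction of e^{-qz} pays for (1+zq)^p in zS² ≤ 80 (1+zB)(1+zq).
-/
lemma exists_exp_mul_rpow_le {p : ℝ} (hp : 0 < p) : ∃ C : ℝ, 0 < C ∧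
    ∀ z B q S : ℝ, 0 < z → 0 ≤ B → 0 < q → 0 < S → S ^ 2 ≤ 80 * (B + q) →
      Real.exp (-(q / 4 * z)) * (1 + z * B) ^ (-p) ≤ C * (z ^ (-p) * S ^ (-(2 * p))) := by
  obtain ⟨C, hC, h⟩ := exists_one_add_rpow_le_exp hp (c := 1 / 4) (by norm_num)
  refine ⟨80 ^ p * C, by positivity, fun z B q S hz hB hq hS hSq => ?_⟩
  have h1 : z * S ^ 2 ≤ 80 * ((1 + z * B) * (1 + z * q)) := by
    have : 0 ≤ z * B * (z * q) := by positivity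
    nlinarith
  have h2 : (z * S ^ 2) ^ p ≤ 80 ^ p * ((1 + z * B) ^ p * (C * Real.exp (1 / 4 * (z * q)))) := by
    calc (z * S ^ 2) ^ p ≤ (80 * ((1 + z * B) * (1 + z * q))) ^ p := by gcongr
      _ = 80 ^ p * ((1 + z * B) ^ p * (1 + z * q) ^ p) := by
        rw [Real.mul_rpow (by norm_num) (by positivity),
          Real.mul_rpow (by positivity) (by positivity)]
      _ ≤ _ := by
        gcongr
        exact h _ (by positivity)
  have e1 : z ^ (-p) * S ^ (-(2 * p)) = ((z * S ^ 2) ^ p)⁻¹ := by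
    rw [Real.mul_rpow hz.le (by positivity), mul_inv, Real.rpow_neg hz.le, Real.rpow_neg hS.le,
      Real.rpow_mul hS.le, Real.rpow_two]
  rw [e1, ← div_eq_mul_inv, le_div_iff₀ (by positivity), Real.rpow_neg (by positivity),
    Real.exp_neg]
  calc _ ≤ (Real.exp (q / 4 * z))⁻¹ * ((1 + z * B) ^ p)⁻¹ *
        (80 ^ p * ((1 + z * B) ^ p * (C * Real.exp (1 / 4 * (z * q))))) := by gcongr
    _ = 80 ^ p * C := by
      rw [show 1 / 4 * (z * q) = q / 4 * z by ring]
      have : (1 + z * B) ^ p ≠ 0 := by positivity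
      field_simp

/-- Replaces the symmetric √(ST) by S, so that it can cancel 1/sin(θ/2). If x ≤ S then T ≤ 2S and
the square-root branch of the minimum suffices. If S ≤ x then T ≤ 2x, and the linear branch leaves
an extra √z x, absorbed by the exponential. The rate q/16 leaves room for squaring. -/
lemma exp_mul_sqrtMin_le' {j z q S T x : ℝ} (hj : 1 ≤ j) (hz : 0 < z) (hS : 0 < S) (hT : 0 < T)
    (hx : 0 < x) (hTS : T ≤ S + x) (hq : x ^ 2 ≤ 20 * q) :
    Real.exp (-(q / 16 * z)) * sqrtMin j (z * (S * T)) ≤ 20 * (Real.sqrt z * S / j) := by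
  have hj0 : 0 < j := by linarith
  have hsz : 0 < Real.sqrt z := Real.sqrt_pos.2 hz
  have hzz : Real.sqrt z ^ 2 = z := Real.sq_sqrt hz.le
  have hq0 : 0 < q := by nlinarith
  rcases le_total x S with h | h
  · have h1 : Real.sqrt (z * (S * T)) ≤ 2 * (Real.sqrt z * S) := by
      refine Real.sqrt_le_iff.2 ⟨by positivity, ?_⟩
      have : S * T ≤ S * (2 * S) := by gcongr; linarith
      calc z * (S * T) ≤ z * (S * (2 * S)) := by gcongr
        _ = 2 * (z * S ^ 2) := by ring
        _ ≤ 4 * (z * S ^ 2) := by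
          have : 0 < z * S ^ 2 := by positivity
          linarith
        _ = (2 * (Real.sqrt z * S)) ^ 2 := by rw [mul_pow, mul_pow, hzz]; ring
    have h2 : Real.exp (-(q / 16 * z)) ≤ 1 := Real.exp_le_one_iff.2 (by
      have : 0 < q / 16 * z := by positivity
      linarith)
    have h3 : sqrtMin j (z * (S * T)) ≤ 2 * (Real.sqrt z * S / j) := by
      refine (min_le_left _ _).trans ?_
      rw [← mul_div_assoc]
      gcongr
    have h4 := sqrtMin_nonneg hj0 (y := z * (S * T)) (by positivity)
    have h5 : 0 < Real.sqrt z * S / j := by positivity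
    calc _ ≤ 1 * (2 * (Real.sqrt z * S / j)) := by gcongr
      _ ≤ _ := by linarith
  · have h1 : Real.sqrt z * x ≤ 10 * Real.exp (q / 16 * z) := by
      have a1 : q / 16 * z + 1 ≤ Real.exp (q / 16 * z) := Real.add_one_le_exp _
      have a2 : (Real.sqrt z * x) ^ 2 ≤ 320 * (q / 16 * z) := by
        rw [mul_pow, hzz]
        nlinarith
      -- With v = √z x, (v-16)² ≥ 0 gives v ≤ 8 + v²/32, below 10(1 + v²/320).
      nlinarith [sq_nonneg (Real.sqrt z * x - 16)]
    have h2 : sqrtMin j (z * (S * T)) ≤ 2 * (Real.sqrt z * S / j) * (Real.sqrt z * x) := by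
      refine (min_le_right _ _).trans ?_
      have : j ≤ j ^ 2 := by nlinarith
      have hT2 : T ≤ 2 * x := by linarith
      calc z * (S * T) / j ^ 2 ≤ z * (S * (2 * x)) / j := by gcongr
        _ = 2 * (Real.sqrt z ^ 2 * S * x / j) := by rw [hzz]; ring
        _ = _ := by ring
    have h5 : 0 < Real.sqrt z * S / j := by positivity
    rw [Real.exp_neg, inv_mul_le_iff₀ (Real.exp_pos _)]
    refine h2.trans ?_
    calc _ ≤ 2 * (Real.sqrt z * S / j) * (10 * Real.exp (q / 16 * z)) := by gcongr
      _ = _ := by ring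

lemma exp_mul_sqrtMin_le {j z q S T x : ℝ} (hj : 1 ≤ j) (hz : 0 < z) (hS : 0 < S) (hT : 0 < T)
    (hx : 0 < x) (hTS : T ≤ S + x) (hq : x ^ 2 ≤ 20 * q) :
    Real.exp (-(q / 8 * z)) * sqrtMin j (z * (S * T)) ≤ 20 * (Real.sqrt z * S / j) := by
  refine le_trans ?_ (exp_mul_sqrtMin_le' hj hz hS hT hx hTS hq)
  have h := sqrtMin_nonneg (j := j) (by linarith) (y := z * (S * T)) (by positivity)
  have hq0 : 0 < q * z := mul_pos (by nlinarith) hz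
  gcongr ?_ * _
  exact Real.exp_le_exp.2 (by nlinarith)

lemma exp_mul_sqrtMin_sq_le {j z q S T x : ℝ} (hj : 1 ≤ j) (hz : 0 < z) (hS : 0 < S) (hT : 0 < T)
    (hx : 0 < x) (hTS : T ≤ S + x) (hq : x ^ 2 ≤ 20 * q) :
    Real.exp (-(q / 8 * z)) * sqrtMin j (z * (S * T)) ^ 2 ≤ 400 * (z * S ^ 2 / j ^ 2) := by
  have h := exp_mul_sqrtMin_le' hj hz hS hT hx hTS hq
  have h0 := sqrtMin_nonneg (j := j) (by linarith) (y := z * (S * T)) (by positivity)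
  calc _ = (Real.exp (-(q / 16 * z)) * sqrtMin j (z * (S * T))) ^ 2 := by
        rw [mul_pow, ← Real.exp_nat_mul]
        congr 2
        push_cast
        ring
    _ ≤ (20 * (Real.sqrt z * S / j)) ^ 2 := by gcongr
    _ = _ := by
        rw [mul_pow, div_pow, mul_pow, Real.sq_sqrt hz.le]
        ring

/-- A majorant of `μ_{α,β}(B(θ, x)) / x`, for `s = sin (θ/2)` and `s' = cos (θ/2)`. -/
def offDiagVol (α β s s' x : ℝ) : ℝ := (s + x) ^ (2 * α + 1) * (s' + x) ^ (2 * β + 1)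

lemma offDiagVol_pos {α β s t s' t' x : ℝ} (h : OffDiag s t s' t' x) :
    0 < offDiagVol α β s s' x := by
  have := h.s_pos
  have := h.s'_pos
  have := h.x_pos
  unfold offDiagVol
  positivity

/-- Two quarters of e^{-qz} convert the two Bessel weights into powers of s+x and s'+x, and half of
it survives. The exponents of z add up to (α+β) - (α+1/2) - (β+1/2) = -1. -/
lemma exists_weight_le {α β : ℝ} (hα : -(1 / 2) < α) (hβ : -(1 / 2) < β) : ∃ C : ℝ, 0 < C ∧
    ∀ s t s' t' x : ℝ, OffDiag s t s' t' x → ∀ z : ℝ, 0 < z →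
      (z / 2) ^ (α + β) * Real.exp (-((1 - s * t - s' * t') * z)) *
        ((1 + z * (s * t)) ^ (-(α + 1 / 2)) * (1 + z * (s' * t')) ^ (-(β + 1 / 2))) ≤
      C / offDiagVol α β s s' x * (z⁻¹ * Real.exp (-((1 - s * t - s' * t') / 2 * z))) := by
  obtain ⟨C, hC, h⟩ := exists_exp_mul_rpow_le (p := α + 1 / 2) (by linarith)
  obtain ⟨C', hC', h'⟩ := exists_exp_mul_rpow_le (p := β + 1 / 2) (by linarith)
  refine ⟨(1 / 2) ^ (α + β) * C * C', by positivity, fun s t s' t' x hO z hz => ?_⟩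
  have hs := hO.s_pos
  have ht := hO.t_pos
  have hs' := hO.s'_pos
  have ht' := hO.t'_pos
  have hx := hO.x_pos
  have hq := hO.q_pos
  have hqx := hO.sq_le
  obtain ⟨q, hqdef⟩ : ∃ q, q = 1 - s * t - s' * t' := ⟨_, rfl⟩
  rw [← hqdef] at hq hqx ⊢
  -- From s ≤ t + x follows s² ≤ 2st + x², so (s+x)² ≤ 4st + 4x² ≤ 4st + 80q.
  have k1 := h z (s * t) q (s + x) hz (by positivity) hq (by positivity) (by
    have := mul_le_mul_of_nonneg_left hO.s_le hs.le
    nlinarith [sq_nonneg (s - x)])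
  have k2 := h' z (s' * t') q (s' + x) hz (by positivity) hq (by positivity) (by
    have := mul_le_mul_of_nonneg_left hO.s'_le hs'.le
    nlinarith [sq_nonneg (s' - x)])
  have e1 : Real.exp (-(q * z)) = Real.exp (-(q / 4 * z)) * Real.exp (-(q / 4 * z)) *
      Real.exp (-(q / 2 * z)) := by
    rw [← Real.exp_add, ← Real.exp_add]
    ring_nf
  have e2 : (s + x) ^ (-(2 * (α + 1 / 2))) * (s' + x) ^ (-(2 * (β + 1 / 2))) =
      (offDiagVol α β s s' x)⁻¹ := by
    unfold offDiagVol
    rw [Real.rpow_neg (by positivity), Real.rpow_neg (by positivity), mul_inv]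
    ring_nf
  have e3 : (z / 2) ^ (α + β) * (z ^ (-(α + 1 / 2)) * z ^ (-(β + 1 / 2))) =
      (1 / 2) ^ (α + β) * z⁻¹ := by
    rw [div_eq_mul_one_div z 2, Real.mul_rpow hz.le (by norm_num), mul_assoc, mul_left_comm,
      ← Real.rpow_add hz, ← Real.rpow_add hz,
      show α + β + (-(α + 1 / 2) + -(β + 1 / 2)) = -1 by ring, Real.rpow_neg_one]
  calc _ = (z / 2) ^ (α + β) * Real.exp (-(q / 2 * z)) *
        ((Real.exp (-(q / 4 * z)) * (1 + z * (s * t)) ^ (-(α + 1 / 2))) *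
          (Real.exp (-(q / 4 * z)) * (1 + z * (s' * t')) ^ (-(β + 1 / 2)))) := by rw [e1]; ring
    _ ≤ (z / 2) ^ (α + β) * Real.exp (-(q / 2 * z)) *
        ((C * (z ^ (-(α + 1 / 2)) * (s + x) ^ (-(2 * (α + 1 / 2))))) *
          (C' * (z ^ (-(β + 1 / 2)) * (s' + x) ^ (-(2 * (β + 1 / 2)))))) := by gcongr
    _ = C * C' * ((z / 2) ^ (α + β) * (z ^ (-(α + 1 / 2)) * z ^ (-(β + 1 / 2)))) *
        ((s + x) ^ (-(2 * (α + 1 / 2))) * (s' + x) ^ (-(2 * (β + 1 / 2)))) *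
          Real.exp (-(q / 2 * z)) := by ring
    _ = _ := by rw [e2, e3, div_eq_mul_inv]; ring

/-- If `f`, `g` are bounded by the Bessel weights times `F`, `G`, then the product in the integrand
is bounded by the majorant times `F G`. -/
lemma exists_integrand_le {α β : ℝ} (hα : -(1 / 2) < α) (hβ : -(1 / 2) < β) {C₁ C₂ : ℝ}
    (hC₁ : 0 < C₁) (hC₂ : 0 < C₂) : ∃ C : ℝ, 0 < C ∧
    ∀ s t s' t' x : ℝ, OffDiag s t s' t' x → ∀ z : ℝ, 0 < z → ∀ f g F G F₁ G₁ : ℝ,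
      0 ≤ f → 0 ≤ g → 0 ≤ F → 0 ≤ G →
      Real.exp (-(z * (s * t))) * f ≤ C₁ * (1 + z * (s * t)) ^ (-(α + 1 / 2)) * F →
      Real.exp (-(z * (s' * t'))) * g ≤ C₂ * (1 + z * (s' * t')) ^ (-(β + 1 / 2)) * G →
      Real.exp (-((1 - s * t - s' * t') / 8 * z)) * F ≤ F₁ →
      Real.exp (-((1 - s * t - s' * t') / 8 * z)) * G ≤ G₁ →
      Real.exp (-z) * (z / 2) ^ (α + β) * (f * g) ≤
        C / offDiagVol α β s s' x * (z⁻¹ * Real.exp (-((1 - s * t - s' * t') / 4 * z))) *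
          (F₁ * G₁) := by
  obtain ⟨C, hC, h⟩ := exists_weight_le hα hβ
  refine ⟨C * C₁ * C₂, by positivity,
    fun s t s' t' x hO z hz f g F G F₁ G₁ hf0 hg0 hF0 hG0 hf hg hF hG => ?_⟩
  have hs := hO.s_pos
  have ht := hO.t_pos
  have hs' := hO.s'_pos
  have ht' := hO.t'_pos
  have hx := hO.x_pos
  have hV := offDiagVol_pos (α := α) (β := β) hO
  have hw := h s t s' t' x hO z hz
  have hF₁ : 0 ≤ F₁ := le_trans (by positivity) hF
  have e1 : Real.exp (-z) = Real.exp (-((1 - s * t - s' * t') * z)) *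
      (Real.exp (-(z * (s * t))) * Real.exp (-(z * (s' * t')))) := by
    rw [← Real.exp_add, ← Real.exp_add]
    ring_nf
  have e2 : Real.exp (-((1 - s * t - s' * t') / 2 * z)) =
      Real.exp (-((1 - s * t - s' * t') / 4 * z)) * (Real.exp (-((1 - s * t - s' * t') / 8 * z)) *
        Real.exp (-((1 - s * t - s' * t') / 8 * z))) := by
    rw [← Real.exp_add, ← Real.exp_add]
    ring_nf
  calc Real.exp (-z) * (z / 2) ^ (α + β) * (f * g)
      = (z / 2) ^ (α + β) * Real.exp (-((1 - s * t - s' * t') * z)) *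
        ((Real.exp (-(z * (s * t))) * f) * (Real.exp (-(z * (s' * t'))) * g)) := by rw [e1]; ring
    _ ≤ (z / 2) ^ (α + β) * Real.exp (-((1 - s * t - s' * t') * z)) *
        ((C₁ * (1 + z * (s * t)) ^ (-(α + 1 / 2)) * F) *
          (C₂ * (1 + z * (s' * t')) ^ (-(β + 1 / 2)) * G)) := by gcongr
    _ = C₁ * C₂ * ((z / 2) ^ (α + β) * Real.exp (-((1 - s * t - s' * t') * z)) *
        ((1 + z * (s * t)) ^ (-(α + 1 / 2)) * (1 + z * (s' * t')) ^ (-(β + 1 / 2)))) *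
          (F * G) := by ring
    _ ≤ C₁ * C₂ * (C / offDiagVol α β s s' x *
        (z⁻¹ * Real.exp (-((1 - s * t - s' * t') / 2 * z)))) * (F * G) := by gcongr
    _ = C * C₁ * C₂ / offDiagVol α β s s' x *
        (z⁻¹ * Real.exp (-((1 - s * t - s' * t') / 4 * z))) *
          ((Real.exp (-((1 - s * t - s' * t') / 8 * z)) * F) *
            (Real.exp (-((1 - s * t - s' * t') / 8 * z)) * G)) := by rw [e2]; ring
    _ ≤ _ := by gcongr

end JacobiRiesz
end

/-! ### Bounds for the products that occur in the kernel and its gradient -/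

noncomputable section
namespace JacobiRiesz

section

variable {α β a b : ℝ}

lemma exists_besselH_mul_besselH_le (hα : -(1 / 2) < α) (hβ : -(1 / 2) < β) (ha : 1 ≤ a)
    (hb : b = 0 ∨ 1 ≤ b) : ∃ C : ℝ, 0 < C ∧ ∀ j : ℕ, 1 ≤ j →
    ∀ s t s' t' x : ℝ, OffDiag s t s' t' x → ∀ z : ℝ, 0 < z →
      Real.exp (-z) * (z / 2) ^ (α + β) *
          (besselH α (a * j) (z * (s * t)) * besselH β (b * j) (z * (s' * t'))) ≤
        C / offDiagVol α β s s' x * Real.exp (-((1 - s * t - s' * t') / 4 * z)) *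
          (z⁻¹ * Real.sqrt z * s / j) := by
  obtain ⟨C₁, hC₁, h₁⟩ := exists_besselH_mul_nat_le hα ha
  obtain ⟨C₂, hC₂, h₂⟩ := exists_besselH_besselR_le hβ hb
  obtain ⟨C, hC, h⟩ := exists_integrand_le hα hβ hC₁ hC₂
  have hb0 : 0 ≤ b := by rcases hb with rfl | hb <;> linarith
  refine ⟨C * 20, by positivity, fun j hj s t s' t' x hO z hz => ?_⟩
  have hj1 : (1 : ℝ) ≤ j := by exact_mod_cast hj
  have hj0 : (0 : ℝ) < j := by linarith
  have hy := mul_pos hz (mul_pos hO.s_pos hO.t_pos)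
  have hy' := mul_pos hz (mul_pos hO.s'_pos hO.t'_pos)
  have hq := hO.q_pos
  obtain ⟨k₁, -, -⟩ := h₁ j hj _ hy
  obtain ⟨k₂, -⟩ := h₂ j hj _ hy'
  have := h s t s' t' x hO z hz _ _ (sqrtMin j (z * (s * t))) 1 (20 * (Real.sqrt z * s / j)) 1
    (besselH_nonneg hα (mul_nonneg (by linarith) j.cast_nonneg) hy.le) (besselH_nonneg hβ (mul_nonneg hb0 j.cast_nonneg) hy'.le)
    (sqrtMin_nonneg hj0 hy.le) zero_le_one k₁ (by rwa [mul_one])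
    (exp_mul_sqrtMin_le hj1 hz hO.s_pos hO.t_pos hO.x_pos hO.t_le hO.sq_le)
    (by
      rw [mul_one]
      refine Real.exp_le_one_iff.2 ?_
      have : 0 < (1 - s * t - s' * t') / 8 * z := by positivity
      linarith)
  refine this.trans_eq ?_
  ring

/-- The second-order smallness appears as s², enough to compensate the coefficient 1/s² that arises
when 1/sin(θ/2) is differentiated. The factor z of the squared gain cancels 1/z. -/
lemma exists_besselR_sub_mul_besselH_le (hα : -(1 / 2) < α) (hβ : -(1 / 2) < β)
    (ha : a = 1 ∨ 2 ≤ a) (hb : b = 0 ∨ 1 ≤ b) : ∃ C : ℝ, 0 < C ∧ ∀ j : ℕ, 1 ≤ j →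
    ∀ s t s' t' x : ℝ, OffDiag s t s' t' x → ∀ z : ℝ, 0 < z →
      Real.exp (-z) * (z / 2) ^ (α + β) *
          (|besselR α (a * j) (z * (s * t)) - besselH α (a * j) (z * (s * t))| *
            besselH β (b * j) (z * (s' * t'))) ≤
        C / offDiagVol α β s s' x * Real.exp (-((1 - s * t - s' * t') / 4 * z)) *
          (s ^ 2 / j) := by
  obtain ⟨C₁, hC₁, h₁⟩ := exists_besselR_sub_le hα ha
  obtain ⟨C₂, hC₂, h₂⟩ := exists_besselH_besselR_le hβ hb
  obtain ⟨C, hC, h⟩ := exists_integrand_le hα hβ hC₁ hC₂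
  have hb0 : 0 ≤ b := by rcases hb with rfl | hb <;> linarith
  refine ⟨C * 400, by positivity, fun j hj s t s' t' x hO z hz => ?_⟩
  have hj1 : (1 : ℝ) ≤ j := by exact_mod_cast hj
  have hj0 : (0 : ℝ) < j := by linarith
  have hy := mul_pos hz (mul_pos hO.s_pos hO.t_pos)
  have hy' := mul_pos hz (mul_pos hO.s'_pos hO.t'_pos)
  have hq := hO.q_pos
  have k₁ := h₁ j hj _ hy
  obtain ⟨k₂, -⟩ := h₂ j hj _ hy'
  have := h s t s' t' x hO z hz _ _ (j * sqrtMin j (z * (s * t)) ^ 2) 1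
    (j * (400 * (z * s ^ 2 / j ^ 2))) 1
    (abs_nonneg _) (besselH_nonneg hβ (mul_nonneg hb0 j.cast_nonneg) hy'.le)
    (by positivity) zero_le_one k₁ (by rwa [mul_one])
    (by
      rw [mul_left_comm]
      exact mul_le_mul_of_nonneg_left (exp_mul_sqrtMin_sq_le hj1 hz hO.s_pos hO.t_pos hO.x_pos
        hO.t_le hO.sq_le) hj0.le)
    (by
      rw [mul_one]
      refine Real.exp_le_one_iff.2 ?_
      have : 0 < (1 - s * t - s' * t') / 8 * z := by positivity
      linarith)
  refine this.trans_eq ?_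
  field_simp

/-- Each factor contributes one √z, which together cancel 1/z. Both forms are needed: the
θ-derivative divides by s', the φ-derivative by t'. They come from the symmetry of the minimum in s'
and t'. -/
lemma exists_besselH_mul_besselR_le (hα : -(1 / 2) < α) (hβ : -(1 / 2) < β) (ha : 1 ≤ a)
    (hb : b = 0 ∨ 1 ≤ b) : ∃ C : ℝ, 0 < C ∧ ∀ j : ℕ, 1 ≤ j →
    ∀ s t s' t' x : ℝ, OffDiag s t s' t' x → ∀ z : ℝ, 0 < z →
      Real.exp (-z) * (z / 2) ^ (α + β) *
          (besselH α (a * j) (z * (s * t)) * |besselR β (b * j) (z * (s' * t'))|) ≤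
        C / offDiagVol α β s s' x * Real.exp (-((1 - s * t - s' * t') / 4 * z)) *
          (s * s' / j) ∧
      Real.exp (-z) * (z / 2) ^ (α + β) *
          (besselH α (a * j) (z * (s * t)) * |besselR β (b * j) (z * (s' * t'))|) ≤
        C / offDiagVol α β s s' x * Real.exp (-((1 - s * t - s' * t') / 4 * z)) *
          (s * t' / j) := by
  obtain ⟨C₁, hC₁, h₁⟩ := exists_besselH_mul_nat_le hα ha
  obtain ⟨C₂, hC₂, h₂⟩ := exists_besselH_besselR_le hβ hb
  obtain ⟨C, hC, h⟩ := exists_integrand_le hα hβ hC₁ hC₂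
  refine ⟨C * 400, by positivity, fun j hj s t s' t' x hO z hz => ?_⟩
  have hj1 : (1 : ℝ) ≤ j := by exact_mod_cast hj
  have hj0 : (0 : ℝ) < j := by linarith
  have hy := mul_pos hz (mul_pos hO.s_pos hO.t_pos)
  have hy' := mul_pos hz (mul_pos hO.s'_pos hO.t'_pos)
  have hzz : Real.sqrt z * Real.sqrt z = z := Real.mul_self_sqrt hz.le
  obtain ⟨k₁, -, -⟩ := h₁ j hj _ hy
  obtain ⟨-, k₂⟩ := h₂ j hj _ hy'
  have main : ∀ S : ℝ, Real.exp (-((1 - s * t - s' * t') / 8 * z)) *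
      sqrtMin 1 (z * (s' * t')) ≤ 20 * (Real.sqrt z * S / 1) →
      Real.exp (-z) * (z / 2) ^ (α + β) *
          (besselH α (a * j) (z * (s * t)) * |besselR β (b * j) (z * (s' * t'))|) ≤
        C * 400 / offDiagVol α β s s' x * Real.exp (-((1 - s * t - s' * t') / 4 * z)) *
          (s * S / j) := by
    intro S hS
    have := h s t s' t' x hO z hz _ _ (sqrtMin j (z * (s * t))) (sqrtMin 1 (z * (s' * t')))
      (20 * (Real.sqrt z * s / j)) (20 * (Real.sqrt z * S / 1))
      (besselH_nonneg hα (mul_nonneg (by linarith) j.cast_nonneg) hy.le) (abs_nonneg _)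
      (sqrtMin_nonneg hj0 hy.le) (sqrtMin_nonneg one_pos hy'.le) k₁ k₂
      (exp_mul_sqrtMin_le hj1 hz hO.s_pos hO.t_pos hO.x_pos hO.t_le hO.sq_le) hS
    refine this.trans_eq ?_
    rw [show 20 * (Real.sqrt z * s / j) * (20 * (Real.sqrt z * S / 1)) =
      400 * ((Real.sqrt z * Real.sqrt z) * (s * S) / j) by ring, hzz]
    field_simp
  refine ⟨main s' (exp_mul_sqrtMin_le le_rfl hz hO.s'_pos hO.t'_pos hO.x_pos hO.t'_le hO.sq_le),
    main t' ?_⟩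
  rw [mul_comm s' t'] at *
  exact exp_mul_sqrtMin_le le_rfl hz hO.t'_pos hO.s'_pos hO.x_pos hO.s'_le
    (by rw [mul_comm t' s']; exact hO.sq_le)

lemma exists_besselR_mul_besselH_le (hα : -(1 / 2) < α) (hβ : -(1 / 2) < β) (ha : 1 ≤ a)
    (hb : b = 0 ∨ 1 ≤ b) : ∃ C : ℝ, 0 < C ∧ ∀ j : ℕ, 1 ≤ j →
    ∀ s t s' t' x : ℝ, OffDiag s t s' t' x → ∀ z : ℝ, 0 < z →
      Real.exp (-z) * (z / 2) ^ (α + β) *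
          (|besselR α (a * j) (z * (s * t))| * besselH β (b * j) (z * (s' * t'))) ≤
        C / offDiagVol α β s s' x * Real.exp (-((1 - s * t - s' * t') / 4 * z)) *
          (s * t / j) := by
  obtain ⟨C₁, hC₁, h₁⟩ := exists_besselR_le hα ha
  obtain ⟨C₂, hC₂, h₂⟩ := exists_besselH_besselR_le hβ hb
  obtain ⟨C, hC, h⟩ := exists_integrand_le hα hβ hC₁ hC₂
  have hb0 : 0 ≤ b := by rcases hb with rfl | hb <;> linarith
  refine ⟨C, by positivity, fun j hj s t s' t' x hO z hz => ?_⟩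
  have hj0 : (0 : ℝ) < j := by exact_mod_cast hj
  have hy := mul_pos hz (mul_pos hO.s_pos hO.t_pos)
  have hy' := mul_pos hz (mul_pos hO.s'_pos hO.t'_pos)
  have hq := hO.q_pos
  obtain ⟨k₁, -⟩ := h₁ j hj _ hy
  obtain ⟨k₂, -⟩ := h₂ j hj _ hy'
  have hexp : Real.exp (-((1 - s * t - s' * t') / 8 * z)) ≤ 1 := by
    refine Real.exp_le_one_iff.2 ?_
    have : 0 < (1 - s * t - s' * t') / 8 * z := by positivity
    linarith
  have := h s t s' t' x hO z hz _ _ (z * (s * t) / j) 1 (z * (s * t) / j) 1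
    (abs_nonneg _) (besselH_nonneg hβ (mul_nonneg hb0 j.cast_nonneg) hy'.le)
    (by positivity) zero_le_one k₁ (by rwa [mul_one])
    (mul_le_of_le_one_left (by positivity) hexp) (by rwa [mul_one])
  refine this.trans_eq ?_
  field_simp

/-! ### Integrated estimates -/

/-- The kernel of `(sin (θ/2))⁻¹ J^{-1/2}` in terms of Bessel functions. -/
def sinKernel (α β δ ε θ φ : ℝ) : ℝ :=
  (Real.sin (θ / 2))⁻¹ * besselLaplace α β δ ε (Real.sin (θ / 2) * Real.sin (φ / 2))
    (Real.cos (θ / 2) * Real.cos (φ / 2))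

lemma sin_half_pos {θ : ℝ} (hθ : θ ∈ Ioo 0 Real.pi) : 0 < Real.sin (θ / 2) :=
  Real.sin_pos_of_pos_of_lt_pi (by linarith [hθ.1]) (by linarith [hθ.1, hθ.2])

lemma cos_half_pos {θ : ℝ} (hθ : θ ∈ Ioo 0 Real.pi) : 0 < Real.cos (θ / 2) :=
  Real.cos_pos_of_mem_Ioo ⟨by linarith [hθ.1, hθ.2], by linarith [hθ.2]⟩

lemma abs_sin_half_sub_le (θ φ : ℝ) : |Real.sin (θ / 2) - Real.sin (φ / 2)| ≤ |θ - φ| := by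
  refine (Real.abs_sin_sub_sin_le _ _).trans ?_
  rw [← sub_div, abs_div, abs_two]
  linarith [abs_nonneg (θ - φ)]

lemma abs_cos_half_sub_le (θ φ : ℝ) : |Real.cos (θ / 2) - Real.cos (φ / 2)| ≤ |θ - φ| := by
  refine (Real.abs_cos_sub_cos_le _ _).trans ?_
  rw [← sub_div, abs_div, abs_two]
  linarith [abs_nonneg (θ - φ)]

lemma one_sub_sin_mul_sin_sub_cos_mul_cos (θ φ : ℝ) :
    1 - Real.sin (θ / 2) * Real.sin (φ / 2) - Real.cos (θ / 2) * Real.cos (φ / 2) =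
      2 * Real.sin ((θ - φ) / 4) ^ 2 := by
  have h1 : Real.cos ((θ - φ) / 2) = Real.cos (θ / 2) * Real.cos (φ / 2) +
      Real.sin (θ / 2) * Real.sin (φ / 2) := by
    rw [sub_div, Real.cos_sub]
  have h2 : Real.cos ((θ - φ) / 2) = 1 - 2 * Real.sin ((θ - φ) / 4) ^ 2 := by
    rw [show (θ - φ) / 2 = 2 * ((θ - φ) / 4) by ring, Real.cos_two_mul]
    linarith [Real.sin_sq_add_cos_sq ((θ - φ) / 4)]
  linarith

lemma offDiag_sin_cos {θ φ : ℝ} (hθ : θ ∈ Ioo 0 Real.pi) (hφ : φ ∈ Ioo 0 Real.pi) (hne : θ ≠ φ) :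
    OffDiag (Real.sin (θ / 2)) (Real.sin (φ / 2)) (Real.cos (θ / 2)) (Real.cos (φ / 2))
      |θ - φ| where
  s_pos := sin_half_pos hθ
  t_pos := sin_half_pos hφ
  s'_pos := cos_half_pos hθ
  t'_pos := cos_half_pos hφ
  x_pos := abs_pos.2 (sub_ne_zero.2 hne)
  s_le := by linarith [(abs_le.1 (abs_sin_half_sub_le θ φ)).2]
  t_le := by linarith [(abs_le.1 (abs_sin_half_sub_le θ φ)).1]
  s'_le := by linarith [(abs_le.1 (abs_cos_half_sub_le θ φ)).2]
  t'_le := by linarith [(abs_le.1 (abs_cos_half_sub_le θ φ)).1]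
  s_le_one := Real.sin_le_one _
  t_le_one := Real.sin_le_one _
  s'_le_one := Real.cos_le_one _
  t'_le_one := Real.cos_le_one _
  sq_le := by
    rw [one_sub_sin_mul_sin_sub_cos_mul_cos]
    have hx : |(θ - φ) / 4| ≤ Real.pi / 2 := by
      rw [abs_le]
      constructor <;> linarith [hθ.1, hθ.2, hφ.1, hφ.2]
    have h1 := Real.mul_abs_le_abs_sin hx
    have h2 : (2 / Real.pi * |(θ - φ) / 4|) ^ 2 ≤ Real.sin ((θ - φ) / 4) ^ 2 := by
      rw [← sq_abs (Real.sin ((θ - φ) / 4))]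
      gcongr
    -- Here q = 2 sin²((θ-φ)/4) and |sin v| ≥ (2/π)|v|; the right-hand side equals (10/π²)|θ-φ|²,
    -- and π² ≤ 10. This is the source of the constant 20.
    have h3 : |θ - φ| ^ 2 ≤ 40 * (2 / Real.pi * |(θ - φ) / 4|) ^ 2 := by
      have hpi : Real.pi ^ 2 ≤ 10 := by
        have := Real.pi_lt_d2
        have := Real.pi_pos
        nlinarith
      rw [mul_pow, div_pow, sq_abs, sq_abs, div_pow]
      have : 0 < Real.pi ^ 2 := by positivity
      rw [div_mul_div_comm, ← mul_div_assoc, le_div_iff₀ (by positivity)]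
      nlinarith [sq_nonneg (θ - φ)]
    linarith
  cross_le := by
    rw [show Real.cos (θ / 2) * Real.sin (φ / 2) - Real.sin (θ / 2) * Real.cos (φ / 2) =
      Real.sin (φ / 2 - θ / 2) by rw [Real.sin_sub]; ring]
    refine (Real.abs_sin_le_abs).trans ?_
    rw [← sub_div, abs_div, abs_two, abs_sub_comm]
    linarith [abs_nonneg (θ - φ)]

end

end JacobiRiesz
end

/-! ### Size of the kernel and pointwise bound of its gradient -/

noncomputable section
namespace JacobiRiesz

section

variable {α β a b : ℝ}

lemma integrableOn_inv_mul_sqrt_mul_exp {q : ℝ} (hq : 0 < q) :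
    IntegrableOn (fun z : ℝ => Real.exp (-(q / 4 * z)) * (z⁻¹ * Real.sqrt z)) (Ioi 0) := by
  refine (integrableOn_rpow_mul_exp (p := -(1 / 2)) (c := q / 4) (by norm_num)
    (by positivity)).congr_fun (fun z hz => ?_) measurableSet_Ioi
  have hz : (0 : ℝ) < z := hz
  rw [Real.sqrt_eq_rpow, ← Real.rpow_neg_one, ← Real.rpow_add hz, mul_comm]
  norm_num

lemma integral_inv_mul_sqrt_mul_exp_le {q x : ℝ} (hx : 0 < x) (hq : x ^ 2 ≤ 20 * q) :
    ∫ z in Ioi (0 : ℝ), Real.exp (-(q / 4 * z)) * (z⁻¹ * Real.sqrt z) ≤ 18 / x := by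
  have hq0 : 0 < q := by nlinarith
  have h := Real.integral_rpow_mul_exp_neg_mul_Ioi (a := 1 / 2) (r := q / 4) (by norm_num)
    (by positivity)
  have e : ∫ z in Ioi (0 : ℝ), Real.exp (-(q / 4 * z)) * (z⁻¹ * Real.sqrt z) =
      ∫ z in Ioi (0 : ℝ), z ^ ((1 : ℝ) / 2 - 1) * Real.exp (-(q / 4 * z)) := by
    refine setIntegral_congr_fun measurableSet_Ioi fun z hz => ?_
    have hz : (0 : ℝ) < z := hz
    rw [Real.sqrt_eq_rpow, ← Real.rpow_neg_one, ← Real.rpow_add hz, mul_comm]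
    norm_num
  rw [e, h, Real.Gamma_one_half_eq, ← Real.sqrt_eq_rpow]
  -- 4/q ≤ 80/x² < (9/x)².
  have h1 : Real.sqrt (1 / (q / 4)) ≤ 9 / x := by
    refine Real.sqrt_le_iff.2 ⟨by positivity, ?_⟩
    rw [div_pow, div_le_div_iff₀ (by positivity) (by positivity)]
    nlinarith
  have h2 : Real.sqrt Real.pi ≤ 2 := by
    refine Real.sqrt_le_iff.2 ⟨by norm_num, ?_⟩
    linarith [Real.pi_le_four]
  calc _ ≤ 9 / x * 2 := by gcongr
    _ = _ := by ring

/-- The factor s/j of the integrand bound cancels the prefactor 1/s and the multiplier j, and the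
integral of z^{-1/2} e^{-qz/4} is at most 18/x. -/
theorem exists_sinKernel_le (hα : -(1 / 2) < α) (hβ : -(1 / 2) < β) (ha : 1 ≤ a)
    (hb : b = 0 ∨ 1 ≤ b) : ∃ C : ℝ, 0 < C ∧ ∀ j : ℕ, 1 ≤ j →
    ∀ θ ∈ Ioo 0 Real.pi, ∀ φ ∈ Ioo 0 Real.pi, θ ≠ φ →
      (j : ℝ) * |sinKernel α β (a * j) (b * j) θ φ| ≤
        C / (|θ - φ| * offDiagVol α β (Real.sin (θ / 2)) (Real.cos (θ / 2)) |θ - φ|) := by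
  obtain ⟨C, hC, h⟩ := exists_besselH_mul_besselH_le hα hβ ha hb
  have hb0 : 0 ≤ b := by rcases hb with rfl | hb <;> linarith
  refine ⟨C * 18, by positivity, fun j hj θ hθ φ hφ hne => ?_⟩
  have hO := offDiag_sin_cos hθ hφ hne
  have hV := offDiagVol_pos (α := α) (β := β) hO
  have hq := hO.q_pos
  have hqx := hO.sq_le
  have hx := hO.x_pos
  have hs := hO.s_pos
  have hj0 : (0 : ℝ) < j := by exact_mod_cast hj
  have hh := h j hj _ _ _ _ _ hO
  unfold sinKernel besselLaplace
  set x := |θ - φ|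
  set s := Real.sin (θ / 2)
  set t := Real.sin (φ / 2)
  set s' := Real.cos (θ / 2)
  set t' := Real.cos (φ / 2)
  set V := offDiagVol α β s s' x
  have hB := mul_pos hO.s_pos hO.t_pos
  have hD := mul_pos hO.s'_pos hO.t'_pos
  have hnn : ∀ z ∈ Ioi (0 : ℝ), 0 ≤ besselProd α β (a * j) (b * j) (s * t) (s' * t') z :=
    fun z hz => besselProd_nonneg hα hβ (by positivity) (by positivity) hB hD hz
  have h1 : ∫ z in Ioi (0 : ℝ), besselProd α β (a * j) (b * j) (s * t) (s' * t') z ≤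
      C / V * (s / j) * (18 / x) := by
    refine le_trans ?_ (mul_le_mul_of_nonneg_left (integral_inv_mul_sqrt_mul_exp_le hx hqx)
      (by positivity))
    rw [← integral_const_mul]
    refine setIntegral_mono_on (integrableOn_besselProd hα hβ (by positivity) (by positivity)
      hB hD (by linarith)) ((integrableOn_inv_mul_sqrt_mul_exp hq).const_mul _)
      measurableSet_Ioi fun z hz => ?_
    refine (hh z hz).trans_eq ?_
    ring
  have h0 := setIntegral_nonneg measurableSet_Ioi hnn (μ := volume)
  rw [abs_of_nonneg (mul_nonneg (by positivity) h0)]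
  calc _ ≤ (j : ℝ) * (s⁻¹ * (C / V * (s / j) * (18 / x))) := by gcongr
    _ = _ := by field_simp

lemma mul_exp_le {z q x : ℝ} (hz : 0 < z) (hq : x ^ 2 ≤ 20 * q) :
    Real.exp (-(q / 4 * z)) * (x * Real.sqrt z) ≤ 10 * Real.exp (-(q / 8 * z)) := by
  have hzz : Real.sqrt z ^ 2 = z := Real.sq_sqrt hz.le
  have h1 : x * Real.sqrt z ≤ 10 * Real.exp (q / 8 * z) := by
    have a1 : q / 8 * z + 1 ≤ Real.exp (q / 8 * z) := Real.add_one_le_exp _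
    have a2 : (x * Real.sqrt z) ^ 2 ≤ 160 * (q / 8 * z) := by
      rw [mul_pow, hzz]
      nlinarith
    nlinarith [sq_nonneg (x * Real.sqrt z - 8)]
  calc _ ≤ Real.exp (-(q / 4 * z)) * (10 * Real.exp (q / 8 * z)) := by gcongr
    _ = _ := by
      rw [mul_left_comm, ← Real.exp_add]
      ring_nf

lemma abs_add_sub_le_of_le {w₁ w₂ w₃ X₁ X₂ X₃ A₁ A₂ A₃ : ℝ} (h₁ : |X₁| ≤ A₁) (h₂ : |X₂| ≤ A₂)
    (h₃ : |X₃| ≤ A₃) (hw₁ : 0 ≤ w₁) (hw₃ : 0 ≤ w₃) :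
    |w₁ * X₁ + w₂ * X₂ - w₃ * X₃| ≤ w₁ * A₁ + |w₂| * A₂ + w₃ * A₃ := by
  calc _ ≤ |w₁ * X₁| + |w₂ * X₂| + |w₃ * X₃| :=
        (abs_sub _ _).trans (add_le_add_left (abs_add_le _ _) _)
    _ = w₁ * |X₁| + |w₂| * |X₂| + w₃ * |X₃| := by
        rw [abs_mul, abs_mul, abs_mul, abs_of_nonneg hw₁, abs_of_nonneg hw₃]
    _ ≤ _ := by gcongr

/-- The two expressions are the integrands of the θ- and φ-derivatives of s⁻¹ L(st, s't'). Splitting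
off the large parts of the Bessel derivatives leaves three terms. The large parts combine with the
coefficient s't - st' = O(x), and x√z is absorbed by the exponential. The other two contain
`besselR`, replaced by `besselR` - `besselH` in the θ-derivative because 1/s is differentiated too.
All three are then O(1/(Vj)), with V the volume majorant. -/
lemma exists_gradIntegrand_le (hα : -(1 / 2) < α) (hβ : -(1 / 2) < β) (ha : a = 1 ∨ 2 ≤ a)
    (hb : b = 0 ∨ 1 ≤ b) : ∃ C : ℝ, 0 < C ∧ ∀ j : ℕ, 1 ≤ j →
    ∀ s t s' t' x : ℝ, OffDiag s t s' t' x → ∀ z : ℝ, 0 < z → ∀ p p₁ p₂ : ℝ,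
      p = besselProd α β (a * j) (b * j) (s * t) (s' * t') z →
      p₁ = Real.exp (-z) * (z / 2) ^ (α + β) *
          (z * besselH' α (a * j) (z * (s * t)) * besselH β (b * j) (z * (s' * t'))) →
      p₂ = Real.exp (-z) * (z / 2) ^ (α + β) *
          (besselH α (a * j) (z * (s * t)) * (z * besselH' β (b * j) (z * (s' * t')))) →
      |-(s' / (2 * s ^ 2)) * p + s⁻¹ * (s' * t / 2) * p₁ - s⁻¹ * (s * t' / 2) * p₂| ≤
        C / offDiagVol α β s s' x / j * Real.exp (-((1 - s * t - s' * t') / 8 * z)) ∧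
      |s⁻¹ * (s * t' / 2) * p₁ - s⁻¹ * (s' * t / 2) * p₂| ≤
        C / offDiagVol α β s s' x / j * Real.exp (-((1 - s * t - s' * t') / 8 * z)) := by
  have ha1 : 1 ≤ a := by rcases ha with h | h <;> linarith
  have hb0 : 0 ≤ b := by rcases hb with rfl | hb <;> linarith
  obtain ⟨C₁, hC₁, h₁⟩ := exists_besselH_mul_besselH_le hα hβ ha1 hb
  obtain ⟨C₂, hC₂, h₂⟩ := exists_besselR_sub_mul_besselH_le hα hβ ha hb
  obtain ⟨C₃, hC₃, h₃⟩ := exists_besselH_mul_besselR_le hα hβ ha1 hb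
  obtain ⟨C₄, hC₄, h₄⟩ := exists_besselR_mul_besselH_le hα hβ ha1 hb
  refine ⟨5 * C₁ + C₂ + C₃ + C₄, by positivity,
    fun j hj s t s' t' x hO z hz p p₁ p₂ hp hp₁ hp₂ => ?_⟩
  have hj0 : (0 : ℝ) < j := by exact_mod_cast hj
  have k₁ := h₁ j hj s t s' t' x hO z hz
  have k₂ := h₂ j hj s t s' t' x hO z hz
  obtain ⟨k₃, k₃'⟩ := h₃ j hj s t s' t' x hO z hz
  have k₄ := h₄ j hj s t s' t' x hO z hz
  have hs := hO.s_pos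
  have ht := hO.t_pos
  have hs' := hO.s'_pos
  have ht' := hO.t'_pos
  have hx := hO.x_pos
  have hB := mul_pos hs ht
  have hD := mul_pos hs' ht'
  have hH := besselH_nonneg hα (δ := a * j) (by positivity) (mul_pos hz hB).le
  have hK := besselH_nonneg hβ (δ := b * j) (by positivity) (mul_pos hz hD).le
  have hexp := mul_exp_le hz hO.sq_le
  have hcross := hO.cross_le
  have hV := offDiagVol_pos (α := α) (β := β) hO
  have hq := hO.q_pos
  rw [besselProd] at hp
  rw [mul_besselH'_eq hB hz] at hp₁
  rw [mul_besselH'_eq hD hz] at hp₂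
  have hzz : Real.sqrt z * Real.sqrt z = z := Real.mul_self_sqrt hz.le
  have hΦ : 0 < Real.exp (-z) * (z / 2) ^ (α + β) := by positivity
  generalize offDiagVol α β s s' x = V at *
  generalize Real.exp (-z) * (z / 2) ^ (α + β) = Φ at *
  generalize besselH α (a * j) (z * (s * t)) = H at *
  generalize besselH β (b * j) (z * (s' * t')) = K at *
  generalize besselR α (a * j) (z * (s * t)) = R at *
  generalize besselR β (b * j) (z * (s' * t')) = R' at *
  have hE8 : Real.exp (-((1 - s * t - s' * t') / 4 * z)) ≤
      Real.exp (-((1 - s * t - s' * t') / 8 * z)) :=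
    Real.exp_le_exp.2 (by nlinarith [mul_pos hq hz])
  have hE : 0 < Real.exp (-((1 - s * t - s' * t') / 4 * z)) := Real.exp_pos _
  generalize Real.exp (-((1 - s * t - s' * t') / 4 * z)) = E at *
  generalize Real.exp (-((1 - s * t - s' * t') / 8 * z)) = E8 at *
  have a₁ : |Φ * (H * K)| ≤ C₁ / V * E * (z⁻¹ * Real.sqrt z * s / j) := by rw [abs_of_nonneg (by positivity)]; exact k₁
  have a₂ : |Φ * ((R - H) * K)| ≤ C₂ / V * E * (s ^ 2 / j) := by
    rw [abs_mul, abs_mul, abs_of_nonneg hΦ.le, abs_of_nonneg hK]; exact k₂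
  have a₃ : |Φ * (H * R')| ≤ C₃ / V * E * (s * s' / j) := by
    rw [abs_mul, abs_mul, abs_of_nonneg hΦ.le, abs_of_nonneg hH]; exact k₃
  have a₃' : |Φ * (H * R')| ≤ C₃ / V * E * (s * t' / j) := by
    rw [abs_mul, abs_mul, abs_of_nonneg hΦ.le, abs_of_nonneg hH]; exact k₃'
  have a₄ : |Φ * (R * K)| ≤ C₄ / V * E * (s * t / j) := by
    rw [abs_mul, abs_mul, abs_of_nonneg hΦ.le, abs_of_nonneg hK]; exact k₄
  have hw : |z * (s' * t - s * t') / (2 * s)| ≤ z * x / (2 * s) := by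
    rw [abs_div, abs_mul, abs_of_pos hz, abs_of_pos (by positivity : 0 < 2 * s)]
    gcongr
  have hw' : |z * (s * t' - s' * t) / (2 * s)| ≤ z * x / (2 * s) := by
    rw [← abs_neg, ← neg_div, ← mul_neg, neg_sub]
    exact hw
  have hmain : z * x / (2 * s) * (C₁ / V * E * (z⁻¹ * Real.sqrt z * s / j)) ≤
      5 * C₁ / V / j * E8 := by
    calc _ = C₁ / V / j * (E * (x * Real.sqrt z)) / 2 := by field_simp
      _ ≤ C₁ / V / j * (10 * E8) / 2 := by gcongr
      _ = _ := by ring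
  have hs1 := hO.s_le_one
  have ht1 := hO.t_le_one
  have hs1' := hO.s'_le_one
  have ht1' := hO.t'_le_one
  have hfrac : ∀ c : ℝ, 0 < c → ∀ r : ℝ, r ≤ 1 → c / V / j * E * (r / 2) ≤ c / V / j * E8 := by
    intro c hc r hr
    have : 0 < c / V / j := by positivity
    calc _ ≤ c / V / j * E * 1 := by gcongr; linarith
      _ ≤ _ := by rw [mul_one]; gcongr
  constructor
  · have e : -(s' / (2 * s ^ 2)) * p + s⁻¹ * (s' * t / 2) * p₁ - s⁻¹ * (s * t' / 2) * p₂ =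
        s' / (2 * s ^ 2) * (Φ * ((R - H) * K)) +
          z * (s' * t - s * t') / (2 * s) * (Φ * (H * K)) - 1 / (2 * s') * (Φ * (H * R')) := by
      rw [hp, hp₁, hp₂]
      field_simp
      ring
    rw [e]
    refine (abs_add_sub_le_of_le a₂ a₁ a₃ (by positivity) (by positivity)).trans ?_
    calc _ ≤ C₂ / V / j * E * (s' / 2) +
          z * x / (2 * s) * (C₁ / V * E * (z⁻¹ * Real.sqrt z * s / j)) +
          C₃ / V / j * E * (s / 2) := by
          gcongr ?_ + ?_ + ?_
          · refine le_of_eq ?_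
            field_simp
          · gcongr
          · refine le_of_eq ?_
            field_simp
      _ ≤ C₂ / V / j * E8 + 5 * C₁ / V / j * E8 + C₃ / V / j * E8 :=
          add_le_add (add_le_add (hfrac _ hC₂ _ hs1') hmain) (hfrac _ hC₃ _ hs1)
      _ ≤ C₂ / V / j * E8 + 5 * C₁ / V / j * E8 + C₃ / V / j * E8 + C₄ / V / j * E8 :=
          le_add_of_nonneg_right (by have := hE.trans_le hE8; positivity)
      _ = _ := by ring
  · have e : s⁻¹ * (s * t' / 2) * p₁ - s⁻¹ * (s' * t / 2) * p₂ =
        t' / (2 * (s * t)) * (Φ * (R * K)) +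
          z * (s * t' - s' * t) / (2 * s) * (Φ * (H * K)) -
            t / (2 * (s * t')) * (Φ * (H * R')) := by
      rw [hp₁, hp₂]
      field_simp
      ring
    rw [e]
    refine (abs_add_sub_le_of_le a₄ a₁ a₃' (by positivity) (by positivity)).trans ?_
    calc _ ≤ C₄ / V / j * E * (t' / 2) +
          z * x / (2 * s) * (C₁ / V * E * (z⁻¹ * Real.sqrt z * s / j)) +
          C₃ / V / j * E * (t / 2) := by
          gcongr ?_ + ?_ + ?_
          · refine le_of_eq ?_
            field_simp
          · gcongr
          · refine le_of_eq ?_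
            field_simp
      _ ≤ C₄ / V / j * E8 + 5 * C₁ / V / j * E8 + C₃ / V / j * E8 :=
          add_le_add (add_le_add (hfrac _ hC₄ _ ht1') hmain) (hfrac _ hC₃ _ ht1)
      _ ≤ C₄ / V / j * E8 + 5 * C₁ / V / j * E8 + C₃ / V / j * E8 + C₂ / V / j * E8 :=
          le_add_of_nonneg_right (by have := hE.trans_le hE8; positivity)
      _ = _ := by ring

end

end JacobiRiesz
end

/-! ### Integrated gradient bound -/

noncomputable section
namespace JacobiRiesz

section

variable {α β a b : ℝ}

lemma integrableOn_exp_neg_mul {c : ℝ} (hc : 0 < c) :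
    IntegrableOn (fun z : ℝ => Real.exp (-(c * z))) (Ioi 0) := by
  simpa using integrableOn_rpow_mul_exp (p := 0) (by norm_num) hc

lemma integral_exp_neg_mul {c : ℝ} (hc : 0 < c) :
    ∫ z in Ioi (0 : ℝ), Real.exp (-(c * z)) = 1 / c := by
  simpa using Real.integral_rpow_mul_exp_neg_mul_Ioi one_pos hc

/-- The integral of e^{-qz/8} is 8/q ≤ 160/x²; this is where the gradient picks up one more power of
1/x than the kernel. -/
lemma abs_setIntegral_le_of_abs_le {g : ℝ → ℝ} {K q x : ℝ} (hK : 0 ≤ K) (hx : 0 < x)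
    (hq : x ^ 2 ≤ 20 * q) (h : ∀ z : ℝ, 0 < z → |g z| ≤ K * Real.exp (-(q / 8 * z))) :
    |∫ z in Ioi (0 : ℝ), g z| ≤ K * (160 / x ^ 2) := by
  have hq0 : 0 < q := by nlinarith
  have h1 := norm_integral_le_of_norm_le (f := g) (μ := volume.restrict (Ioi (0 : ℝ)))
    ((integrableOn_exp_neg_mul (c := q / 8) (by positivity)).const_mul K)
    ((ae_restrict_iff' measurableSet_Ioi).2 (.of_forall fun z hz => h z hz))
  rw [Real.norm_eq_abs, integral_const_mul, integral_exp_neg_mul (by positivity)] at h1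
  refine h1.trans (mul_le_mul_of_nonneg_left ?_ hK)
  rw [div_le_div_iff₀ (by positivity) (by positivity)]
  linarith

lemma integral_add_sub_const_mul {f g h : ℝ → ℝ} {μ : Measure ℝ} (hf : Integrable f μ)
    (hg : Integrable g μ) (hh : Integrable h μ) (c d e : ℝ) :
    ∫ z, (c * f z + d * g z - e * h z) ∂μ = c * ∫ z, f z ∂μ + d * ∫ z, g z ∂μ -
      e * ∫ z, h z ∂μ := by
  have hfg : Integrable (fun z => c * f z + d * g z) μ := (hf.const_mul c).add (hg.const_mul d)
  rw [integral_sub hfg (hh.const_mul e),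
    integral_add (hf.const_mul c) (hg.const_mul d), integral_const_mul, integral_const_mul,
    integral_const_mul]

lemma hasFDerivAt_sin_half_fst (θ φ : ℝ) :
    HasFDerivAt (fun p : ℝ × ℝ => Real.sin (p.1 / 2))
      ((Real.cos (θ / 2) / 2) • ContinuousLinearMap.fst ℝ ℝ ℝ) (θ, φ) := by
  have f1 : HasFDerivAt (fun p : ℝ × ℝ => p.1) (ContinuousLinearMap.fst ℝ ℝ ℝ) (θ, φ) :=
    hasFDerivAt_fst
  have h : HasDerivAt (fun x : ℝ => Real.sin (x / 2)) (Real.cos (θ / 2) / 2) θ := by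
    refine ((hasDerivAt_id θ).div_const 2).sin.congr_deriv ?_
    simp only [id]
    ring
  exact HasDerivAt.comp_hasFDerivAt (θ, φ) h f1

lemma hasFDerivAt_sin_half_snd (θ φ : ℝ) :
    HasFDerivAt (fun p : ℝ × ℝ => Real.sin (p.2 / 2))
      ((Real.cos (φ / 2) / 2) • ContinuousLinearMap.snd ℝ ℝ ℝ) (θ, φ) := by
  have f1 : HasFDerivAt (fun p : ℝ × ℝ => p.2) (ContinuousLinearMap.snd ℝ ℝ ℝ) (θ, φ) :=
    hasFDerivAt_snd
  have h : HasDerivAt (fun x : ℝ => Real.sin (x / 2)) (Real.cos (φ / 2) / 2) φ := by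
    refine ((hasDerivAt_id φ).div_const 2).sin.congr_deriv ?_
    simp only [id]
    ring
  exact HasDerivAt.comp_hasFDerivAt (θ, φ) h f1

lemma hasFDerivAt_cos_half_fst (θ φ : ℝ) :
    HasFDerivAt (fun p : ℝ × ℝ => Real.cos (p.1 / 2))
      ((-(Real.sin (θ / 2) / 2)) • ContinuousLinearMap.fst ℝ ℝ ℝ) (θ, φ) := by
  have f1 : HasFDerivAt (fun p : ℝ × ℝ => p.1) (ContinuousLinearMap.fst ℝ ℝ ℝ) (θ, φ) :=
    hasFDerivAt_fst
  have h : HasDerivAt (fun x : ℝ => Real.cos (x / 2)) (-(Real.sin (θ / 2) / 2)) θ := by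
    have := ((hasDerivAt_id θ).div_const 2).cos
    refine this.congr_deriv ?_
    simp only [id]
    ring
  exact HasDerivAt.comp_hasFDerivAt (θ, φ) h f1

lemma hasFDerivAt_cos_half_snd (θ φ : ℝ) :
    HasFDerivAt (fun p : ℝ × ℝ => Real.cos (p.2 / 2))
      ((-(Real.sin (φ / 2) / 2)) • ContinuousLinearMap.snd ℝ ℝ ℝ) (θ, φ) := by
  have f1 : HasFDerivAt (fun p : ℝ × ℝ => p.2) (ContinuousLinearMap.snd ℝ ℝ ℝ) (θ, φ) :=
    hasFDerivAt_snd
  have h : HasDerivAt (fun x : ℝ => Real.cos (x / 2)) (-(Real.sin (φ / 2) / 2)) φ := by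
    have := ((hasDerivAt_id φ).div_const 2).cos
    refine this.congr_deriv ?_
    simp only [id]
    ring
  exact HasDerivAt.comp_hasFDerivAt (θ, φ) h f1

lemma hasFDerivAt_inv_sin_mul {L : ℝ → ℝ → ℝ} {θ φ LB LD : ℝ} (hs : Real.sin (θ / 2) ≠ 0)
    (hL : HasFDerivAt (fun p : ℝ × ℝ => L p.1 p.2)
      (LB • ContinuousLinearMap.fst ℝ ℝ ℝ + LD • ContinuousLinearMap.snd ℝ ℝ ℝ)
      (Real.sin (θ / 2) * Real.sin (φ / 2), Real.cos (θ / 2) * Real.cos (φ / 2))) :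
    HasFDerivAt (fun p : ℝ × ℝ => (Real.sin (p.1 / 2))⁻¹ *
        L (Real.sin (p.1 / 2) * Real.sin (p.2 / 2)) (Real.cos (p.1 / 2) * Real.cos (p.2 / 2)))
      ((-(Real.cos (θ / 2) / (2 * Real.sin (θ / 2) ^ 2)) *
            L (Real.sin (θ / 2) * Real.sin (φ / 2)) (Real.cos (θ / 2) * Real.cos (φ / 2)) +
          (Real.sin (θ / 2))⁻¹ * (Real.cos (θ / 2) * Real.sin (φ / 2) / 2) * LB -
          (Real.sin (θ / 2))⁻¹ * (Real.sin (θ / 2) * Real.cos (φ / 2) / 2) * LD) •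
            ContinuousLinearMap.fst ℝ ℝ ℝ +
        ((Real.sin (θ / 2))⁻¹ * (Real.sin (θ / 2) * Real.cos (φ / 2) / 2) * LB -
          (Real.sin (θ / 2))⁻¹ * (Real.cos (θ / 2) * Real.sin (φ / 2) / 2) * LD) •
            ContinuousLinearMap.snd ℝ ℝ ℝ) (θ, φ) := by
  have h1 := hasFDerivAt_sin_half_fst θ φ
  have h2 := hasFDerivAt_sin_half_snd θ φ
  have h3 := hasFDerivAt_cos_half_fst θ φ
  have h4 := hasFDerivAt_cos_half_snd θ φ
  have h5 : HasFDerivAt (fun p : ℝ × ℝ => (Real.sin (p.1 / 2))⁻¹) _ (θ, φ) :=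
    HasDerivAt.comp_hasFDerivAt (θ, φ) (hasDerivAt_inv hs) h1
  have h6 := (h1.mul h2).prodMk (h3.mul h4)
  have h7 := HasFDerivAt.comp (f := fun p : ℝ × ℝ => (Real.sin (p.1 / 2) * Real.sin (p.2 / 2),
    Real.cos (p.1 / 2) * Real.cos (p.2 / 2))) (θ, φ) hL h6
  refine (h5.mul h7).congr_fderiv ?_
  ext <;> simp <;> field_simp <;> ring

theorem exists_hasFDerivAt_sinKernel (hα : -(1 / 2) < α) (hβ : -(1 / 2) < β)
    (ha : a = 1 ∨ 2 ≤ a) (hb : b = 0 ∨ 1 ≤ b) : ∃ C : ℝ, 0 < C ∧ ∀ j : ℕ, 1 ≤ j →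
    ∀ θ ∈ Ioo 0 Real.pi, ∀ φ ∈ Ioo 0 Real.pi, θ ≠ φ → ∃ f₁ f₂ : ℝ,
      HasFDerivAt (fun p : ℝ × ℝ => sinKernel α β (a * j) (b * j) p.1 p.2)
        (f₁ • ContinuousLinearMap.fst ℝ ℝ ℝ + f₂ • ContinuousLinearMap.snd ℝ ℝ ℝ) (θ, φ) ∧
      (j : ℝ) * |f₁| ≤
        C / (|θ - φ| ^ 2 * offDiagVol α β (Real.sin (θ / 2)) (Real.cos (θ / 2)) |θ - φ|) ∧
      (j : ℝ) * |f₂| ≤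
        C / (|θ - φ| ^ 2 * offDiagVol α β (Real.sin (θ / 2)) (Real.cos (θ / 2)) |θ - φ|) := by
  obtain ⟨C, hC, h⟩ := exists_gradIntegrand_le hα hβ ha hb
  have ha0 : 0 ≤ a := by rcases ha with h | h <;> linarith
  have hb0 : 0 ≤ b := by rcases hb with rfl | hb <;> linarith
  refine ⟨C * 160, by positivity, fun j hj θ hθ φ hφ hne => ?_⟩
  have hO := offDiag_sin_cos hθ hφ hne
  have hV := offDiagVol_pos (α := α) (β := β) hO
  have hq := hO.q_pos
  have hB := mul_pos hO.s_pos hO.t_pos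
  have hD := mul_pos hO.s'_pos hO.t'_pos
  have hj0 : (0 : ℝ) < j := by exact_mod_cast hj
  have hδ : 0 ≤ a * j := by positivity
  have hε : 0 ≤ b * j := by positivity
  have hL := hasFDerivAt_besselLaplace hα hβ hδ hε hB hD (by linarith)
  have i0 := integrableOn_besselProd hα hβ hδ hε hB hD (by linarith)
  have i1 := integrableOn_besselProd_fst hα hβ hδ hε hB hD (by linarith)
  have i2 := integrableOn_besselProd_snd hα hβ hδ hε hB hD (by linarith)
  refine ⟨_, _, hasFDerivAt_inv_sin_mul hO.s_pos.ne' hL, ?_, ?_⟩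
  · unfold besselLaplace
    rw [← integral_add_sub_const_mul i0 i1 i2]
    have := abs_setIntegral_le_of_abs_le (by positivity) hO.x_pos hO.sq_le
      (fun z hz => (h j hj _ _ _ _ _ hO z hz _ _ _ rfl rfl rfl).1)
    calc _ ≤ _ := mul_le_mul_of_nonneg_left this hj0.le
      _ = _ := by have := hO.x_pos; field_simp
  · rw [← integral_const_mul, ← integral_const_mul,
      ← integral_sub (i1.const_mul _) (i2.const_mul _)]
    have := abs_setIntegral_le_of_abs_le (by positivity) hO.x_pos hO.sq_le
      (fun z hz => (h j hj _ _ _ _ _ hO z hz _ _ _ rfl rfl rfl).2)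
    calc _ ≤ _ := mul_le_mul_of_nonneg_left this hj0.le
      _ = _ := by have := hO.x_pos; field_simp

end

/-! ### The measure of balls -/

/-- Both exponents of the density are positive, so on the ball it is at most its value with both
half-angle functions enlarged by x; the ball has length at most 2x. Only this upper bound is needed,
with positivity so that dividing by the measure is meaningful. -/
lemma jacobiMeasure_ball {α β : ℝ} (hα : -(1 / 2) < α) (hβ : -(1 / 2) < β) {θ x : ℝ}
    (hθ : θ ∈ Ioo 0 Real.pi) (hx : 0 < x) :
    0 < (jacobiMeasure α β).real (Metric.ball θ x) ∧
    (jacobiMeasure α β).real (Metric.ball θ x) ≤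
      2 * (x * offDiagVol α β (Real.sin (θ / 2)) (Real.cos (θ / 2)) x) := by
  set w : ℝ → ℝ := fun y => Real.sin (y / 2) ^ (2 * α + 1) * Real.cos (y / 2) ^ (2 * β + 1)
    with hw
  set V := offDiagVol α β (Real.sin (θ / 2)) (Real.cos (θ / 2)) x with hV
  have hs := sin_half_pos hθ
  have hc := cos_half_pos hθ
  have hwpos : ∀ y ∈ Ioo 0 Real.pi, 0 < w y := fun y hy => by
    have := sin_half_pos hy
    have := cos_half_pos hy
    simp only [hw]
    positivity
  have hV0 : 0 < V := by
    simp only [hV, offDiagVol]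
    positivity
  have hmeas : Measurable fun y => ENNReal.ofReal (w y) := by
    refine Measurable.ennreal_ofReal ?_
    simp only [hw]
    fun_prop
  have e : jacobiMeasure α β (Metric.ball θ x) =
      ∫⁻ y in Metric.ball θ x ∩ Ioo 0 Real.pi, ENNReal.ofReal (w y) := by
    rw [jacobiMeasure, withDensity_apply _ Metric.isOpen_ball.measurableSet,
      Measure.restrict_restrict Metric.isOpen_ball.measurableSet]
  have hle : jacobiMeasure α β (Metric.ball θ x) ≤ ENNReal.ofReal (2 * (x * V)) := by
    rw [e]
    calc ∫⁻ y in Metric.ball θ x ∩ Ioo 0 Real.pi, ENNReal.ofReal (w y)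
        ≤ ∫⁻ _ in Metric.ball θ x ∩ Ioo 0 Real.pi, ENNReal.ofReal V := by
          refine setLIntegral_mono measurable_const fun y hy => ENNReal.ofReal_le_ofReal ?_
          have hyx : |y - θ| < x := by simpa [Real.dist_eq] using hy.1
          have h1 := sin_half_pos hy.2
          have h2 := cos_half_pos hy.2
          have h3 := (abs_le.1 (abs_sin_half_sub_le y θ)).2
          have h4 := (abs_le.1 (abs_cos_half_sub_le y θ)).2
          simp only [hw, hV, offDiagVol]
          gcongr <;> linarith
      _ = ENNReal.ofReal V * volume (Metric.ball θ x ∩ Ioo 0 Real.pi) := by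
          rw [setLIntegral_const]
      _ ≤ ENNReal.ofReal V * volume (Metric.ball θ x) := by
          gcongr
          exact inter_subset_left
      _ = _ := by
          rw [Real.volume_ball, ← ENNReal.ofReal_mul hV0.le]
          congr 1
          ring
  have hpos : 0 < jacobiMeasure α β (Metric.ball θ x) := by
    rw [e, setLIntegral_pos_iff hmeas]
    have hsub : Metric.ball θ x ∩ Ioo 0 Real.pi ⊆
        (Function.support fun y => ENNReal.ofReal (w y)) ∩ (Metric.ball θ x ∩ Ioo 0 Real.pi) := by
      intro y hy
      exact ⟨(ENNReal.ofReal_pos.2 (hwpos y hy.2)).ne', hy⟩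
    refine lt_of_lt_of_le ?_ (measure_mono hsub)
    exact (Metric.isOpen_ball.inter isOpen_Ioo).measure_pos volume
      ⟨θ, Metric.mem_ball_self hx, hθ⟩
  constructor
  · exact ENNReal.toReal_pos hpos.ne' (ne_top_of_le_ne_top ENNReal.ofReal_ne_top hle)
  · exact ENNReal.toReal_le_of_le_ofReal (by positivity) hle

end JacobiRiesz
end

noncomputable section
namespace JacobiRiesz

/-! ### The product formula for Jacobi polynomials -/

section

open Polynomial Finset

variable {α β : ℝ}

/-- `∑_{i+k=m} ξⁱ ηᵏ / (i! k! Γ(i+α+1) Γ(k+β+1))`, the homogeneous parts of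
`E_α(ξ) E_β(η)`. -/
def besselForm (α β : ℝ) (m : ℕ) (ξ η : ℝ) : ℝ :=
  ∑ p ∈ antidiagonal m, besselCoeff α p.1 * besselCoeff β p.2 * (ξ ^ p.1 * η ^ p.2)

/-- The polynomial `x ↦ besselForm α β m (ξ x) (η (1 - x))`. -/
def besselFormPoly (α β : ℝ) (m : ℕ) (ξ η : ℝ) : ℝ[X] :=
  ∑ p ∈ antidiagonal m, C (besselCoeff α p.1 * besselCoeff β p.2 * (ξ ^ p.1 * η ^ p.2)) *
    (X ^ p.1 * (1 - X) ^ p.2)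

lemma eval_besselFormPoly (m : ℕ) (ξ η x : ℝ) :
    (besselFormPoly α β m ξ η).eval x = besselForm α β m (ξ * x) (η * (1 - x)) := by
  simp only [besselFormPoly, besselForm, eval_finsetSum, eval_mul, eval_C, eval_pow, eval_X,
    eval_sub, eval_one, mul_pow]
  exact sum_congr rfl fun p _ => by ring

/-- The Jacobi differential operator in the variable `x = sin²(θ/2)`. -/
def jacobiOp (α β N : ℝ) (p : ℝ[X]) : ℝ[X] :=
  X * (1 - X) * derivative (derivative p) + (C (α + 1) * (1 - X) - C (β + 1) * X) * derivative p +
    C N * p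

lemma jacobiOp_add (N : ℝ) (p q : ℝ[X]) :
    jacobiOp α β N (p + q) = jacobiOp α β N p + jacobiOp α β N q := by
  simp only [jacobiOp, derivative_add]
  ring

lemma jacobiOp_C_mul (N c : ℝ) (p : ℝ[X]) :
    jacobiOp α β N (C c * p) = C c * jacobiOp α β N p := by
  simp only [jacobiOp, derivative_C_mul]
  ring

lemma jacobiOp_zero (N : ℝ) : jacobiOp α β N 0 = 0 := by
  simp [jacobiOp]

lemma jacobiOp_sum {ι : Type*} (N : ℝ) (s : Finset ι) (f : ι → ℝ[X]) :
    jacobiOp α β N (∑ i ∈ s, f i) = ∑ i ∈ s, jacobiOp α β N (f i) := by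
  classical
  induction s using Finset.induction_on with
  | empty => simp [jacobiOp_zero]
  | insert a s ha ih => rw [sum_insert ha, sum_insert ha, jacobiOp_add, ih]

/-- In this basis the operator lowers one exponent at a time, and its diagonal part depends on i + k
only, which is why homogeneous forms are adapted to it. -/
lemma jacobiOp_X_pow_mul (N : ℝ) (i k : ℕ) :
    jacobiOp α β N (X ^ i * (1 - X) ^ k) =
      C (i * (i + α)) * (X ^ (i - 1) * (1 - X) ^ k) +
      C (k * (k + β)) * (X ^ i * (1 - X) ^ (k - 1)) +
      C (N - (i + k) * (i + k + (α + β + 1))) * (X ^ i * (1 - X) ^ k) := by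
  have h1 : derivative (1 - X : ℝ[X]) = -1 := by simp
  rcases i with _ | _ | i <;> rcases k with _ | _ | k <;>
    simp [jacobiOp, derivative_mul, derivative_pow, h1] <;> ring

lemma jacobiOp_besselFormPoly_zero (N ξ η : ℝ) :
    jacobiOp α β N (besselFormPoly α β 0 ξ η) = C N * besselFormPoly α β 0 ξ η := by
  simp [besselFormPoly, jacobiOp]

/-- The coefficient recursion reassembles the two lowering terms into ξ and η times the form of one
degree less. The choice (-1, 1) kills this term and gives the Jacobi polynomial; the choice (y, 1-y)
makes its coefficient 1 and lets sums telescope. -/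
lemma jacobiOp_besselFormPoly_succ (hα : -(1 / 2) < α) (hβ : -(1 / 2) < β) (N ξ η : ℝ) (m : ℕ) :
    jacobiOp α β N (besselFormPoly α β (m + 1) ξ η) =
      C (ξ + η) * besselFormPoly α β m ξ η +
      C (N - (m + 1) * (m + 1 + (α + β + 1))) * besselFormPoly α β (m + 1) ξ η := by
  have e1 : ∑ p ∈ antidiagonal (m + 1),
      C (besselCoeff α p.1 * besselCoeff β p.2 * (ξ ^ p.1 * η ^ p.2)) *
        (C (p.1 * (p.1 + α)) * (X ^ (p.1 - 1) * (1 - X) ^ p.2)) =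
      C ξ * besselFormPoly α β m ξ η := by
    rw [Finset.Nat.sum_antidiagonal_succ, besselFormPoly, mul_sum]
    simp only [Nat.cast_zero, zero_mul, map_zero, mul_zero, zero_add]
    refine sum_congr rfl fun p _ => ?_
    rw [← besselCoeff_succ hα p.1, Nat.add_sub_cancel]
    simp only [C_mul, C_pow, Nat.cast_add, Nat.cast_one]
    ring
  have e2 : ∑ p ∈ antidiagonal (m + 1),
      C (besselCoeff α p.1 * besselCoeff β p.2 * (ξ ^ p.1 * η ^ p.2)) *
        (C (p.2 * (p.2 + β)) * (X ^ p.1 * (1 - X) ^ (p.2 - 1))) =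
      C η * besselFormPoly α β m ξ η := by
    rw [Finset.Nat.sum_antidiagonal_succ', besselFormPoly, mul_sum]
    simp only [Nat.cast_zero, zero_mul, map_zero, mul_zero, zero_add]
    refine sum_congr rfl fun p _ => ?_
    rw [← besselCoeff_succ hβ p.2, Nat.add_sub_cancel]
    simp only [C_mul, C_pow, Nat.cast_add, Nat.cast_one]
    ring
  rw [C_add, add_mul, ← e1, ← e2]
  conv_lhs => rw [besselFormPoly, jacobiOp_sum]
  conv_rhs => rw [besselFormPoly, mul_sum]
  rw [← sum_add_distrib, ← sum_add_distrib]
  refine sum_congr rfl fun p hp => ?_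
  have hm : (p.1 : ℝ) + p.2 = m + 1 := by
    exact_mod_cast mem_antidiagonal.1 hp
  rw [jacobiOp_C_mul, jacobiOp_X_pow_mul, hm]
  ring

lemma coeff_jacobiOp (N : ℝ) (p : ℝ[X]) (i : ℕ) :
    (jacobiOp α β N p).coeff i = (i + 1) * (i + 1 + α) * p.coeff (i + 1) +
      (N - i * (i + (α + β + 1))) * p.coeff i := by
  have e : jacobiOp α β N p = X * derivative (derivative p) -
      X * (X * derivative (derivative p)) + C (α + 1) * derivative p -
      C (α + β + 2) * (X * derivative p) + C N * p := by
    rw [show C (α + β + 2) = C (α + 1) + C (β + 1) by rw [← C_add]; ring_nf]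
    unfold jacobiOp
    ring
  rw [e]
  rcases i with _ | _ | i <;>
    simp only [coeff_add, coeff_sub, coeff_C_mul, coeff_X_mul, coeff_X_mul_zero,
      coeff_derivative] <;> push_cast <;> ring

/-- The equation is a two-term recursion for the coefficients with nonzero leading factor
(i+1)(i+1+α), so the constant term determines the solution. -/
lemma eq_zero_of_jacobiOp_eq_zero (hα : -(1 / 2) < α) {N : ℝ} {p : ℝ[X]}
    (h : jacobiOp α β N p = 0) (h0 : p.coeff 0 = 0) : p = 0 := by
  ext i
  induction i with
  | zero => simpa using h0
  | succ i ih =>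
    have := congrArg (fun q => coeff q i) h
    simp only [coeff_jacobiOp, coeff_zero] at this ih ⊢
    rw [ih, mul_zero, add_zero] at this
    have hi : (0 : ℝ) ≤ i := i.cast_nonneg
    have : ((i : ℝ) + 1) * (i + 1 + α) ≠ 0 := by
      have : 0 < (i : ℝ) + 1 + α := by linarith
      positivity
    simp_all

lemma eval_zero_mul_eq (hα : -(1 / 2) < α) {N : ℝ} {p q : ℝ[X]}
    (hp : jacobiOp α β N p = 0) (hq : jacobiOp α β N q = 0) (x : ℝ) :
    q.eval 0 * p.eval x = p.eval 0 * q.eval x := by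
  have h := eq_zero_of_jacobiOp_eq_zero (α := α) (β := β) (N := N) hα
    (p := C (q.eval 0) * p + C (-p.eval 0) * q)
    (by rw [jacobiOp_add, jacobiOp_C_mul, jacobiOp_C_mul, hp, hq]; simp)
    (by simp [coeff_zero_eq_eval_zero]; ring)
  have := congrArg (eval x) h
  simp at this
  linarith

lemma jacobiOp_besselFormPoly_neg_one (hα : -(1 / 2) < α) (hβ : -(1 / 2) < β) (n : ℕ) :
    jacobiOp α β (n * (n + (α + β + 1))) (besselFormPoly α β n (-1) 1) = 0 := by
  rcases n with _ | n
  · rw [jacobiOp_besselFormPoly_zero]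
    simp
  · rw [jacobiOp_besselFormPoly_succ hα hβ]
    simp

/-- The coefficients `(-n)_m (n+λ)_m`. -/
def productCoeff (l : ℝ) (n : ℕ) : ℕ → ℝ
  | 0 => 1
  | m + 1 => -((n : ℝ) * (n + l) - m * (m + l)) * productCoeff l n m

/-- `∑_{m ≤ n} (-n)_m (n+λ)_m A_m(y x, (1-y)(1-x))` as a polynomial in `x`. -/
def productPoly (α β : ℝ) (n : ℕ) (y : ℝ) : ℝ[X] :=
  ∑ m ∈ range (n + 1), C (productCoeff (α + β + 1) n m) * besselFormPoly α β m y (1 - y)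

lemma jacobiOp_sum_productCoeff (hα : -(1 / 2) < α) (hβ : -(1 / 2) < β) (n K : ℕ) (y : ℝ) :
    jacobiOp α β (n * (n + (α + β + 1))) (∑ m ∈ range (K + 1),
      C (productCoeff (α + β + 1) n m) * besselFormPoly α β m y (1 - y)) =
    C (-productCoeff (α + β + 1) n (K + 1)) * besselFormPoly α β K y (1 - y) := by
  induction K with
  | zero =>
    simp [jacobiOp_besselFormPoly_zero, productCoeff]
  | succ K ih =>
    rw [sum_range_succ, jacobiOp_add, ih, jacobiOp_C_mul, jacobiOp_besselFormPoly_succ hα hβ,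
      show productCoeff (α + β + 1) n (K + 1 + 1) =
        -((n : ℝ) * (n + (α + β + 1)) - ((K + 1 : ℕ) : ℝ) * ((K + 1 : ℕ) + (α + β + 1))) *
          productCoeff (α + β + 1) n (K + 1) from rfl]
    rw [show y + (1 - y) = 1 by ring]
    push_cast
    simp only [C_mul, C_neg, C_1]
    ring

/-- The telescoped sum leaves only the coefficient (-n)_{n+1}, which is zero. -/
lemma jacobiOp_productPoly (hα : -(1 / 2) < α) (hβ : -(1 / 2) < β) (n : ℕ) (y : ℝ) :
    jacobiOp α β (n * (n + (α + β + 1))) (productPoly α β n y) = 0 := by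
  rw [productPoly, jacobiOp_sum_productCoeff hα hβ]
  simp [productCoeff]

lemma eval_productPoly (n : ℕ) (x y : ℝ) : (productPoly α β n y).eval x =
    ∑ m ∈ range (n + 1), productCoeff (α + β + 1) n m *
      besselForm α β m (y * x) ((1 - y) * (1 - x)) := by
  simp [productPoly, eval_finsetSum, eval_besselFormPoly]

lemma eval_productPoly_comm (n : ℕ) (x y : ℝ) :
    (productPoly α β n y).eval x = (productPoly α β n x).eval y := by
  simp only [eval_productPoly, mul_comm]

lemma besselForm_zero_left (m : ℕ) (η : ℝ) :
    besselForm α β m 0 η = besselCoeff α 0 * besselCoeff β m * η ^ m := by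
  rw [besselForm, Finset.Nat.sum_antidiagonal_eq_sum_range_succ
    (fun i k => besselCoeff α i * besselCoeff β k * (0 ^ i * η ^ k)), sum_range_succ']
  simp

lemma besselForm_zero_right (m : ℕ) (ξ : ℝ) :
    besselForm α β m ξ 0 = besselCoeff α m * besselCoeff β 0 * ξ ^ m := by
  rw [besselForm, Finset.Nat.sum_antidiagonal_eq_sum_range_succ
    (fun i k => besselCoeff α i * besselCoeff β k * (ξ ^ i * 0 ^ k)), sum_range_succ]
  rw [sum_eq_zero]
  · simp
  · intro i hi
    have : m - i ≠ 0 := by have := mem_range.1 hi; omega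
    simp [this]

lemma besselForm_zero_zero (m : ℕ) :
    besselForm α β m 0 0 = if m = 0 then besselCoeff α 0 * besselCoeff β 0 else 0 := by
  rw [besselForm_zero_left]
  rcases m with _ | m <;> simp

/-- The product formula for Jacobi polynomials. -/
lemma productPoly_mul (hα : -(1 / 2) < α) (hβ : -(1 / 2) < β) (n : ℕ) (x y : ℝ) :
    besselForm α β n 0 1 * besselForm α β n (-1) 0 * (productPoly α β n y).eval x =
      besselCoeff α 0 * besselCoeff β 0 *
        (besselForm α β n (-x) (1 - x) * besselForm α β n (-y) (1 - y)) := by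
  have hP := jacobiOp_besselFormPoly_neg_one hα hβ n
  have hQ := jacobiOp_productPoly hα hβ n
  -- Let P be the Jacobi polynomial and Q_y the product polynomial. Uniqueness gives Q_y
  -- proportional to P, and by the symmetry Q_y(0) = Q_0(y) the factor is again a value of a
  -- multiple of P. The normalization is read off at Q_0(1), where both arguments of the forms
  -- vanish and only m = 0 survives.
  have k1 := eval_zero_mul_eq hα hP (hQ y) x
  have k2 := eval_zero_mul_eq hα hP (hQ 0) y
  have k3 := eval_zero_mul_eq hα hP (hQ 0) 1
  rw [eval_productPoly_comm n 0 y] at k1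
  simp only [eval_besselFormPoly] at k1 k2 k3
  have k4 : (productPoly α β n 0).eval 1 = besselCoeff α 0 * besselCoeff β 0 := by
    rw [eval_productPoly, sum_eq_single 0]
    · simp [besselForm, productCoeff]
    · intro m _ hm
      simp [besselForm_zero_zero, hm]
    · simp
  rw [k4] at k3
  simp only [neg_one_mul, one_mul, neg_zero, sub_zero, sub_self] at k1 k2 k3
  have h0 : besselForm α β n 0 1 ≠ 0 := by
    rw [besselForm_zero_left]
    have := besselCoeff_pos hα 0
    have := besselCoeff_pos hβ n
    positivity
  apply mul_left_cancel₀ h0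
  generalize (productPoly α β n y).eval x = q at *
  generalize (productPoly α β n 0).eval 0 = q0 at *
  generalize (productPoly α β n 0).eval y = qy at *
  generalize besselForm α β n 0 1 = p0 at *
  generalize besselForm α β n (-1) 0 = p1 at *
  generalize besselForm α β n (-x) (1 - x) = px at *
  generalize besselForm α β n (-y) (1 - y) = py at *
  linear_combination (-(p0 * p1)) * k1 - p1 * px * k2 + px * py * k3

end

end JacobiRiesz
end

noncomputable section
namespace JacobiRiesz

/-! ### Jacobi polynomials in terms of the coefficients of Bessel functions -/

section

open Finset

variable {α β : ℝ}

lemma iteratedDeriv_affine_rpow {c s q : ℝ} (hq : -(1 / 2) < q) (n : ℕ) :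
    ∀ i ≤ n, ∀ y : ℝ, 0 < c + s * y →
      iteratedDeriv i (fun y : ℝ => (c + s * y) ^ ((n : ℝ) + q)) y =
        s ^ i * (Real.Gamma (n + q + 1) / Real.Gamma (((n - i : ℕ) : ℝ) + q + 1)) *
          (c + s * y) ^ (((n - i : ℕ) : ℝ) + q) := by
  intro i
  induction i with
  | zero =>
    intro _ y hy
    have := (Gamma_nat_add_pos hq n).ne'
    simp [div_self this]
  | succ i ih =>
    intro hi y hy
    have hev : iteratedDeriv i (fun y : ℝ => (c + s * y) ^ ((n : ℝ) + q)) =ᶠ[nhds y]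
        fun y => s ^ i * (Real.Gamma (n + q + 1) / Real.Gamma (((n - i : ℕ) : ℝ) + q + 1)) *
          (c + s * y) ^ (((n - i : ℕ) : ℝ) + q) := by
      have : ∀ᶠ z in nhds y, 0 < c + s * z :=
        (isOpen_lt continuous_const (by fun_prop)).mem_nhds hy
      filter_upwards [this] with z hz using ih (by omega) z hz
    have h1 : HasDerivAt (fun y : ℝ => c + s * y) s y := by
      simpa using ((hasDerivAt_id y).const_mul s).const_add c
    have h2 := (h1.rpow_const (p := ((n - i : ℕ) : ℝ) + q) (Or.inl hy.ne')).const_mul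
      (s ^ i * (Real.Gamma (n + q + 1) / Real.Gamma (((n - i : ℕ) : ℝ) + q + 1)))
    rw [iteratedDeriv_succ, hev.deriv_eq, h2.deriv]
    have hk : n - i = n - (i + 1) + 1 := by omega
    rw [hk]
    generalize n - (i + 1) = k
    have hk0 : (0 : ℝ) ≤ k := k.cast_nonneg
    have hg := Gamma_nat_add_pos hq k
    rw [show ((k + 1 : ℕ) : ℝ) + q + 1 = (k + q + 1) + 1 by push_cast; ring,
      Real.Gamma_add_one (by linarith : (k : ℝ) + q + 1 ≠ 0).symm.symm,
      show ((k + 1 : ℕ) : ℝ) + q = k + q + 1 by push_cast; ring, add_sub_cancel_right, pow_succ]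
    have : (k : ℝ) + q + 1 ≠ 0 := by linarith
    field_simp

/-- Leibniz's rule in Rodrigues' formula, with x = sin²(θ/2). The binomial coefficients and Gamma
quotients split into the Bessel coefficients. -/
lemma jacobiP_eq (hα : -(1 / 2) < α) (hβ : -(1 / 2) < β) (n : ℕ) {x : ℝ} (hx : x ∈ Set.Ioo 0 1) :
    jacobiP α β n (1 - 2 * x) = Real.Gamma (n + α + 1) * Real.Gamma (n + β + 1) *
      besselForm α β n (-x) (1 - x) := by
  have hx0 : 0 < x := hx.1
  have hx1 : 0 < 1 - x := by linarith [hx.2]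
  have e1 : (fun y : ℝ => (1 - y) ^ ((n : ℝ) + α)) = fun y => (1 + (-1) * y) ^ ((n : ℝ) + α) := by
    ext y; ring_nf
  have e2 : (fun y : ℝ => (1 + y) ^ ((n : ℝ) + β)) = fun y => (1 + 1 * y) ^ ((n : ℝ) + β) := by
    ext y; ring_nf
  have p1 : 0 < 1 + (-1) * (1 - 2 * x) := by linarith
  have p2 : 0 < 1 + 1 * (1 - 2 * x) := by linarith
  have c1 : ContDiffAt ℝ n (fun y : ℝ => (1 - y) ^ ((n : ℝ) + α)) (1 - 2 * x) := by
    refine ContDiffAt.rpow_const_of_ne (by fun_prop) ?_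
    linarith
  have c2 : ContDiffAt ℝ n (fun y : ℝ => (1 + y) ^ ((n : ℝ) + β)) (1 - 2 * x) := by
    refine ContDiffAt.rpow_const_of_ne (by fun_prop) ?_
    linarith
  rw [jacobiP, iteratedDeriv_fun_mul c1 c2, e1, e2, besselForm,
    Finset.Nat.sum_antidiagonal_eq_sum_range_succ
      (fun i k => besselCoeff α i * besselCoeff β k * ((-x) ^ i * (1 - x) ^ k)),
    ← sum_range_reflect, mul_sum, mul_sum]
  refine sum_congr rfl fun i hi => ?_
  have hi' : i ≤ n := by have := mem_range.1 hi; omega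
  obtain ⟨k, rfl⟩ := Nat.exists_eq_add_of_le hi'
  have s1 : i + k + 1 - 1 - i = k := by omega
  have s2 : i + k - i = k := by omega
  have s3 : i + k - k = i := by omega
  rw [s1, s3, iteratedDeriv_affine_rpow hα _ k (by omega) _ p1,
    iteratedDeriv_affine_rpow hβ _ i (by omega) _ p2, s2, s3]
  have q1 : 1 + (-1) * (1 - 2 * x) = 2 * x := by ring
  have q2 : 1 + 1 * (1 - 2 * x) = 2 * (1 - x) := by ring
  have q3 : 1 - (1 - 2 * x) = 2 * x := by ring
  have q4 : 1 + (1 - 2 * x) = 2 * (1 - x) := by ring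
  rw [q1, q2, q3, q4, Real.rpow_add (by positivity), Real.rpow_add (by positivity),
    Real.rpow_natCast, Real.rpow_natCast, Real.rpow_neg (by positivity),
    Real.rpow_neg (by positivity)]
  have g1 := (Gamma_nat_add_pos hα i).ne'
  have g2 := (Gamma_nat_add_pos hβ k).ne'
  have r1 : (2 * x) ^ α ≠ 0 := by positivity
  have r2 : (2 * (1 - x)) ^ β ≠ 0 := by positivity
  generalize (2 * x) ^ α = R1 at *
  generalize (2 * (1 - x)) ^ β = R2 at *
  have hc : ((i + k).choose k : ℝ) = ((i + k).factorial : ℝ) / (k.factorial * i.factorial) := by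
    rw [Nat.cast_choose ℝ (by omega), s3]
  have f0 : ((i + k).factorial : ℝ) ≠ 0 := by positivity
  have f1 : (i.factorial : ℝ) ≠ 0 := by positivity
  have f2 : (k.factorial : ℝ) ≠ 0 := by positivity
  rw [hc, besselCoeff, besselCoeff, mul_pow, mul_pow, one_pow, pow_add, pow_add, neg_pow x i]
  have hs : ((-1 : ℝ) ^ k) * (-1) ^ k = 1 := by rw [← mul_pow]; simp
  field_simp
  linear_combination (Real.Gamma (((i + k : ℕ) : ℝ) + α + 1) *
    Real.Gamma (((i + k : ℕ) : ℝ) + β + 1)) * hs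

lemma productCoeff_eq {l : ℝ} (hl : 0 < l) {n m : ℕ} (hm : m ≤ n) :
    productCoeff l n m = (-1) ^ m * (n.factorial / (n - m).factorial) *
      (Real.Gamma (n + m + l) / Real.Gamma (n + l)) := by
  have hn : (0 : ℝ) ≤ n := n.cast_nonneg
  have hg : Real.Gamma (n + l) ≠ 0 := (Real.Gamma_pos_of_pos (by positivity)).ne'
  induction m with
  | zero =>
    have f1 : (n.factorial : ℝ) ≠ 0 := by positivity
    simp [productCoeff, div_self hg, div_self f1]
  | succ m ih =>
    rw [productCoeff, ih (by omega)]
    obtain ⟨k, rfl⟩ := Nat.exists_eq_add_of_le hm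
    have s1 : m + 1 + k - m = k + 1 := by omega
    have s2 : m + 1 + k - (m + 1) = k := by omega
    rw [s1, s2, Nat.factorial_succ k]
    have : ((m + 1 + k : ℕ) : ℝ) + (m + 1 : ℕ) + l = ((m + 1 + k : ℕ) + m + l) + 1 := by
      push_cast; ring
    rw [this, Real.Gamma_add_one (by positivity)]
    have f2 : (k.factorial : ℝ) ≠ 0 := by positivity
    generalize Real.Gamma (((m + 1 + k : ℕ) : ℝ) + m + l) = G
    push_cast at hg ⊢
    generalize Real.Gamma ((m : ℝ) + 1 + k + l) = G' at *
    field_simp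
    ring

/-- The `n`-th coefficient of the product expansion, in terms of a sequence of forms `A`. -/
def poissonCoeff (l : ℝ) (A : ℕ → ℝ) (n : ℕ) : ℝ :=
  (2 * n + l) * ∑ p ∈ antidiagonal n,
    (-1) ^ p.2 * (Real.Gamma (2 * p.1 + p.2 + l) / p.2.factorial) * A p.1

lemma cos_eq_one_sub_sin_half_sq (θ : ℝ) : Real.cos θ = 1 - 2 * Real.sin (θ / 2) ^ 2 := by
  have h := Real.cos_two_mul (θ / 2)
  rw [show 2 * (θ / 2) = θ by ring] at h
  rw [h]
  linarith [Real.sin_sq_add_cos_sq (θ / 2)]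

lemma trigJacobi_eq (hα : -(1 / 2) < α) (hβ : -(1 / 2) < β) (n : ℕ) {θ : ℝ}
    (hθ : θ ∈ Set.Ioo 0 Real.pi) :
    trigJacobi α β n θ = jacobiNorm α β n * (Real.Gamma (n + α + 1) * Real.Gamma (n + β + 1) *
      besselForm α β n (-(Real.sin (θ / 2) ^ 2)) (1 - Real.sin (θ / 2) ^ 2)) := by
  have hs := sin_half_pos hθ
  have hc := cos_half_pos hθ
  rw [trigJacobi, cos_eq_one_sub_sin_half_sq, jacobiP_eq hα hβ n]
  exact ⟨by positivity, by nlinarith [Real.sin_sq_add_cos_sq (θ / 2)]⟩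

/-- The product formula with the squared norming constants inserted. The Gamma factors depending on
n + α and n + β cancel, leaving coefficients that involve α and β separately only through the forms.
-/
lemma trigJacobi_mul_trigJacobi (hα : -(1 / 2) < α) (hβ : -(1 / 2) < β) (hl : 0 < α + β + 1)
    (n : ℕ) {θ φ : ℝ} (hθ : θ ∈ Set.Ioo 0 Real.pi) (hφ : φ ∈ Set.Ioo 0 Real.pi) :
    trigJacobi α β n θ * trigJacobi α β n φ = poissonCoeff (α + β + 1)
      (fun m => besselForm α β m ((Real.sin (θ / 2) * Real.sin (φ / 2)) ^ 2)
        ((Real.cos (θ / 2) * Real.cos (φ / 2)) ^ 2)) n := by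
  have hn : (0 : ℝ) ≤ n := n.cast_nonneg
  have g1 := Gamma_nat_add_pos hα n
  have g2 := Gamma_nat_add_pos hβ n
  have g3 : 0 < Real.Gamma (n + (α + β + 1)) := Real.Gamma_pos_of_pos (by positivity)
  have g4 : 0 < (2 * n + (α + β + 1)) := by positivity
  have f0 : (0 : ℝ) < n.factorial := by positivity
  have hnorm : jacobiNorm α β n * jacobiNorm α β n =
      (2 * n + (α + β + 1)) * n.factorial * Real.Gamma (n + (α + β + 1)) /
        (Real.Gamma (n + α + 1) * Real.Gamma (n + β + 1)) := by
    rw [jacobiNorm, Real.Gamma_nat_eq_factorial,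
      show (n : ℝ) + α + β + 1 = n + (α + β + 1) by ring,
      show 2 * (n : ℝ) + α + β + 1 = 2 * n + (α + β + 1) by ring,
      Real.mul_self_sqrt (by positivity)]
  have hcθ : Real.cos (θ / 2) ^ 2 = 1 - Real.sin (θ / 2) ^ 2 := by
    linarith [Real.sin_sq_add_cos_sq (θ / 2)]
  have hcφ : Real.cos (φ / 2) ^ 2 = 1 - Real.sin (φ / 2) ^ 2 := by
    linarith [Real.sin_sq_add_cos_sq (φ / 2)]
  rw [trigJacobi_eq hα hβ n hθ, trigJacobi_eq hα hβ n hφ]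
  have key := productPoly_mul hα hβ n (Real.sin (φ / 2) ^ 2) (Real.sin (θ / 2) ^ 2)
  rw [besselForm_zero_left, besselForm_zero_right, eval_productPoly, ← hcθ, ← hcφ, ← mul_pow,
    ← mul_pow] at key
  rw [← hcθ, ← hcφ, poissonCoeff]
  simp only [mul_pow] at key ⊢
  have hsum : ∑ p ∈ antidiagonal n, (-1) ^ p.2 *
      (Real.Gamma (2 * p.1 + p.2 + (α + β + 1)) / p.2.factorial) *
        besselForm α β p.1 (Real.sin (θ / 2) ^ 2 * Real.sin (φ / 2) ^ 2)
          (Real.cos (θ / 2) ^ 2 * Real.cos (φ / 2) ^ 2) =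
      (-1) ^ n * Real.Gamma (n + (α + β + 1)) / n.factorial * ∑ m ∈ range (n + 1),
        productCoeff (α + β + 1) n m *
        besselForm α β m (Real.sin (θ / 2) ^ 2 * Real.sin (φ / 2) ^ 2)
          (Real.cos (θ / 2) ^ 2 * Real.cos (φ / 2) ^ 2) := by
    rw [Finset.Nat.sum_antidiagonal_eq_sum_range_succ (fun i k => (-1) ^ k *
      (Real.Gamma (2 * i + k + (α + β + 1)) / k.factorial) *
        besselForm α β i (Real.sin (θ / 2) ^ 2 * Real.sin (φ / 2) ^ 2)
          (Real.cos (θ / 2) ^ 2 * Real.cos (φ / 2) ^ 2)), mul_sum]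
    refine sum_congr rfl fun m hm => ?_
    have hm' : m ≤ n := by have := mem_range.1 hm; omega
    rw [productCoeff_eq hl hm']
    obtain ⟨k, rfl⟩ := Nat.exists_eq_add_of_le hm'
    rw [show m + k - m = k by omega,
      show 2 * (m : ℝ) + k + (α + β + 1) = ((m + k : ℕ) : ℝ) + m + (α + β + 1) by push_cast; ring]
    have hs : ((-1 : ℝ) ^ m) * (-1) ^ m = 1 := by rw [← mul_pow]; simp
    have g3' := g3.ne'
    have f0' := f0.ne'
    generalize Real.Gamma (((m + k : ℕ) : ℝ) + (α + β + 1)) = G at *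
    generalize ((m + k).factorial : ℝ) = F at *
    rw [pow_add]
    field_simp
    linear_combination (-besselForm α β m (Real.sin (θ / 2) ^ 2 * Real.sin (φ / 2) ^ 2)
      (Real.cos (θ / 2) ^ 2 * Real.cos (φ / 2) ^ 2)) * hs
  rw [hsum]
  generalize (∑ m ∈ range (n + 1), productCoeff (α + β + 1) n m *
        besselForm α β m (Real.sin (θ / 2) ^ 2 * Real.sin (φ / 2) ^ 2)
          (Real.cos (θ / 2) ^ 2 * Real.cos (φ / 2) ^ 2)) = Q at *
  generalize besselForm α β n (-Real.sin (θ / 2) ^ 2) (Real.cos (θ / 2) ^ 2) = P1 at *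
  generalize besselForm α β n (-Real.sin (φ / 2) ^ 2) (Real.cos (φ / 2) ^ 2) = P2 at *
  have a0 : 0 < Real.Gamma (α + 1) := by simpa using Gamma_nat_add_pos hα 0
  have b0 : 0 < Real.Gamma (β + 1) := by simpa using Gamma_nat_add_pos hβ 0
  have key' : (-1) ^ n * Q = (n.factorial : ℝ) ^ 2 * Real.Gamma (n + α + 1) *
      Real.Gamma (n + β + 1) * (P1 * P2) := by
    simp only [besselCoeff, Nat.factorial_zero, Nat.cast_zero, zero_add, Nat.cast_one,
      one_mul, one_pow, mul_one] at key
    field_simp at key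
    linear_combination key
  calc _ = (jacobiNorm α β n * jacobiNorm α β n) * ((Real.Gamma (n + α + 1) *
        Real.Gamma (n + β + 1)) ^ 2 * (P1 * P2)) := by ring
    _ = (2 * n + (α + β + 1)) * Real.Gamma (n + (α + β + 1)) / n.factorial *
      ((n.factorial : ℝ) ^ 2 * Real.Gamma (n + α + 1) *
      Real.Gamma (n + β + 1) * (P1 * P2)) := by rw [hnorm]; field_simp
    _ = _ := by rw [← key']; ring

end

end JacobiRiesz
end

noncomputable section
namespace JacobiRiesz

/-! ### Sonin's bound and convergence of the Poisson series -/

section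

variable {α β : ℝ}

/-- Since a > 0, the derivative can only turn from nonpositive to nonnegative, so the maximum is at
an endpoint. -/
lemma le_max_of_deriv_affine_sign {S S' : ℝ → ℝ} {a c : ℝ} (ha : 0 < a)
    (hS : ∀ x, HasDerivAt S (S' x) x)
    (hS' : ∀ x, ∃ r : ℝ, 0 ≤ r ∧ S' x = r * (a * x - c)) {x : ℝ} (hx : x ∈ Icc (0 : ℝ) 1) :
    S x ≤ max (S 0) (S 1) := by
  have hd : Differentiable ℝ S := fun x => (hS x).differentiableAt
  rcases le_total (a * x) c with h | h
  · refine le_max_of_le_left ?_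
    have : AntitoneOn S (Icc 0 x) := by
      refine antitoneOn_of_deriv_nonpos (convex_Icc 0 x) hd.continuous.continuousOn
        hd.differentiableOn fun y hy => ?_
      rw [interior_Icc] at hy
      obtain ⟨r, hr, e⟩ := hS' y
      rw [(hS y).deriv, e]
      exact mul_nonpos_of_nonneg_of_nonpos hr (by nlinarith [hy.2])
    exact this (left_mem_Icc.2 hx.1) (right_mem_Icc.2 hx.1) hx.1
  · refine le_max_of_le_right ?_
    have : MonotoneOn S (Icc x 1) := by
      refine monotoneOn_of_deriv_nonneg (convex_Icc x 1) hd.continuous.continuousOn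
        hd.differentiableOn fun y hy => ?_
      rw [interior_Icc] at hy
      obtain ⟨r, hr, e⟩ := hS' y
      rw [(hS y).deriv, e]
      exact mul_nonneg hr (by nlinarith [hy.1])
    exact this (left_mem_Icc.2 hx.2) (right_mem_Icc.2 hx.2) hx.2

lemma besselForm_sq_le (hα : -(1 / 2) < α) (hβ : -(1 / 2) < β) (hl : 0 < α + β + 1) (n : ℕ)
    {x : ℝ} (hx : x ∈ Icc (0 : ℝ) 1) :
    besselForm α β n (-x) (1 - x) ^ 2 ≤
      (besselCoeff α 0 * besselCoeff β n) ^ 2 + (besselCoeff α n * besselCoeff β 0) ^ 2 := by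
  set p := besselFormPoly α β n (-1) 1 with hp
  set N : ℝ := n * (n + (α + β + 1)) with hN
  have e : ∀ y, besselForm α β n (-y) (1 - y) = p.eval y := by
    intro y
    rw [hp, eval_besselFormPoly]
    simp
  have e0 : p.eval 0 = besselCoeff α 0 * besselCoeff β n := by
    rw [← e, neg_zero, besselForm_zero_left]
    simp
  have e1 : p.eval 1 ^ 2 = (besselCoeff α n * besselCoeff β 0) ^ 2 := by
    rw [← e, sub_self, besselForm_zero_right, mul_pow _ ((-1 : ℝ) ^ n), ← pow_mul, mul_comm n 2,
      pow_mul]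
    simp
  rcases Nat.eq_zero_or_pos n with rfl | hn
  · rw [e]
    have : p = Polynomial.C (besselCoeff α 0 * besselCoeff β 0) := by
      simp [hp, besselFormPoly]
    rw [this, Polynomial.eval_C]
    nlinarith [sq_nonneg (besselCoeff α 0 * besselCoeff β 0)]
  have hN0 : 0 < N := by
    have : (0 : ℝ) < n := by exact_mod_cast hn
    positivity
  have hode : ∀ y, y * (1 - y) * (p.derivative.derivative.eval y) +
      ((α + 1) * (1 - y) - (β + 1) * y) * p.derivative.eval y + N * p.eval y = 0 := by
    intro y
    have := congrArg (Polynomial.eval y) (jacobiOp_besselFormPoly_neg_one hα hβ n)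
    simpa [jacobiOp, ← hp, hN] using this
  -- Sonin's function: the differential equation removes p p' and p'' p' from its derivative,
  -- leaving p'² times an affine function. At the endpoints it equals N p². The case n = 0 was set
  -- aside because then N = 0.
  have hS : ∀ y, HasDerivAt (fun y => N * p.eval y ^ 2 + y * (1 - y) * p.derivative.eval y ^ 2)
      (p.derivative.eval y ^ 2 * (2 * (α + β + 1) * y - (2 * α + 1))) y := by
    intro y
    have d1 := ((p.hasDerivAt y).pow 2).const_mul N
    have d2 := ((hasDerivAt_id y).mul ((hasDerivAt_id y).const_sub 1)).mul
      ((p.derivative.hasDerivAt y).pow 2)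
    refine (d1.add d2).congr_deriv ?_
    have := hode y
    simp only [id_eq, Pi.mul_apply, Pi.pow_apply]
    push_cast
    linear_combination 2 * p.derivative.eval y * this
  have h := le_max_of_deriv_affine_sign (a := 2 * (α + β + 1)) (c := 2 * α + 1) (by positivity) hS
    (fun y => ⟨_, sq_nonneg _, rfl⟩) hx
  simp only [zero_mul, sub_self, mul_zero, add_zero] at h
  rw [e, ← e0, ← e1]
  have h' : N * p.eval x ^ 2 ≤ N * (p.eval 0 ^ 2 + p.eval 1 ^ 2) := by
    have h2 : 0 ≤ x * (1 - x) * p.derivative.eval x ^ 2 :=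
      mul_nonneg (mul_nonneg hx.1 (by linarith [hx.2])) (sq_nonneg _)
    have h3 := h.trans (max_le_add_of_nonneg (by positivity) (by positivity))
    linarith
  exact le_of_mul_le_mul_left h' hN0

/-- A majorant for the coefficients of the Poisson series. -/
def poissonMajorant (α β : ℝ) (n : ℕ) : ℝ :=
  (2 * n + (α + β + 1)) * (Real.Gamma (n + (α + β + 1)) / n.factorial) *
    (Real.Gamma (n + α + 1) / Real.Gamma (n + β + 1))

lemma tendsto_natCast_add_div (a b : ℝ) (c : ℝ) (hc : c ≠ 0) :
    Filter.Tendsto (fun n : ℕ => (c * n + a) / (c * n + b)) Filter.atTop (nhds 1) := by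
  have := tendsto_add_mul_div_add_mul_atTop_nhds a b c hc
  rw [div_self hc] at this
  simpa only [add_comm] using this

lemma summable_poissonMajorant (hα : -(1 / 2) < α) (hβ : -(1 / 2) < β) (hl : 0 < α + β + 1)
    {w : ℝ} (hw : w ∈ Ioo (0 : ℝ) 1) : Summable fun n => poissonMajorant α β n * w ^ n := by
  have hw0 := hw.1
  have hpos : ∀ n, 0 < poissonMajorant α β n * w ^ n := by
    intro n
    have := Gamma_nat_add_pos hα n
    have := Gamma_nat_add_pos hβ n
    have : 0 < Real.Gamma (n + (α + β + 1)) := Real.Gamma_pos_of_pos (by positivity)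
    unfold poissonMajorant
    positivity
  refine summable_of_ratio_test_tendsto_lt_one hw.2 (.of_forall fun n => (hpos n).ne') ?_
  have hlim := (((tendsto_natCast_add_div (2 + (α + β + 1)) (α + β + 1) 2 two_ne_zero).mul
    (tendsto_natCast_add_div (α + β + 1) 1 1 one_ne_zero)).mul
    (tendsto_natCast_add_div (α + 1) (β + 1) 1 one_ne_zero)).mul_const w
  simp only [one_mul] at hlim
  refine hlim.congr fun n => ?_
  rw [Real.norm_of_nonneg (hpos _).le, Real.norm_of_nonneg (hpos _).le]
  have hn : (0 : ℝ) ≤ n := n.cast_nonneg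
  have g1 := Gamma_nat_add_pos hα n
  have g2 := Gamma_nat_add_pos hβ n
  have g3 : 0 < Real.Gamma (n + (α + β + 1)) := Real.Gamma_pos_of_pos (by positivity)
  have h1 : 0 < (n : ℝ) + α + 1 := by linarith
  have h2 : 0 < (n : ℝ) + β + 1 := by linarith
  have h3 : 0 < (n : ℝ) + (α + β + 1) := by linarith
  have h4 : 0 < 2 * (n : ℝ) + (α + β + 1) := by linarith
  unfold poissonMajorant
  rw [Nat.factorial_succ, pow_succ,
    show ((n + 1 : ℕ) : ℝ) + (α + β + 1) = (n + (α + β + 1)) + 1 by push_cast; ring,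
    show ((n + 1 : ℕ) : ℝ) + α + 1 = (n + α + 1) + 1 by push_cast; ring,
    show ((n + 1 : ℕ) : ℝ) + β + 1 = (n + β + 1) + 1 by push_cast; ring,
    Real.Gamma_add_one h1.ne', Real.Gamma_add_one h2.ne', Real.Gamma_add_one h3.ne',
    show (n : ℝ) + (β + 1) = n + β + 1 by ring, show (n : ℝ) + (α + 1) = n + α + 1 by ring]
  push_cast
  generalize Real.Gamma ((n : ℝ) + α + 1) = G1 at *
  generalize Real.Gamma ((n : ℝ) + β + 1) = G2 at *
  generalize Real.Gamma ((n : ℝ) + (α + β + 1)) = G3 at *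
  field_simp
  ring

lemma trigJacobi_sq_le (hα : -(1 / 2) < α) (hβ : -(1 / 2) < β) (hl : 0 < α + β + 1)
    (n : ℕ) {θ : ℝ} (hθ : θ ∈ Ioo 0 Real.pi) :
    trigJacobi α β n θ ^ 2 ≤ besselCoeff α 0 ^ 2 * poissonMajorant α β n +
      besselCoeff β 0 ^ 2 * poissonMajorant β α n := by
  have hn : (0 : ℝ) ≤ n := n.cast_nonneg
  have g1 := Gamma_nat_add_pos hα n
  have g2 := Gamma_nat_add_pos hβ n
  have g3 : 0 < Real.Gamma (n + (α + β + 1)) := Real.Gamma_pos_of_pos (by positivity)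
  have g4 : 0 < (2 * n + (α + β + 1)) := by positivity
  have hs := sin_half_pos hθ
  have hnorm : jacobiNorm α β n ^ 2 =
      (2 * n + (α + β + 1)) * n.factorial * Real.Gamma (n + (α + β + 1)) /
        (Real.Gamma (n + α + 1) * Real.Gamma (n + β + 1)) := by
    rw [jacobiNorm, Real.Gamma_nat_eq_factorial,
      show (n : ℝ) + α + β + 1 = n + (α + β + 1) by ring,
      show 2 * (n : ℝ) + α + β + 1 = 2 * n + (α + β + 1) by ring, Real.sq_sqrt (by positivity)]
  have hb := besselForm_sq_le hα hβ hl n (x := Real.sin (θ / 2) ^ 2)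
    ⟨by positivity, by nlinarith [Real.sin_sq_add_cos_sq (θ / 2), sq_nonneg (Real.cos (θ / 2))]⟩
  rw [trigJacobi_eq hα hβ n hθ, mul_pow, mul_pow, hnorm]
  refine (mul_le_mul_of_nonneg_left (mul_le_mul_of_nonneg_left hb (by positivity))
    (by positivity)).trans_eq ?_
  rw [poissonMajorant, poissonMajorant, show β + α + 1 = α + β + 1 by ring]
  rw [show besselCoeff β n = ((n.factorial : ℝ) * Real.Gamma (n + β + 1))⁻¹ from rfl,
    show besselCoeff α n = ((n.factorial : ℝ) * Real.Gamma (n + α + 1))⁻¹ from rfl]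
  field_simp

lemma summable_abs_poissonCoeff (hα : -(1 / 2) < α) (hβ : -(1 / 2) < β) (hl : 0 < α + β + 1)
    {θ φ : ℝ} (hθ : θ ∈ Ioo 0 Real.pi) (hφ : φ ∈ Ioo 0 Real.pi) {w : ℝ}
    (hw : w ∈ Ioo (0 : ℝ) 1) :
    Summable fun n => |trigJacobi α β n θ * trigJacobi α β n φ| * w ^ n := by
  have hs := ((summable_poissonMajorant hα hβ hl hw).mul_left (besselCoeff α 0 ^ 2)).add
    ((summable_poissonMajorant hβ hα (by linarith) hw).mul_left (besselCoeff β 0 ^ 2))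
  refine Summable.of_nonneg_of_le (fun n => ?_) (fun n => ?_) hs
  · have := hw.1
    positivity
  · have h1 := trigJacobi_sq_le hα hβ hl n hθ
    have h2 := trigJacobi_sq_le hα hβ hl n hφ
    rw [← mul_assoc, ← mul_assoc, ← add_mul]
    refine mul_le_mul_of_nonneg_right ?_ (pow_nonneg hw.1.le n)
    rw [abs_mul]
    nlinarith [sq_nonneg (|trigJacobi α β n θ| - |trigJacobi α β n φ|),
      sq_abs (trigJacobi α β n θ), sq_abs (trigJacobi α β n φ)]

end

end JacobiRiesz
end

noncomputable section
namespace JacobiRiesz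

/-! ### Integration of power series against Gamma densities -/

section

variable {α β : ℝ}

lemma integral_exp_neg_mul_rpow {s : ℝ} (hs : 0 < s) :
    ∫ x in Ioi (0 : ℝ), Real.exp (-x) * x ^ (s - 1) = Real.Gamma s :=
  (Real.Gamma_eq_integral hs).symm

lemma hasSum_exp_mul (z : ℝ) : HasSum (fun l : ℕ => z ^ l / l.factorial) (Real.exp z) := by
  rw [Real.exp_eq_exp_ℝ]
  exact NormedSpace.expSeries_div_hasSum_exp z

/-- The binomial series, with Gamma functions. -/
lemma hasSum_Gamma_mul_pow {M w : ℝ} (hM : 0 < M) (hw : |w| < 1) :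
    HasSum (fun l : ℕ => w ^ l * (Real.Gamma (M + l) / l.factorial))
      (Real.Gamma M * (1 - w) ^ (-M)) := by
  obtain ⟨hw1, hw2⟩ := abs_lt.1 hw
  have hval : ∀ v : ℝ, v < 1 → IntegrableOn (fun x : ℝ =>
        Real.exp (-x) * x ^ (M - 1) * Real.exp (v * x)) (Ioi 0) ∧
      ∫ x in Ioi (0 : ℝ), Real.exp (-x) * x ^ (M - 1) * Real.exp (v * x) =
        Real.Gamma M * (1 - v) ^ (-M) := by
    intro v hv
    have hv' : 0 < 1 - v := by linarith
    have e : (fun x : ℝ => Real.exp (-x) * x ^ (M - 1) * Real.exp (v * x)) =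
        fun x => x ^ (M - 1) * Real.exp (-((1 - v) * x)) := by
      ext x
      rw [mul_right_comm, ← Real.exp_add, mul_comm]
      ring_nf
    rw [e]
    refine ⟨integrableOn_rpow_mul_exp (by linarith) hv', ?_⟩
    rw [Real.integral_rpow_mul_exp_neg_mul_Ioi hM hv', one_div, Real.inv_rpow hv'.le,
      Real.rpow_neg hv'.le, mul_comm]
  have hterm : ∀ l : ℕ, ∫ x in Ioi (0 : ℝ), Real.exp (-x) * x ^ (M - 1) *
      ((w * x) ^ l / l.factorial) = w ^ l * (Real.Gamma (M + l) / l.factorial) := by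
    intro l
    have e : ∀ x ∈ Ioi (0 : ℝ), Real.exp (-x) * x ^ (M - 1) * ((w * x) ^ l / l.factorial) =
        w ^ l / l.factorial * (Real.exp (-x) * x ^ (M + l - 1)) := by
      intro x hx
      rw [show M + l - 1 = (M - 1) + l by ring, Real.rpow_add hx, Real.rpow_natCast, mul_pow]
      ring
    rw [setIntegral_congr_fun measurableSet_Ioi e, integral_const_mul,
      integral_exp_neg_mul_rpow (by positivity)]
    ring
  simp_rw [← hterm]
  rw [← (hval w hw2).2]
  -- Expand e^{wx} in the Gamma integral; the same expansion with |w| < 1 dominates.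
  refine hasSum_integral_of_dominated_convergence
    (fun l x => Real.exp (-x) * x ^ (M - 1) * ((|w| * x) ^ l / l.factorial)) (fun l => ?_)
    (fun l => ?_) ?_ ?_ ?_
  · refine ContinuousOn.aestronglyMeasurable ?_ measurableSet_Ioi
    refine ContinuousOn.mul (ContinuousOn.mul (by fun_prop)
      (ContinuousOn.rpow_const (by fun_prop) fun x hx => Or.inl (ne_of_gt hx))) (by fun_prop)
  · refine (ae_restrict_iff' measurableSet_Ioi).2 (.of_forall fun x hx => ?_)
    have hx' : (0 : ℝ) < x := hx
    have e1 : ‖Real.exp (-x) * x ^ (M - 1)‖ = Real.exp (-x) * x ^ (M - 1) :=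
      Real.norm_of_nonneg (by positivity)
    rw [norm_mul, e1, norm_div, norm_pow, Real.norm_eq_abs, abs_mul, abs_of_pos hx',
      Real.norm_of_nonneg (by positivity : (0 : ℝ) ≤ l.factorial)]
  · exact .of_forall fun x => ((hasSum_exp_mul _).summable.mul_left _)
  · simp_rw [tsum_mul_left, (hasSum_exp_mul _).tsum_eq]
    exact (hval |w| hw).1
  · exact .of_forall fun x => ((hasSum_exp_mul _).mul_left _)

/-- The weight is the factor 2n + λ of the norming constant, written for n = m + l as M + 2l with M
= 2m + λ. It amounts to M times the binomial series plus twice its image under w d/dw. -/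
lemma hasSum_add_two_mul_Gamma {M w : ℝ} (hM : 0 < M) (hw : |w| < 1) :
    HasSum (fun l : ℕ => w ^ l * (Real.Gamma (M + l) / l.factorial) * (M + 2 * l))
      (Real.Gamma (M + 1) * ((1 + w) * (1 - w) ^ (-(M + 1)))) := by
  have hw' : 0 < 1 - w := by linarith [(abs_lt.1 hw).2]
  have h1 := (hasSum_Gamma_mul_pow hM hw).mul_right M
  have h2 := (hasSum_Gamma_mul_pow (M := M + 1) (by linarith) hw).mul_left (2 * w)
  have h3 : HasSum (fun l : ℕ => w ^ l * (Real.Gamma (M + l) / l.factorial) * (2 * l))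
      (2 * w * (Real.Gamma (M + 1) * (1 - w) ^ (-(M + 1)))) := by
    rw [← hasSum_nat_add_iff' 1]
    simp only [Finset.range_one, Finset.sum_singleton, Nat.cast_zero, mul_zero, sub_zero]
    refine h2.congr_fun ?_
    intro l
    rw [Nat.factorial_succ, pow_succ, show M + ((l + 1 : ℕ) : ℝ) = M + 1 + l by push_cast; ring]
    have : (l.factorial : ℝ) ≠ 0 := by positivity
    push_cast
    field_simp
  have e : Real.Gamma (M + 1) * ((1 + w) * (1 - w) ^ (-(M + 1))) =
      Real.Gamma M * (1 - w) ^ (-M) * M + 2 * w * (Real.Gamma (M + 1) * (1 - w) ^ (-(M + 1))) := by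
    rw [Real.Gamma_add_one hM.ne', neg_add, Real.rpow_add hw', Real.rpow_neg_one]
    field_simp
    ring
  rw [e]
  exact (h1.add h3).congr_fun fun l => by ring

lemma hasSum_besselE_mul_besselE (hα : -(1 / 2) < α) (hβ : -(1 / 2) < β) (ξ η : ℝ) :
    HasSum (fun m => besselForm α β m ξ η) (besselE α ξ * besselE β η) := by
  have h1 := (summable_besselE hα ξ).norm
  have h2 := (summable_besselE hβ η).norm
  have e : ∀ m, besselForm α β m ξ η = ∑ p ∈ Finset.HasAntidiagonal.antidiagonal m,
      (besselCoeff α p.1 * ξ ^ p.1) * (besselCoeff β p.2 * η ^ p.2) := fun m =>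
    Finset.sum_congr rfl fun p _ => by ring
  simp_rw [e]
  rw [besselE, besselE, tsum_mul_tsum_eq_tsum_sum_antidiagonal_of_summable_norm h1 h2]
  exact (summable_norm_sum_mul_antidiagonal_of_summable_norm h1 h2).of_norm.hasSum

lemma besselForm_nonneg (hα : -(1 / 2) < α) (hβ : -(1 / 2) < β) (m : ℕ) {ξ η : ℝ} (hξ : 0 ≤ ξ)
    (hη : 0 ≤ η) : 0 ≤ besselForm α β m ξ η :=
  Finset.sum_nonneg fun p _ => by
    have := besselCoeff_pos hα p.1
    have := besselCoeff_pos hβ p.2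
    positivity

lemma besselForm_zero_pos (hα : -(1 / 2) < α) (hβ : -(1 / 2) < β) (ξ η : ℝ) :
    0 < besselForm α β 0 ξ η := by
  simpa [besselForm] using mul_pos (besselCoeff_pos hα 0) (besselCoeff_pos hβ 0)

lemma besselForm_mul (m : ℕ) (c ξ η : ℝ) :
    besselForm α β m (c * ξ) (c * η) = c ^ m * besselForm α β m ξ η := by
  rw [besselForm, besselForm, Finset.mul_sum]
  refine Finset.sum_congr rfl fun p hp => ?_
  rw [mul_pow, mul_pow, ← Finset.HasAntidiagonal.mem_antidiagonal.1 hp, pow_add]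
  ring

/-- The homogeneous part of degree m carries (z/2)^{2m}, so each term integrates to a Gamma value.
All terms are nonnegative, so the series dominates itself. -/
lemma hasSum_besselLaplace (hα : -(1 / 2) < α) (hβ : -(1 / 2) < β) (hl : 0 < α + β + 1) {B D : ℝ}
    (hB : 0 < B) (hD : 0 < D) (hBD : B + D < 1) :
    HasSum (fun m : ℕ => besselForm α β m (B ^ 2) (D ^ 2) *
      (Real.Gamma (2 * m + (α + β + 1)) * 2 ^ (1 - (2 * m + (α + β + 1)))))
      (besselLaplace α β 0 0 B D) := by
  set f : ℕ → ℝ → ℝ := fun m z => Real.exp (-z) * (z / 2) ^ (α + β) *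
    ((z / 2) ^ 2) ^ m * besselForm α β m (B ^ 2) (D ^ 2) with hf
  have hsum : ∀ z, HasSum (fun m => f m z) (besselProd α β 0 0 B D z) := by
    intro z
    have h := (hasSum_besselE_mul_besselE hα hβ ((z / 2) ^ 2 * B ^ 2)
      ((z / 2) ^ 2 * D ^ 2)).mul_left (Real.exp (-z) * (z / 2) ^ (α + β))
    simp only [besselForm_mul] at h
    have e : besselProd α β 0 0 B D z = Real.exp (-z) * (z / 2) ^ (α + β) *
        (besselE α ((z / 2) ^ 2 * B ^ 2) * besselE β ((z / 2) ^ 2 * D ^ 2)) := by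
      simp only [besselProd, besselH, Real.rpow_zero, add_zero, one_mul]
      ring_nf
    rw [e]
    exact h.congr_fun fun m => by simp only [hf]; ring
  have hterm : ∀ m : ℕ, ∫ z in Ioi (0 : ℝ), f m z = besselForm α β m (B ^ 2) (D ^ 2) *
      (Real.Gamma (2 * m + (α + β + 1)) * 2 ^ (1 - (2 * m + (α + β + 1)))) := by
    intro m
    have e : ∀ z ∈ Ioi (0 : ℝ), f m z =
        besselForm α β m (B ^ 2) (D ^ 2) * 2 ^ (1 - (2 * m + (α + β + 1))) *
          (Real.exp (-z) * z ^ (2 * m + (α + β + 1) - 1)) := by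
      intro z hz
      have hz' : (0 : ℝ) < z := hz
      have e1 : ((z / 2) ^ 2) ^ m * (z / 2) ^ (α + β) =
          z ^ (2 * (m : ℝ) + (α + β + 1) - 1) * 2 ^ (1 - (2 * (m : ℝ) + (α + β + 1))) := by
        rw [← pow_mul, ← Real.rpow_natCast, ← Real.rpow_add (by positivity),
          Real.div_rpow hz'.le zero_le_two, div_eq_mul_inv, ← Real.rpow_neg zero_le_two]
        push_cast
        ring_nf
      simp only [hf]
      linear_combination (Real.exp (-z) * besselForm α β m (B ^ 2) (D ^ 2)) * e1
    rw [setIntegral_congr_fun measurableSet_Ioi e, integral_const_mul,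
      integral_exp_neg_mul_rpow (by positivity)]
    ring
  simp_rw [← hterm]
  refine hasSum_integral_of_dominated_convergence f (fun m => ?_) (fun m => ?_) ?_ ?_ ?_
  · refine ContinuousOn.aestronglyMeasurable ?_ measurableSet_Ioi
    exact ((continuousOn_weight _).mul (by fun_prop)).mul (by fun_prop)
  · refine (ae_restrict_iff' measurableSet_Ioi).2 (.of_forall fun z hz => ?_)
    have hz' : (0 : ℝ) < z := hz
    have := besselForm_nonneg hα hβ m (sq_nonneg B) (sq_nonneg D)
    exact (Real.norm_of_nonneg (by positivity)).le
  · exact .of_forall fun z => (hsum z).summable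
  · simp_rw [fun z => (hsum z).tsum_eq]
    exact integrableOn_besselProd hα hβ le_rfl le_rfl hB hD hBD
  · exact .of_forall hsum

/-- Compared with the Laplace series there is one extra factor 2m + λ. The Laplace series still
converges at (rB, rD) for some r > 1, and Bernoulli's inequality bounds that factor by a multiple of
r^{2m}. The ratio 1/4 is the supremum of w/(1+w)² on (0, 1). -/
lemma summable_besselForm_mul_Gamma (hα : -(1 / 2) < α) (hβ : -(1 / 2) < β)
    (hl : 0 < α + β + 1) {B D : ℝ} (hB : 0 < B) (hD : 0 < D) (hBD : B + D < 1) :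
    Summable fun m : ℕ => besselForm α β m (B ^ 2) (D ^ 2) *
      Real.Gamma (2 * m + (α + β + 1) + 1) * (1 / 4) ^ m := by
  obtain ⟨r, hr1, hr2⟩ : ∃ r : ℝ, 1 < r ∧ r * (B + D) < 1 := by
    have hBD0 : 0 < B + D := by positivity
    obtain ⟨r, h1, h2⟩ := exists_between ((one_lt_inv₀ hBD0).2 hBD)
    exact ⟨r, h1, by rwa [← lt_div_iff₀ hBD0, one_div]⟩
  have hr0 : 0 < r := by linarith
  have h := (hasSum_besselLaplace hα hβ hl (B := r * B) (D := r * D) (by positivity)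
    (by positivity) (by linarith)).summable
  refine Summable.of_nonneg_of_le (fun m => ?_) (fun m => ?_)
    (h.mul_left (((α + β + 1) + 1 / (r - 1)) * 2 ^ (α + β)))
  · have := besselForm_nonneg hα hβ m (sq_nonneg B) (sq_nonneg D)
    have : 0 < Real.Gamma (2 * m + (α + β + 1) + 1) := Real.Gamma_pos_of_pos (by positivity)
    positivity
  · have hA := besselForm_nonneg hα hβ m (sq_nonneg B) (sq_nonneg D)
    have hG : 0 < Real.Gamma (2 * m + (α + β + 1)) := Real.Gamma_pos_of_pos (by positivity)
    have hm0 : (0 : ℝ) ≤ m := m.cast_nonneg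
    rw [mul_pow, mul_pow, besselForm_mul, Real.Gamma_add_one (by positivity)]
    have hp : 2 ^ (α + β) * (2 : ℝ) ^ (1 - (2 * (m : ℝ) + (α + β + 1))) = (1 / 4) ^ m := by
      rw [← Real.rpow_add two_pos, show α + β + (1 - (2 * (m : ℝ) + (α + β + 1))) =
        -((2 * m : ℕ) : ℝ) by push_cast; ring, Real.rpow_neg zero_le_two, Real.rpow_natCast,
        pow_mul, one_div, inv_pow]
      norm_num
    have hb : 2 * (m : ℝ) + (α + β + 1) ≤ ((α + β + 1) + 1 / (r - 1)) * (r ^ 2) ^ m := by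
      have hr3 : 0 < r - 1 := by linarith
      have b := one_add_mul_le_pow (a := r - 1) (by linarith) (2 * m)
      rw [add_sub_cancel, pow_mul] at b
      push_cast at b
      refine le_trans ?_ (mul_le_mul_of_nonneg_left b (by positivity))
      have : 1 / (r - 1) * (2 * m * (r - 1)) = 2 * m := by field_simp
      have h2 : 0 ≤ (α + β + 1) * (2 * m * (r - 1)) := by positivity
      have h3 : 0 < 1 / (r - 1) := by positivity
      linarith
    calc _ = besselForm α β m (B ^ 2) (D ^ 2) * Real.Gamma (2 * m + (α + β + 1)) * (1 / 4) ^ m *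
          (2 * m + (α + β + 1)) := by ring
      _ ≤ besselForm α β m (B ^ 2) (D ^ 2) * Real.Gamma (2 * m + (α + β + 1)) * (1 / 4) ^ m *
          (((α + β + 1) + 1 / (r - 1)) * (r ^ 2) ^ m) := by gcongr
      _ = _ := by rw [← hp]; ring

end

end JacobiRiesz
end

noncomputable section
namespace JacobiRiesz

/-! ### The Poisson kernel as a series with positive terms -/

section

lemma analyticAt_tsum_mul_pow {a : ℕ → ℝ} {r w : ℝ} (hr : 0 < r)
    (ha : Summable fun n => |a n| * r ^ n) (hw : |w| < r) :
    AnalyticAt ℝ (fun x => ∑' n, a n * x ^ n) w := by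
  set p := FormalMultilinearSeries.ofScalars ℝ a with hp
  lift r to NNReal using hr.le
  have hrad : (r : ENNReal) ≤ p.radius := by
    refine p.le_radius_of_summable ?_
    simpa [hp, FormalMultilinearSeries.ofScalars_norm] using ha
  have hpos : 0 < p.radius := lt_of_lt_of_le (by simpa using hr) hrad
  have h := (p.hasFPowerSeriesOnBall hpos).analyticAt_of_mem (y := w) <| by
    refine Metric.eball_subset_eball hrad ?_
    rw [Metric.mem_eball, edist_dist, Real.dist_eq, sub_zero]
    rw [← ENNReal.ofReal_coe_nnreal]
    exact (ENNReal.ofReal_lt_ofReal_iff (by simpa using hr)).2 hw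
  refine h.congr (.of_forall fun x => ?_)
  exact FormalMultilinearSeries.ofScalars_sum_eq a x

lemma hasSum_sum_antidiagonal {f : ℕ × ℕ → ℝ} {a : ℝ} (hf : HasSum f a) :
    HasSum (fun n => ∑ p ∈ Finset.HasAntidiagonal.antidiagonal n, f p) a := by
  have h := Finset.HasAntidiagonal.sigmaAntidiagonalEquivProd.hasSum_iff.2 hf
  refine h.sigma fun n => ?_
  have := hasSum_fintype (fun p : Finset.HasAntidiagonal.antidiagonal n => f p)
  rwa [Finset.sum_coe_sort (Finset.HasAntidiagonal.antidiagonal n) f] at this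

variable {l : ℝ} {A : ℕ → ℝ}

lemma pow_mul_one_add_rpow_eq {w : ℝ} (hw : w ∈ Ioo (0 : ℝ) 1) (m : ℕ) :
    w ^ m * ((1 + -w) * (1 - -w) ^ (-(2 * (m : ℝ) + l + 1))) =
      (1 - w) * (1 + w) ^ (-(l + 1)) * (w / (1 + w) ^ 2) ^ m := by
  have h1 : 0 < 1 + w := by linarith [hw.1]
  rw [sub_neg_eq_add, show -(2 * (m : ℝ) + l + 1) = -(l + 1) + -((2 * m : ℕ) : ℝ) by
    push_cast; ring, Real.rpow_add h1, Real.rpow_neg h1.le ((2 * m : ℕ) : ℝ), Real.rpow_natCast,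
    pow_mul, div_pow]
  field_simp
  ring

/-- Exchanging the sums needs absolute convergence, and absolute values turn w/(1+w)² into w/(1-w)².
For w < 1/10 this is still at most 1/4; it is not so for all w in (0, 1), hence the later
continuation. -/
lemma hasSum_poissonCoeff_of_small (hl : 0 < l) (hA0 : ∀ m, 0 ≤ A m)
    (hA : Summable fun m : ℕ => A m * Real.Gamma (2 * m + l + 1) * (1 / 4) ^ m) {w : ℝ}
    (hw : w ∈ Ioo (0 : ℝ) (1 / 10)) :
    HasSum (fun n => poissonCoeff l A n * w ^ n) ((1 - w) * (1 + w) ^ (-(l + 1)) *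
      ∑' m : ℕ, A m * Real.Gamma (2 * m + l + 1) * (w / (1 + w) ^ 2) ^ m) := by
  obtain ⟨hw0, hw1⟩ := hw
  have hw1' : w < 1 := by linarith
  set f : ℕ × ℕ → ℝ := fun p => A p.1 * w ^ p.1 * ((-w) ^ p.2 *
    (Real.Gamma (2 * p.1 + l + p.2) / p.2.factorial) * (2 * p.1 + l + 2 * p.2)) with hf
  have hM : ∀ m : ℕ, 0 < 2 * (m : ℝ) + l := fun m => by positivity
  have habs : ∀ p : ℕ × ℕ, ‖f p‖ = A p.1 * w ^ p.1 * (w ^ p.2 *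
      (Real.Gamma (2 * p.1 + l + p.2) / p.2.factorial) * (2 * p.1 + l + 2 * p.2)) := by
    intro p
    have := hA0 p.1
    have : 0 < Real.Gamma (2 * p.1 + l + p.2) := Real.Gamma_pos_of_pos (by positivity)
    simp only [hf, norm_mul, norm_pow, norm_neg]
    rw [Real.norm_of_nonneg (hA0 p.1), Real.norm_of_nonneg hw0.le,
      Real.norm_of_nonneg (by positivity : 0 ≤ Real.Gamma (2 * p.1 + l + p.2) / p.2.factorial),
      Real.norm_of_nonneg (by positivity : (0 : ℝ) ≤ 2 * p.1 + l + 2 * p.2)]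
  have hrow : ∀ m : ℕ, HasSum (fun k => ‖f (m, k)‖) (A m * w ^ m * (Real.Gamma (2 * m + l + 1) *
      ((1 + w) * (1 - w) ^ (-(2 * (m : ℝ) + l + 1))))) := by
    intro m
    simp_rw [habs]
    exact (hasSum_add_two_mul_Gamma (hM m) (by rwa [abs_of_pos hw0])).mul_left _
  have hsum : Summable f := by
    refine Summable.of_norm ((summable_prod_of_nonneg fun p => norm_nonneg _).2
      ⟨fun m => (hrow m).summable, ?_⟩)
    simp_rw [fun m => (hrow m).tsum_eq]
    refine Summable.of_nonneg_of_le (fun m => ?_) (fun m => ?_)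
      (hA.mul_left ((1 + w) * (1 - w) ^ (-(l + 1))))
    · have := hA0 m
      have : 0 < Real.Gamma (2 * m + l + 1) := Real.Gamma_pos_of_pos (by positivity)
      have : 0 < 1 - w := by linarith
      positivity
    · have h1 : 0 < 1 - w := by linarith
      have hG : 0 < Real.Gamma (2 * m + l + 1) := Real.Gamma_pos_of_pos (by positivity)
      have e : w ^ m * (1 - w) ^ (-(2 * (m : ℝ) + l + 1)) =
          (1 - w) ^ (-(l + 1)) * (w / (1 - w) ^ 2) ^ m := by
        rw [show -(2 * (m : ℝ) + l + 1) = -(l + 1) + -((2 * m : ℕ) : ℝ) by push_cast; ring,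
          Real.rpow_add h1, Real.rpow_neg h1.le ((2 * m : ℕ) : ℝ), Real.rpow_natCast,
          pow_mul, div_pow]
        field_simp
      have hb : w / (1 - w) ^ 2 ≤ 1 / 4 := by
        rw [div_le_div_iff₀ (by positivity) (by norm_num)]
        nlinarith
      have hb' : (w / (1 - w) ^ 2) ^ m ≤ (1 / 4) ^ m := pow_le_pow_left₀ (by positivity) hb m
      have hA0' := hA0 m
      calc _ = (1 + w) * A m * Real.Gamma (2 * m + l + 1) *
            (w ^ m * (1 - w) ^ (-(2 * (m : ℝ) + l + 1))) := by ring
        _ = (1 + w) * A m * Real.Gamma (2 * m + l + 1) *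
            ((1 - w) ^ (-(l + 1)) * (w / (1 - w) ^ 2) ^ m) := by rw [e]
        _ ≤ (1 + w) * A m * Real.Gamma (2 * m + l + 1) *
            ((1 - w) ^ (-(l + 1)) * (1 / 4) ^ m) := by gcongr
        _ = _ := by ring
  have hrow' : ∀ m : ℕ, HasSum (fun k => f (m, k)) ((1 - w) * (1 + w) ^ (-(l + 1)) *
      (A m * Real.Gamma (2 * m + l + 1) * (w / (1 + w) ^ 2) ^ m)) := by
    intro m
    have h := (hasSum_add_two_mul_Gamma (M := 2 * m + l) (w := -w) (hM m)
      (by rwa [abs_neg, abs_of_pos hw0])).mul_left (A m * w ^ m)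
    have e := pow_mul_one_add_rpow_eq (l := l) (w := w) ⟨hw0, hw1'⟩ m
    rw [show (1 - w) * (1 + w) ^ (-(l + 1)) *
      (A m * Real.Gamma (2 * m + l + 1) * (w / (1 + w) ^ 2) ^ m) =
      A m * Real.Gamma (2 * m + l + 1) * ((1 - w) * (1 + w) ^ (-(l + 1)) *
        (w / (1 + w) ^ 2) ^ m) by ring, ← e]
    rwa [show A m * Real.Gamma (2 * m + l + 1) * (w ^ m * ((1 + -w) *
      (1 - -w) ^ (-(2 * (m : ℝ) + l + 1)))) = A m * w ^ m * (Real.Gamma (2 * m + l + 1) *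
      ((1 + -w) * (1 - -w) ^ (-(2 * (m : ℝ) + l + 1)))) by ring]
  have hfin := hsum.hasSum
  have hS := (hfin.prod_fiberwise hrow').tsum_eq
  rw [← tsum_mul_left, hS]
  refine (hasSum_sum_antidiagonal hfin).congr_fun fun n => ?_
  rw [poissonCoeff, Finset.mul_sum, Finset.sum_mul]
  refine Finset.sum_congr rfl fun p hp => ?_
  have hn := Finset.HasAntidiagonal.mem_antidiagonal.1 hp
  simp only [hf]
  rw [← hn, neg_pow w p.2, pow_add,
    show 2 * (p.1 : ℝ) + p.2 + l = 2 * p.1 + l + p.2 by ring]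
  push_cast
  ring

lemma div_one_add_sq_mem {w : ℝ} (hw : w ∈ Ioo (0 : ℝ) 1) :
    |w / (1 + w) ^ 2| < 1 / 4 := by
  have h0 := hw.1
  have h1 := hw.2
  rw [abs_of_pos (by positivity), div_lt_div_iff₀ (by positivity) (by norm_num)]
  nlinarith [sq_pos_of_pos (sub_pos.2 h1)]

/-- The Poisson series, resummed, by analytic continuation in `w`. -/
lemma tsum_poissonCoeff_mul_pow (hl : 0 < l) (hA0 : ∀ m, 0 ≤ A m)
    (hA : Summable fun m : ℕ => A m * Real.Gamma (2 * m + l + 1) * (1 / 4) ^ m)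
    (hc : ∀ w ∈ Ioo (0 : ℝ) 1, Summable fun n => |poissonCoeff l A n| * w ^ n) {w : ℝ}
    (hw : w ∈ Ioo (0 : ℝ) 1) :
    ∑' n, poissonCoeff l A n * w ^ n = (1 - w) * (1 + w) ^ (-(l + 1)) *
      ∑' m : ℕ, A m * Real.Gamma (2 * m + l + 1) * (w / (1 + w) ^ 2) ^ m := by
  have hL : AnalyticOnNhd ℝ (fun w => ∑' n, poissonCoeff l A n * w ^ n) (Ioo 0 1) := by
    intro w hw
    obtain ⟨r, h1, h2⟩ := exists_between hw.2
    have hr : 0 < r := hw.1.trans h1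
    exact analyticAt_tsum_mul_pow hr (hc r ⟨hr, h2⟩) (by rwa [abs_of_pos hw.1])
  have hR : AnalyticOnNhd ℝ (fun w : ℝ => (1 - w) * (1 + w) ^ (-(l + 1)) *
      ∑' m : ℕ, A m * Real.Gamma (2 * m + l + 1) * (w / (1 + w) ^ 2) ^ m) (Ioo 0 1) := by
    intro w hw
    have h0 : 0 < 1 + w := by linarith [hw.1]
    have a1 : AnalyticAt ℝ (fun w : ℝ => 1 - w) w := by fun_prop
    have a2 : AnalyticAt ℝ (fun w : ℝ => (1 + w) ^ (-(l + 1))) w := by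
      have b : AnalyticAt ℝ (fun w : ℝ => 1 + w) w := by fun_prop
      refine (((b.log h0).mul (analyticAt_const (v := -(l + 1)))).rexp).congr ?_
      filter_upwards [b.continuousAt.eventually (lt_mem_nhds h0)] with x hx
      exact (Real.rpow_def_of_pos hx _).symm
    have a3 : AnalyticAt ℝ (fun w : ℝ => w / (1 + w) ^ 2) w :=
      AnalyticAt.div (by fun_prop) (by fun_prop) (by positivity)
    have a4 : AnalyticAt ℝ (fun v : ℝ => ∑' m : ℕ, A m * Real.Gamma (2 * m + l + 1) * v ^ m)
        (w / (1 + w) ^ 2) := by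
      -- w/(1+w)² stays strictly below 1/4 on all of (0, 1), so the resummed side is analytic on the
      -- whole interval.
      refine analyticAt_tsum_mul_pow (r := 1 / 4) (by norm_num) ?_ (div_one_add_sq_mem hw)
      refine hA.congr fun m => ?_
      have : 0 < Real.Gamma (2 * m + l + 1) := Real.Gamma_pos_of_pos (by positivity)
      rw [abs_of_nonneg (mul_nonneg (hA0 m) this.le)]
    exact (a1.mul a2).mul (AnalyticAt.comp (f := fun w : ℝ => w / (1 + w) ^ 2) a4 a3)
  refine hL.eqOn_of_preconnected_of_eventuallyEq hR isPreconnected_Ioo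
    (z₀ := 1 / 20) ⟨by norm_num, by norm_num⟩ ?_ hw
  filter_upwards [Ioo_mem_nhds (a := (0 : ℝ)) (b := 1 / 10) (x := 1 / 20) (by norm_num)
    (by norm_num)] with w hw
  exact (hasSum_poissonCoeff_of_small hl hA0 hA hw).tsum_eq

end

end JacobiRiesz
end

noncomputable section
namespace JacobiRiesz

/-! ### The time integral of the Poisson kernel -/

section

/-- The building blocks of the resummed Poisson kernel. -/
def poissonBlock (M t : ℝ) : ℝ :=
  Real.exp (-(M / 2) * t) * ((1 - Real.exp (-t)) * (1 + Real.exp (-t)) ^ (-(M + 1)))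

lemma poissonBlock_nonneg (M : ℝ) {t : ℝ} (ht : 0 < t) : 0 ≤ poissonBlock M t := by
  have : Real.exp (-t) ≤ 1 := Real.exp_le_one_iff.2 (by linarith)
  have : 0 ≤ 1 - Real.exp (-t) := by linarith
  unfold poissonBlock
  positivity

lemma integral_poissonBlock {M : ℝ} (hM : 0 < M) :
    IntegrableOn (poissonBlock M) (Ioi 0) ∧
      ∫ t in Ioi (0 : ℝ), poissonBlock M t = 2 / M * 2 ^ (-M) := by
  -- An explicit antiderivative: the factor 1 - e^{-t} is what differentiating e^{-Mt/2}
  -- (1+e^{-t})^{-M} produces.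
  set F : ℝ → ℝ := fun t =>
    -(2 / M) * (Real.exp (-(M / 2) * t) * (1 + Real.exp (-t)) ^ (-M)) with hF
  have hder : ∀ t, HasDerivAt F (poissonBlock M t) t := by
    intro t
    have h1 : HasDerivAt (fun t => Real.exp (-(M / 2) * t))
        (Real.exp (-(M / 2) * t) * (-(M / 2))) t := by
      simpa using ((hasDerivAt_id t).const_mul (-(M / 2))).exp
    have h2 : HasDerivAt (fun t : ℝ => 1 + Real.exp (-t)) (-Real.exp (-t)) t := by
      simpa using ((hasDerivAt_neg t).exp).const_add 1
    have hpos : 0 < 1 + Real.exp (-t) := by positivity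
    have h3 := h2.rpow_const (p := -M) (Or.inl hpos.ne')
    refine ((h1.mul h3).const_mul (-(2 / M))).congr_deriv ?_
    rw [poissonBlock, show -M = -(M + 1) + 1 by ring, Real.rpow_add_one hpos.ne',
      show -(M + 1) + 1 - 1 = -(M + 1) by ring]
    field_simp
    ring
  have hlim : Filter.Tendsto F Filter.atTop (nhds 0) := by
    have h1 : Filter.Tendsto (fun t => Real.exp (-(M / 2) * t)) Filter.atTop (nhds 0) :=
      Real.tendsto_exp_atBot.comp (Filter.tendsto_id.const_mul_atTop_of_neg (by linarith))
    have h2 : Filter.Tendsto (fun t : ℝ => (1 + Real.exp (-t)) ^ (-M)) Filter.atTop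
        (nhds ((1 + 0) ^ (-M))) := by
      refine Filter.Tendsto.rpow_const ?_ (Or.inl (by norm_num))
      exact (Real.tendsto_exp_atBot.comp Filter.tendsto_neg_atTop_atBot).const_add 1
    simpa [hF] using (h1.mul h2).const_mul (-(2 / M))
  have hcont : ContinuousWithinAt F (Ici 0) 0 := (hder 0).continuousAt.continuousWithinAt
  refine ⟨integrableOn_Ioi_deriv_of_nonneg hcont (fun t _ => hder t)
    (fun t ht => poissonBlock_nonneg M ht) hlim, ?_⟩
  rw [integral_Ioi_of_hasDerivAt_of_nonneg hcont (fun t _ => hder t)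
    (fun t ht => poissonBlock_nonneg M ht) hlim]
  simp only [hF, mul_zero, neg_zero, Real.exp_zero, one_mul]
  norm_num

lemma poissonBlock_eq {l t : ℝ} (ht : 0 < t) (m : ℕ) :
    poissonBlock (2 * m + l) t = Real.exp (-(l / 2) * t) *
      ((1 - Real.exp (-t)) * (1 + Real.exp (-t)) ^ (-(l + 1)) *
        (Real.exp (-t) / (1 + Real.exp (-t)) ^ 2) ^ m) := by
  rw [← pow_mul_one_add_rpow_eq (l := l) (w := Real.exp (-t))
    ⟨Real.exp_pos _, Real.exp_lt_one_iff.2 (by linarith)⟩ m, poissonBlock, ← Real.exp_nat_mul,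
    sub_neg_eq_add, ← sub_eq_add_neg,
    show -((2 * (m : ℝ) + l) / 2) * t = -(l / 2) * t + m * -t by ring, Real.exp_add]
  ring

variable {α β θ φ : ℝ}

lemma poissonTerm_eq (hl : 0 < α + β + 1) {t : ℝ} (n : ℕ) :
    poissonTerm α β t θ φ n = Real.exp (-((α + β + 1) / 2) * t) *
      (trigJacobi α β n θ * trigJacobi α β n φ * Real.exp (-t) ^ n) := by
  have : (0 : ℝ) ≤ n + (α + β + 1) / 2 := by positivity
  rw [poissonTerm, abs_of_nonneg this,
    show -t * (n + (α + β + 1) / 2) = -((α + β + 1) / 2) * t + n * -t by ring, Real.exp_add,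
    Real.exp_nat_mul]
  ring

theorem poissonKernel_spec (hα : -(1 / 2) < α) (hβ : -(1 / 2) < β)
    (hl : 0 < α + β + 1) (hθ : θ ∈ Ioo 0 Real.pi) (hφ : φ ∈ Ioo 0 Real.pi)
    (hne : θ ≠ φ) :
    (∀ t : ℝ, 0 < t → Summable (poissonTerm α β t θ φ)) ∧
    IntegrableOn (fun t => poissonKernel α β t θ φ) (Ioi 0) ∧
    ∫ t in Ioi (0 : ℝ), poissonKernel α β t θ φ =
      besselLaplace α β 0 0 (Real.sin (θ / 2) * Real.sin (φ / 2))
        (Real.cos (θ / 2) * Real.cos (φ / 2)) := by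
  set B := Real.sin (θ / 2) * Real.sin (φ / 2) with hBdef
  set D := Real.cos (θ / 2) * Real.cos (φ / 2) with hDdef
  have hB : 0 < B := mul_pos (sin_half_pos hθ) (sin_half_pos hφ)
  have hD : 0 < D := mul_pos (cos_half_pos hθ) (cos_half_pos hφ)
  have hBD : B + D < 1 := by
    have := (offDiag_sin_cos hθ hφ hne).q_pos
    linarith
  set A : ℕ → ℝ := fun m => besselForm α β m (B ^ 2) (D ^ 2)
  have hA0 : ∀ m, 0 ≤ A m := fun m => besselForm_nonneg hα hβ m (sq_nonneg B) (sq_nonneg D)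
  have hA := summable_besselForm_mul_Gamma hα hβ hl hB hD hBD
  have hcoeff : ∀ n, trigJacobi α β n θ * trigJacobi α β n φ = poissonCoeff (α + β + 1) A n :=
    fun n => trigJacobi_mul_trigJacobi hα hβ hl n hθ hφ
  have hc : ∀ w ∈ Ioo (0 : ℝ) 1, Summable fun n => |poissonCoeff (α + β + 1) A n| * w ^ n := by
    intro w hw
    simp_rw [← hcoeff]
    exact summable_abs_poissonCoeff hα hβ hl hθ hφ hw
  have hw : ∀ t : ℝ, 0 < t → Real.exp (-t) ∈ Ioo (0 : ℝ) 1 := fun t ht =>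
    ⟨Real.exp_pos _, Real.exp_lt_one_iff.2 (by linarith)⟩
  have hterm : ∀ t, poissonTerm α β t θ φ = fun n => Real.exp (-((α + β + 1) / 2) * t) *
      (poissonCoeff (α + β + 1) A n * Real.exp (-t) ^ n) := by
    intro t
    ext n
    rw [poissonTerm_eq hl, hcoeff]
  have hsum : ∀ t : ℝ, 0 < t → Summable (poissonTerm α β t θ φ) := by
    intro t ht
    rw [hterm]
    refine Summable.mul_left _ (Summable.of_norm ((hc _ (hw t ht)).congr fun n => ?_))
    rw [norm_mul, norm_pow, Real.norm_eq_abs, Real.norm_of_nonneg (Real.exp_pos _).le]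
  have hkernel : ∀ t ∈ Ioi (0 : ℝ), poissonKernel α β t θ φ =
      ∑' m : ℕ, A m * Real.Gamma (2 * m + (α + β + 1) + 1) *
        poissonBlock (2 * m + (α + β + 1)) t := by
    intro t ht
    rw [poissonKernel, hterm, tsum_mul_left, tsum_poissonCoeff_mul_pow hl hA0 hA hc (hw t ht),
      ← tsum_mul_left, ← tsum_mul_left]
    refine tsum_congr fun m => ?_
    rw [poissonBlock_eq ht]
    ring
  have hM : ∀ m : ℕ, 0 < 2 * (m : ℝ) + (α + β + 1) := fun m => by positivity
  have hΓ : ∀ m : ℕ, 0 < Real.Gamma (2 * m + (α + β + 1) + 1) := fun m =>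
    Real.Gamma_pos_of_pos (by positivity)
  have hint : ∀ m : ℕ, ∫ t in Ioi (0 : ℝ), A m * Real.Gamma (2 * m + (α + β + 1) + 1) *
      poissonBlock (2 * m + (α + β + 1)) t = A m *
        (Real.Gamma (2 * m + (α + β + 1)) * 2 ^ (1 - (2 * m + (α + β + 1)))) := by
    intro m
    rw [integral_const_mul, (integral_poissonBlock (hM m)).2, Real.Gamma_add_one (hM m).ne',
      sub_eq_add_neg, Real.rpow_add two_pos, Real.rpow_one]
    have := (hM m).ne'
    field_simp
  have hlap := hasSum_besselLaplace hα hβ hl hB hD hBD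
  -- The terms are nonnegative, so their norms have the integrals computed in `hint`, and those form
  -- the convergent Laplace series.
  have hInt := hasSum_integral_of_summable_integral_norm (μ := volume.restrict (Ioi 0))
    (F := fun (m : ℕ) t => A m * Real.Gamma (2 * m + (α + β + 1) + 1) *
      poissonBlock (2 * m + (α + β + 1)) t)
    (fun m => (integral_poissonBlock (hM m)).1.const_mul _) (by
      refine hlap.summable.congr fun m => ?_
      rw [← hint m]
      refine setIntegral_congr_fun measurableSet_Ioi fun t ht => ?_
      exact (Real.norm_of_nonneg (mul_nonneg (mul_nonneg (hA0 m) (hΓ m).le)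
        (poissonBlock_nonneg _ ht))).symm)
  simp_rw [hint] at hInt
  have heq : ∫ t in Ioi (0 : ℝ), poissonKernel α β t θ φ = besselLaplace α β 0 0 B D := by
    rw [setIntegral_congr_fun measurableSet_Ioi hkernel]
    exact hInt.unique hlap
  have hpos : 0 < besselLaplace α β 0 0 B D := by
    rw [← hlap.tsum_eq]
    have hnn : ∀ m : ℕ, 0 ≤ A m *
        (Real.Gamma (2 * m + (α + β + 1)) * 2 ^ (1 - (2 * m + (α + β + 1)))) := fun m => by
      have := Real.Gamma_pos_of_pos (hM m)
      have := hA0 m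
      positivity
    refine hlap.summable.tsum_pos hnn 0 ?_
    have := Real.Gamma_pos_of_pos (hM 0)
    have := besselForm_zero_pos hα hβ (B ^ 2) (D ^ 2)
    positivity
  -- A nonintegrable function has integral 0 by convention, so the positive value proves
  -- integrability.
  exact ⟨hsum, Integrable.of_integral_ne_zero (heq ▸ hpos.ne'), heq⟩

end

end JacobiRiesz
end

noncomputable section
namespace JacobiRiesz

/-! ### The weighted kernels -/

/-- With δ = aj and ε = bj the prefactor is u_j(θ) u_j(φ): the weights are absorbed into the orders
of the Bessel functions. -/
lemma besselProd_eq_zero_zero {α β δ ε B D z : ℝ} (hB : 0 < B) (hD : 0 < D) (hz : 0 < z) :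
    besselProd α β δ ε B D z = B ^ δ * D ^ ε * besselProd (α + δ) (β + ε) 0 0 B D z := by
  unfold besselProd besselH
  have h1 : (z * B / 2) ^ δ = (z / 2) ^ δ * B ^ δ := by
    rw [← Real.mul_rpow (by positivity) hB.le]
    ring_nf
  have h2 : (z * D / 2) ^ ε = (z / 2) ^ ε * D ^ ε := by
    rw [← Real.mul_rpow (by positivity) hD.le]
    ring_nf
  have h3 : (z / 2) ^ (α + δ + (β + ε)) = (z / 2) ^ (α + β) * (z / 2) ^ δ * (z / 2) ^ ε := by
    rw [← Real.rpow_add (by positivity), ← Real.rpow_add (by positivity)]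
    ring_nf
  rw [h1, h2, h3, Real.rpow_zero, Real.rpow_zero, add_zero, add_zero]
  ring

lemma besselLaplace_eq_zero_zero {α β δ ε B D : ℝ} (hB : 0 < B) (hD : 0 < D) :
    besselLaplace α β δ ε B D = B ^ δ * D ^ ε * besselLaplace (α + δ) (β + ε) 0 0 B D := by
  unfold besselLaplace
  rw [← integral_const_mul]
  exact setIntegral_congr_fun measurableSet_Ioi fun z hz => besselProd_eq_zero_zero hB hD hz

lemma besselLaplace_comm (α β δ ε B D : ℝ) :
    besselLaplace α β δ ε B D = besselLaplace β α ε δ D B := by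
  unfold besselLaplace besselProd
  refine integral_congr_ae (.of_forall fun z => ?_)
  dsimp only
  rw [add_comm α β, mul_comm (besselH α δ (z * B))]

lemma sinKernel_pi_sub (α β δ ε θ φ : ℝ) :
    sinKernel β α ε δ (Real.pi - θ) (Real.pi - φ) = (Real.cos (θ / 2))⁻¹ *
      besselLaplace α β δ ε (Real.sin (θ / 2) * Real.sin (φ / 2))
        (Real.cos (θ / 2) * Real.cos (φ / 2)) := by
  unfold sinKernel
  rw [besselLaplace_comm α β, sub_div, sub_div, Real.sin_pi_div_two_sub, Real.sin_pi_div_two_sub,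
    Real.cos_pi_div_two_sub, Real.cos_pi_div_two_sub]

section

variable {α β a b : ℝ} {j : ℕ} {θ φ : ℝ}

lemma weightedKernel_eq_sqrt_rho_mul (M : RankOneSpace) (hα : -(1 / 2) < α) (hβ : -(1 / 2) < β)
    (ha : 1 ≤ a) (hb : 0 ≤ b) (hj : 1 ≤ j) (hθ : θ ∈ Ioo 0 Real.pi) (hφ : φ ∈ Ioo 0 Real.pi)
    (hne : θ ≠ φ) :
    weightedKernel M α β a b j θ φ = Real.sqrt (rho M θ) *
      besselLaplace α β (a * j) (b * j) (Real.sin (θ / 2) * Real.sin (φ / 2))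
        (Real.cos (θ / 2) * Real.cos (φ / 2)) := by
  have hj1 : (1 : ℝ) ≤ j := by exact_mod_cast hj
  have haj : 1 ≤ a * j := by nlinarith
  have hbj : 0 ≤ b * j := by positivity
  have hs := sin_half_pos hθ
  have ht := sin_half_pos hφ
  have hs' := cos_half_pos hθ
  have ht' := cos_half_pos hφ
  obtain ⟨-, -, h⟩ := poissonKernel_spec (α := α + a * j) (β := β + b * j) (by linarith)
    (by linarith) (by linarith) hθ hφ hne
  rw [weightedKernel, angularKernel, h, besselLaplace_eq_zero_zero (α := α) (β := β)
    (δ := a * j) (ε := b * j) (mul_pos hs ht) (mul_pos hs' ht'), u, u, Real.mul_rpow hs.le ht.le, Real.mul_rpow hs'.le ht'.le]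
  ring

lemma sqrt_rho_of_not_isSphere {M : RankOneSpace} (hM : ¬ M.IsSphere) (hθ : θ ∈ Ioo 0 Real.pi) :
    Real.sqrt (rho M θ) = (Real.sin (θ / 2))⁻¹ := by
  have hs := sin_half_pos hθ
  have : rho M θ = ((Real.sin (θ / 2))⁻¹) ^ 2 := by
    cases M <;> simp_all [rho, RankOneSpace.IsSphere]
  rw [this, Real.sqrt_sq (by positivity)]

/-- 1/sin θ = (cot(θ/2) + tan(θ/2))/2 separates the singularities at 0 and π, each with a bounded
coefficient. -/
lemma sqrt_rho_of_isSphere {M : RankOneSpace} (hM : M.IsSphere) (hθ : θ ∈ Ioo 0 Real.pi) :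
    Real.sqrt (rho M θ) = (Real.cos (θ / 2) * (Real.sin (θ / 2))⁻¹ +
      Real.sin (θ / 2) * (Real.cos (θ / 2))⁻¹) / 2 := by
  have hs := sin_half_pos hθ
  have hc := cos_half_pos hθ
  have hθ' := Real.sin_pos_of_mem_Ioo hθ
  have h1 : rho M θ = ((Real.sin θ)⁻¹) ^ 2 := by
    cases M <;> simp_all [rho, RankOneSpace.IsSphere]
  have h2 : Real.sin θ = 2 * Real.sin (θ / 2) * Real.cos (θ / 2) := by
    rw [← Real.sin_two_mul]
    ring_nf
  rw [h1, Real.sqrt_sq (by positivity), h2]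
  field_simp
  linarith [Real.sin_sq_add_cos_sq (θ / 2)]

lemma weightedKernel_eq_of_not_isSphere {M : RankOneSpace} (hM : ¬ M.IsSphere)
    (hα : -(1 / 2) < α) (hβ : -(1 / 2) < β)
    (ha : 1 ≤ a) (hb : 0 ≤ b) (hj : 1 ≤ j) (hθ : θ ∈ Ioo 0 Real.pi) (hφ : φ ∈ Ioo 0 Real.pi)
    (hne : θ ≠ φ) :
    weightedKernel M α β a b j θ φ = sinKernel α β (a * j) (b * j) θ φ := by
  rw [weightedKernel_eq_sqrt_rho_mul M hα hβ ha hb hj hθ hφ hne, sqrt_rho_of_not_isSphere hM hθ,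
    sinKernel]

lemma weightedKernel_eq_of_isSphere {M : RankOneSpace} (hM : M.IsSphere)
    (hα : -(1 / 2) < α) (hβ : -(1 / 2) < β)
    (ha : 1 ≤ a) (hb : 0 ≤ b) (hj : 1 ≤ j) (hθ : θ ∈ Ioo 0 Real.pi) (hφ : φ ∈ Ioo 0 Real.pi)
    (hne : θ ≠ φ) :
    weightedKernel M α β a b j θ φ =
      (Real.cos (θ / 2) * sinKernel α β (a * j) (b * j) θ φ +
        Real.sin (θ / 2) * sinKernel β α (b * j) (a * j) (Real.pi - θ) (Real.pi - φ)) / 2 := by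
  rw [weightedKernel_eq_sqrt_rho_mul M hα hβ ha hb hj hθ hφ hne, sqrt_rho_of_isSphere hM hθ,
    sinKernel_pi_sub, sinKernel]
  ring

lemma pi_sub_mem_Ioo (hθ : θ ∈ Ioo 0 Real.pi) : Real.pi - θ ∈ Ioo 0 Real.pi :=
  ⟨by linarith [hθ.2], by linarith [hθ.1]⟩

lemma offDiagVol_pi_sub (α β θ x : ℝ) :
    offDiagVol β α (Real.sin ((Real.pi - θ) / 2)) (Real.cos ((Real.pi - θ) / 2)) x =
      offDiagVol α β (Real.sin (θ / 2)) (Real.cos (θ / 2)) x := by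
  unfold offDiagVol
  rw [sub_div, Real.sin_pi_div_two_sub, Real.cos_pi_div_two_sub, mul_comm]

lemma abs_pi_sub_sub (θ φ : ℝ) : |Real.pi - θ - (Real.pi - φ)| = |θ - φ| := by
  rw [abs_sub_comm θ φ]
  ring_nf

end

/-! ### Estimates of the weighted kernels on all spaces -/

section

variable {α β a b : ℝ}

lemma exists_sinKernel_pi_sub_le (hα : -(1 / 2) < α) (hβ : -(1 / 2) < β) (ha : 1 ≤ a)
    (hb : 1 ≤ b) : ∃ C : ℝ, 0 < C ∧ ∀ j : ℕ, 1 ≤ j →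
    ∀ θ ∈ Ioo 0 Real.pi, ∀ φ ∈ Ioo 0 Real.pi, θ ≠ φ →
      (j : ℝ) * |sinKernel β α (b * j) (a * j) (Real.pi - θ) (Real.pi - φ)| ≤
        C / (|θ - φ| * offDiagVol α β (Real.sin (θ / 2)) (Real.cos (θ / 2)) |θ - φ|) := by
  -- After reflection b supplies the gain that cancels the singularity at π, so b = 0 is not allowed
  -- here; a takes the other role.
  obtain ⟨C, hC, h⟩ := exists_sinKernel_le hβ hα hb (Or.inr ha)
  refine ⟨C, hC, fun j hj θ hθ φ hφ hne => ?_⟩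
  have := h j hj _ (pi_sub_mem_Ioo hθ) _ (pi_sub_mem_Ioo hφ) (fun h => hne (by linarith))
  rwa [abs_pi_sub_sub, offDiagVol_pi_sub] at this

lemma exists_hasFDerivAt_sinKernel_pi_sub (hα : -(1 / 2) < α) (hβ : -(1 / 2) < β)
    (ha : 1 ≤ a) (hb : b = 1 ∨ 2 ≤ b) : ∃ C : ℝ, 0 < C ∧ ∀ j : ℕ, 1 ≤ j →
    ∀ θ ∈ Ioo 0 Real.pi, ∀ φ ∈ Ioo 0 Real.pi, θ ≠ φ → ∃ f₁ f₂ : ℝ,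
      HasFDerivAt (fun p : ℝ × ℝ => sinKernel β α (b * j) (a * j) (Real.pi - p.1) (Real.pi - p.2))
        (f₁ • ContinuousLinearMap.fst ℝ ℝ ℝ + f₂ • ContinuousLinearMap.snd ℝ ℝ ℝ) (θ, φ) ∧
      (j : ℝ) * |f₁| ≤
        C / (|θ - φ| ^ 2 * offDiagVol α β (Real.sin (θ / 2)) (Real.cos (θ / 2)) |θ - φ|) ∧
      (j : ℝ) * |f₂| ≤
        C / (|θ - φ| ^ 2 * offDiagVol α β (Real.sin (θ / 2)) (Real.cos (θ / 2)) |θ - φ|) := by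
  obtain ⟨C, hC, h⟩ := exists_hasFDerivAt_sinKernel hβ hα hb (Or.inr ha)
  refine ⟨C, hC, fun j hj θ hθ φ hφ hne => ?_⟩
  obtain ⟨f₁, f₂, h0, h1, h2⟩ := h j hj _ (pi_sub_mem_Ioo hθ) _ (pi_sub_mem_Ioo hφ)
    (fun h => hne (by linarith))
  rw [abs_pi_sub_sub, offDiagVol_pi_sub] at h1 h2
  refine ⟨-f₁, -f₂, ?_, by rwa [abs_neg], by rwa [abs_neg]⟩
  have e1 : HasFDerivAt (fun p : ℝ × ℝ => (Real.pi - p.1, Real.pi - p.2))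
      (((-ContinuousLinearMap.fst ℝ ℝ ℝ)).prod (-ContinuousLinearMap.snd ℝ ℝ ℝ)) (θ, φ) :=
    (hasFDerivAt_fst.const_sub _).prodMk (hasFDerivAt_snd.const_sub _)
  refine (HasFDerivAt.comp (f := fun p : ℝ × ℝ => (Real.pi - p.1, Real.pi - p.2)) (θ, φ) h0
    e1).congr_fderiv ?_
  ext <;> simp

lemma exists_weightedKernel_le (M : RankOneSpace) (hα : -(1 / 2) < α) (hβ : -(1 / 2) < β)
    (ha : 1 ≤ a) (hb : b = 0 ∨ 1 ≤ b) (hM : M.IsSphere → 1 ≤ b) : ∃ C : ℝ, 0 < C ∧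
    ∀ j : ℕ, 1 ≤ j → ∀ θ ∈ Ioo 0 Real.pi, ∀ φ ∈ Ioo 0 Real.pi, θ ≠ φ →
      (j : ℝ) * |weightedKernel M α β a b j θ φ| ≤
        C / (|θ - φ| * offDiagVol α β (Real.sin (θ / 2)) (Real.cos (θ / 2)) |θ - φ|) := by
  have hb0 : 0 ≤ b := by rcases hb with rfl | hb <;> linarith
  obtain ⟨C, hC, h⟩ := exists_sinKernel_le hα hβ ha hb
  by_cases hS : M.IsSphere
  · obtain ⟨C', hC', h'⟩ := exists_sinKernel_pi_sub_le hα hβ ha (hM hS)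
    refine ⟨C + C', by positivity, fun j hj θ hθ φ hφ hne => ?_⟩
    rw [weightedKernel_eq_of_isSphere hS hα hβ ha hb0 hj hθ hφ hne]
    have k := h j hj θ hθ φ hφ hne
    have k' := h' j hj θ hθ φ hφ hne
    generalize sinKernel α β (a * j) (b * j) θ φ = X at *
    generalize sinKernel β α (b * j) (a * j) (Real.pi - θ) (Real.pi - φ) = Y at *
    have hs := sin_half_pos hθ
    have hc := cos_half_pos hθ
    have hs1 := Real.sin_le_one (θ / 2)
    have hc1 := Real.cos_le_one (θ / 2)
    have e : |(Real.cos (θ / 2) * X + Real.sin (θ / 2) * Y) / 2| ≤ |X| + |Y| := by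
      rw [abs_div, abs_two]
      have := abs_add_le (Real.cos (θ / 2) * X) (Real.sin (θ / 2) * Y)
      rw [abs_mul, abs_mul, abs_of_pos hs, abs_of_pos hc] at this
      nlinarith [abs_nonneg X, abs_nonneg Y]
    calc _ ≤ (j : ℝ) * (|X| + |Y|) := by gcongr
      _ = j * |X| + j * |Y| := by ring
      _ ≤ _ := (add_le_add k k').trans_eq (by rw [add_div])
  · refine ⟨C, hC, fun j hj θ hθ φ hφ hne => ?_⟩
    rw [weightedKernel_eq_of_not_isSphere hS hα hβ ha hb0 hj hθ hφ hne]
    exact h j hj θ hθ φ hφ hne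

lemma eventually_mem_offDiag {θ φ : ℝ} (hθ : θ ∈ Ioo 0 Real.pi) (hφ : φ ∈ Ioo 0 Real.pi)
    (hne : θ ≠ φ) : ∀ᶠ p : ℝ × ℝ in nhds (θ, φ),
      p.1 ∈ Ioo 0 Real.pi ∧ p.2 ∈ Ioo 0 Real.pi ∧ p.1 ≠ p.2 := by
  refine (continuous_fst.continuousAt.eventually_mem (isOpen_Ioo.mem_nhds hθ)).and
    ((continuous_snd.continuousAt.eventually_mem (isOpen_Ioo.mem_nhds hφ)).and ?_)
  exact (isOpen_ne_fun continuous_fst continuous_snd).mem_nhds hne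

lemma exists_hasFDerivAt_weightedKernel (M : RankOneSpace) (hα : -(1 / 2) < α)
    (hβ : -(1 / 2) < β) (ha : a = 1 ∨ 2 ≤ a) (hb : b = 0 ∨ 1 ≤ b)
    (hM : M.IsSphere → b = 1 ∨ 2 ≤ b) : ∃ C : ℝ, 0 < C ∧ ∀ j : ℕ, 1 ≤ j →
    ∀ θ ∈ Ioo 0 Real.pi, ∀ φ ∈ Ioo 0 Real.pi, θ ≠ φ → ∃ f₁ f₂ : ℝ,
      HasFDerivAt (fun p : ℝ × ℝ => weightedKernel M α β a b j p.1 p.2)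
        (f₁ • ContinuousLinearMap.fst ℝ ℝ ℝ + f₂ • ContinuousLinearMap.snd ℝ ℝ ℝ) (θ, φ) ∧
      (j : ℝ) * |f₁| ≤
        C / (|θ - φ| ^ 2 * offDiagVol α β (Real.sin (θ / 2)) (Real.cos (θ / 2)) |θ - φ|) ∧
      (j : ℝ) * |f₂| ≤
        C / (|θ - φ| ^ 2 * offDiagVol α β (Real.sin (θ / 2)) (Real.cos (θ / 2)) |θ - φ|) := by
  have hb0 : 0 ≤ b := by rcases hb with rfl | hb <;> linarith
  have ha1 : 1 ≤ a := by rcases ha with h | h <;> linarith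
  obtain ⟨C, hC, h⟩ := exists_hasFDerivAt_sinKernel hα hβ ha hb
  by_cases hS : M.IsSphere
  · have hb1 : 1 ≤ b := by rcases hM hS with h | h <;> linarith
    obtain ⟨C', hC', h'⟩ := exists_hasFDerivAt_sinKernel_pi_sub hα hβ ha1 (hM hS)
    obtain ⟨c, hc, g⟩ := exists_sinKernel_le hα hβ ha1 hb
    obtain ⟨c', hc', g'⟩ := exists_sinKernel_pi_sub_le hα hβ ha1 hb1
    refine ⟨C + C' + 4 * c + 4 * c', by positivity, fun j hj θ hθ φ hφ hne => ?_⟩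
    obtain ⟨f₁, f₂, h0, h1, h2⟩ := h j hj θ hθ φ hφ hne
    obtain ⟨f₁', f₂', h0', h1', h2'⟩ := h' j hj θ hθ φ hφ hne
    have k := g j hj θ hθ φ hφ hne
    have k' := g' j hj θ hθ φ hφ hne
    have hder := (((hasFDerivAt_cos_half_fst θ φ).mul h0).add
      ((hasFDerivAt_sin_half_fst θ φ).mul h0')).mul_const (1 / 2 : ℝ)
    dsimp only at hder
    generalize hX : sinKernel α β (a * j) (b * j) θ φ = X at *
    generalize hY : sinKernel β α (b * j) (a * j) (Real.pi - θ) (Real.pi - φ) = Y at *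
    have hs := sin_half_pos hθ
    have hcp := cos_half_pos hθ
    have hs1 := Real.sin_le_one (θ / 2)
    have hc1 := Real.cos_le_one (θ / 2)
    have hO := offDiag_sin_cos hθ hφ hne
    have hV := offDiagVol_pos (α := α) (β := β) hO
    have hx := hO.x_pos
    have hx4 : |θ - φ| ≤ 4 := by
      rw [abs_le]
      have := Real.pi_le_four
      constructor <;> linarith [hθ.1, hθ.2, hφ.1, hφ.2]
    have hj0 : (0 : ℝ) < j := by exact_mod_cast hj
    generalize offDiagVol α β (Real.sin (θ / 2)) (Real.cos (θ / 2)) |θ - φ| = V at *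
    generalize |θ - φ| = x at *
    -- Differentiating the coefficients cos(θ/2) and sin(θ/2) leaves undifferentiated kernels. Their
    -- size bound is good enough because distances are at most 4.
    have conv : ∀ r : ℝ, 0 < r → r / (x * V) ≤ 4 * r / (x ^ 2 * V) := by
      intro r hr
      rw [div_le_div_iff₀ (by positivity) (by positivity)]
      have : 0 < r * x * V := by positivity
      nlinarith
    have k1 := k.trans (conv c hc)
    have k1' := k'.trans (conv c' hc')
    refine ⟨(-(Real.sin (θ / 2) / 2) * X + Real.cos (θ / 2) * f₁ + Real.cos (θ / 2) / 2 * Y +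
        Real.sin (θ / 2) * f₁') / 2, (Real.cos (θ / 2) * f₂ + Real.sin (θ / 2) * f₂') / 2,
      ?_, ?_, ?_⟩
    · refine (hder.congr_of_eventuallyEq ?_).congr_fderiv ?_
      -- The closed form is known only off the diagonal of the open square, an open set, which is
      -- enough for the derivative.
      · filter_upwards [eventually_mem_offDiag hθ hφ hne] with p hp
        rw [weightedKernel_eq_of_isSphere hS hα hβ ha1 hb0 hj hp.1 hp.2.1 hp.2.2]
        simp only [Pi.add_apply, Pi.mul_apply]
        ring
      · ext <;> simp <;> ring
    · have e : |(-(Real.sin (θ / 2) / 2) * X + Real.cos (θ / 2) * f₁ +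
          Real.cos (θ / 2) / 2 * Y + Real.sin (θ / 2) * f₁') / 2| ≤
          |f₁| + |f₁'| + |X| + |Y| := by
        rw [abs_div, abs_two]
        have q1 := abs_add_le (-(Real.sin (θ / 2) / 2) * X + Real.cos (θ / 2) * f₁ +
          Real.cos (θ / 2) / 2 * Y) (Real.sin (θ / 2) * f₁')
        have q2 := abs_add_le (-(Real.sin (θ / 2) / 2) * X + Real.cos (θ / 2) * f₁)
          (Real.cos (θ / 2) / 2 * Y)
        have q3 := abs_add_le (-(Real.sin (θ / 2) / 2) * X) (Real.cos (θ / 2) * f₁)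
        rw [abs_mul, abs_of_pos hs] at q1
        rw [abs_mul (Real.cos (θ / 2) / 2), abs_of_pos (half_pos hcp)] at q2
        rw [abs_mul, abs_mul, abs_neg, abs_of_pos hcp, abs_of_pos (half_pos hs)] at q3
        nlinarith [abs_nonneg X, abs_nonneg Y, abs_nonneg f₁, abs_nonneg f₁']
      calc _ ≤ (j : ℝ) * (|f₁| + |f₁'| + |X| + |Y|) := by gcongr
        _ = j * |f₁| + j * |f₁'| + j * |X| + j * |Y| := by ring
        _ ≤ _ := add_le_add (add_le_add (add_le_add h1 h1') k1) k1'
        _ = _ := by rw [← add_div, ← add_div, ← add_div]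
    · have e : |(Real.cos (θ / 2) * f₂ + Real.sin (θ / 2) * f₂') / 2| ≤ |f₂| + |f₂'| := by
        rw [abs_div, abs_two]
        have := abs_add_le (Real.cos (θ / 2) * f₂) (Real.sin (θ / 2) * f₂')
        rw [abs_mul, abs_mul, abs_of_pos hs, abs_of_pos hcp] at this
        nlinarith [abs_nonneg f₂, abs_nonneg f₂']
      calc _ ≤ (j : ℝ) * (|f₂| + |f₂'|) := by gcongr
        _ = j * |f₂| + j * |f₂'| := by ring
        _ ≤ _ := add_le_add h2 h2'
        _ = (C + C') / (x ^ 2 * V) := by rw [← add_div]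
        _ ≤ _ := div_le_div_of_nonneg_right (by linarith) (by positivity)
  · refine ⟨C, hC, fun j hj θ hθ φ hφ hne => ?_⟩
    obtain ⟨f₁, f₂, h0, h1, h2⟩ := h j hj θ hθ φ hφ hne
    refine ⟨f₁, f₂, h0.congr_of_eventuallyEq ?_, h1, h2⟩
    filter_upwards [eventually_mem_offDiag hθ hφ hne] with p hp
    exact weightedKernel_eq_of_not_isSphere hS hα hβ ha1 hb0 hj hp.1 hp.2.1 hp.2.2

lemma gradLength_le {K : ℝ → ℝ → ℝ} {θ φ f₁ f₂ : ℝ}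
    (h : HasFDerivAt (fun p : ℝ × ℝ => K p.1 p.2)
      (f₁ • ContinuousLinearMap.fst ℝ ℝ ℝ + f₂ • ContinuousLinearMap.snd ℝ ℝ ℝ) (θ, φ)) :
    gradLength K θ φ ≤ |f₁| + |f₂| := by
  have h1 : HasDerivAt (fun x => K x φ) f₁ θ := by
    have := HasFDerivAt.comp_hasDerivAt (f := fun x : ℝ => (x, φ)) θ h
      ((hasDerivAt_id θ).prodMk (hasDerivAt_const θ φ))
    exact this.congr_deriv (by simp)
  have h2 : HasDerivAt (fun y => K θ y) f₂ φ := by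
    have := HasFDerivAt.comp_hasDerivAt (f := fun y : ℝ => (θ, y)) φ h
      ((hasDerivAt_const φ θ).prodMk (hasDerivAt_id φ))
    exact this.congr_deriv (by simp)
  unfold gradLength
  rw [h1.deriv, h2.deriv]
  refine Real.sqrt_le_iff.2 ⟨by positivity, ?_⟩
  nlinarith [sq_abs f₁, sq_abs f₂, mul_nonneg (abs_nonneg f₁) (abs_nonneg f₂)]

end

end JacobiRiesz
end

/-! ### Passage from the volume majorant to the measure of balls -/

theorem theorem6 (M : JacobiRiesz.RankOneSpace) (α β a b : ℝ)
    (hα : -(1 / 2) < α) (hβ : -(1 / 2) < β)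
    (ha : a = 1 ∨ 2 ≤ a) (hb : b = 0 ∨ 1 ≤ b) :
    -- the series and the integral that define the kernels converge off the diagonal
    (∀ j : ℕ, 1 ≤ j → ∀ θ ∈ Set.Ioo 0 Real.pi, ∀ φ ∈ Set.Ioo 0 Real.pi, θ ≠ φ →
      (∀ t : ℝ, 0 < t →
        Summable (JacobiRiesz.poissonTerm (α + a * j) (β + b * j) t θ φ)) ∧
      MeasureTheory.IntegrableOn
        (fun t => JacobiRiesz.poissonKernel (α + a * j) (β + b * j) t θ φ) (Set.Ioi 0)) ∧
    -- size estimate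
    ((M.IsSphere → 1 ≤ b) →
      ∃ C₁ : ℝ, 0 < C₁ ∧ ∀ j : ℕ, 1 ≤ j →
        ∀ θ ∈ Set.Ioo 0 Real.pi, ∀ φ ∈ Set.Ioo 0 Real.pi, θ ≠ φ →
          |(j : ℝ) * JacobiRiesz.weightedKernel M α β a b j θ φ| ≤
            C₁ / (JacobiRiesz.jacobiMeasure α β).real (Metric.ball θ |θ - φ|)) ∧
    -- smoothness estimate
    ((M.IsSphere → b = 1 ∨ 2 ≤ b) →
      ∃ C₂ : ℝ, 0 < C₂ ∧ ∀ j : ℕ, 1 ≤ j →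
        ∀ θ ∈ Set.Ioo 0 Real.pi, ∀ φ ∈ Set.Ioo 0 Real.pi, θ ≠ φ →
          DifferentiableAt ℝ
            (fun p : ℝ × ℝ => JacobiRiesz.weightedKernel M α β a b j p.1 p.2) (θ, φ) ∧
          (j : ℝ) * JacobiRiesz.gradLength (JacobiRiesz.weightedKernel M α β a b j) θ φ ≤
            C₂ / (|θ - φ| *
              (JacobiRiesz.jacobiMeasure α β).real (Metric.ball θ |θ - φ|))) := by
  have ha1 : 1 ≤ a := by rcases ha with h | h <;> linarith
  have hb0 : 0 ≤ b := by rcases hb with rfl | hb <;> linarith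
  refine ⟨fun j hj θ hθ φ hφ hne => ?_, fun hM => ?_, fun hM => ?_⟩
  · have hj1 : (1 : ℝ) ≤ j := by exact_mod_cast hj
    have haj : 1 ≤ a * j := by nlinarith
    have hbj : 0 ≤ b * j := by positivity
    obtain ⟨h1, h2, -⟩ := JacobiRiesz.poissonKernel_spec (α := α + a * j) (β := β + b * j)
      (by linarith) (by linarith) (by linarith) hθ hφ hne
    exact ⟨h1, h2⟩
  · obtain ⟨C, hC, h⟩ := JacobiRiesz.exists_weightedKernel_le M hα hβ ha1 hb hM
    refine ⟨2 * C, by positivity, fun j hj θ hθ φ hφ hne => ?_⟩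
    have hx : 0 < |θ - φ| := abs_pos.2 (sub_ne_zero.2 hne)
    obtain ⟨m1, m2⟩ := JacobiRiesz.jacobiMeasure_ball hα hβ hθ hx
    have k := h j hj θ hθ φ hφ hne
    rw [abs_mul, abs_of_nonneg j.cast_nonneg]
    refine k.trans ?_
    rw [show C / (|θ - φ| * JacobiRiesz.offDiagVol α β (Real.sin (θ / 2)) (Real.cos (θ / 2))
      |θ - φ|) = 2 * C / (2 * (|θ - φ| * JacobiRiesz.offDiagVol α β (Real.sin (θ / 2))
        (Real.cos (θ / 2)) |θ - φ|)) by rw [mul_div_mul_left _ _ two_ne_zero]]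
    exact div_le_div_of_nonneg_left (by positivity) m1 m2
  · obtain ⟨C, hC, h⟩ := JacobiRiesz.exists_hasFDerivAt_weightedKernel M hα hβ ha hb hM
    -- One factor 2 for the two partial derivatives, one from the bound of the measure of the ball.
    refine ⟨4 * C, by positivity, fun j hj θ hθ φ hφ hne => ?_⟩
    have hx : 0 < |θ - φ| := abs_pos.2 (sub_ne_zero.2 hne)
    obtain ⟨m1, m2⟩ := JacobiRiesz.jacobiMeasure_ball hα hβ hθ hx
    obtain ⟨f₁, f₂, k0, k1, k2⟩ := h j hj θ hθ φ hφ hne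
    refine ⟨k0.differentiableAt, ?_⟩
    have hg := JacobiRiesz.gradLength_le k0
    have hj0 : (0 : ℝ) < j := by exact_mod_cast hj
    set V := JacobiRiesz.offDiagVol α β (Real.sin (θ / 2)) (Real.cos (θ / 2)) |θ - φ|
    calc _ ≤ (j : ℝ) * (|f₁| + |f₂|) := by gcongr
      _ = j * |f₁| + j * |f₂| := by ring
      _ ≤ C / (|θ - φ| ^ 2 * V) + C / (|θ - φ| ^ 2 * V) := add_le_add k1 k2
      _ = 4 * C / (|θ - φ| * (2 * (|θ - φ| * V))) := by
        rw [← add_div, show |θ - φ| * (2 * (|θ - φ| * V)) = 2 * (|θ - φ| ^ 2 * V) by ring,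
          show 4 * C = 2 * (C + C) by ring, mul_div_mul_left _ _ two_ne_zero]
      _ ≤ _ := by gcongr
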